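/- **Systems.** A *fair transition system* (fair TS) $\mathcal K$ over a finite set $\Sigma$ of observations consists of a finite set $W$ of states with an initial state, a relation $R\subseteq W\times W$ in which every state has a successor, a labeling $L:W\to\Sigma$ and a set $F\subseteq W$ of Büchi states. A *fair alternating transition system* (fair ATS) $\mathcal K$ consists of a finite set $W$ of states with an initial state, finite sets $A_1,A_2$ of actions of Agents 1 and 2, maps $P_i:W\to 2^{A_i}\setminus\{\emptyset\}$ (available actions), a labeling $L:W\to\Sigma$, a function $\delta:W\times A_1\times A_2\to W$ and a set $F\subseteq W$ of Büchi states. A *$w$-run* is an infinite sequence of states that starts in $w$ and follows $R$ (for an ATS: follows $\delta$ under available actions of both agents); it is *fair* if some state of $F$ occurs infinitely often in it. Let $\mathcal K,\mathcal K'$ be two such systems over the same $\Sigma$ (components of $\mathcal K'$ are primed). For $S\subseteq W\times W'$, a run $u'$ of $\mathcal K'$ *$S$-matches* a run $u$ of $\mathcal K$ if $(u_i,u'_i)\in S$ for all $i\ge 0$. **Fair simulation (TSs).** $S\subseteq W\times W'$ is a fair simulation of $\mathcal K$ by $\mathcal K'$ if for all $(w,w')\in W\times W'$: (1) if $S(w,w')$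 then $L(w)=L'(w')$; (2) there is a strategy $\tau:(W\times W')^*\times W\to W'$ such that if $S(w,w')$ and $u=u_0,u_1,\dots$ is a fair $w$-run of $\mathcal K$, then its outcome $u'$, given by $u'_i=\tau((u_0,u'_0),\dots,(u_{i-1},u'_{i-1}),u_i)$ for $i\ge 0$, is a fair $w'$-run of $\mathcal K'$ that $S$-matches $u$. Let $\preceq_{\mathsf{fair}}$ be the union of all fair simulations. **Fair alternating simulation (ATSs).** Consider strategies $\tau:(W\times W')^+\to A_1$, $\tau':(W\times W')^+\times A_1\to A_1'$, $\xi':(W\times W')^+\times A_1\times A_1'\to A_2'$ and $\xi:(W\times W')^+\times A_1\times A_1'\times A_2'\to A_2$ that only choose actions available at the last pair of states of the history. Starting from $(w,w')$, in each round $\tau,\tau',\xi',\xi$ choose in this order actions $a,a',b',b$, each seeing the history of pairs of states and the actions chosen before it in that round, and the pair of states $(v,v')$ is replaced by $(\delta(v,a,b),\delta'(v',a',b'))$; let $\rho$ and $\rho'$ be the runs that emerge in $\mathcal K$ and $\mathcal K'$. Let $\Theta_S(w,w')$ denote the condition: if $S(w,w')$ and $\rho$ is a fair $w$-run of $\mathcal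 K$, then $\rho'$ is a fair $w'$-run of $\mathcal K'$ and $S$-matches $\rho$. $S\subseteq W\times W'$ is a *weak* fair alternating simulation of $\mathcal K$ by $\mathcal K'$ if for all $(w,w')\in W\times W'$: $S(w,w')$ implies $L(w)=L'(w')$, and $\exists\tau'\,\forall\tau\,\exists\xi\,\forall\xi'\ \Theta_S(w,w')$. It is a *strong* one if the second condition is replaced by $\exists\tau'\,\exists\xi\,\forall\tau\,\forall\xi'\ \Theta_S(w,w')$. Let $\preceq^{\mathsf{weak}}_{\mathsf{fairalt}}$ and $\preceq^{\mathsf{strong}}_{\mathsf{fairalt}}$ be the unions of all weak and of all strong fair alternating simulations, respectively. **Running time** is measured on a unit-cost random access machine with words of $O(\log N)$ bits, where $N$ is the sum of the sizes of all sets ($\Sigma$, states, actions) of the two systems, and with operations $+,\dot-,\times,<,=$ on words. A single program works for all inputs. States, actions and observations are numbered, and the systems are given by their sizes, their initial states and the tables of $P_1,P_2,L,\delta,F$ (ATSs) or $R,L,F$ (TSs); the output is the table of the relation. **Theorem.** 1. For all fair ATSs $\mathcal K,\mathcal K'$ over the same observations, $\preceq^{\mathsf{weak}}_{\mathsf{fairalt}}$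 is a weak and $\preceq^{\mathsf{strong}}_{\mathsf{fairalt}}$ a strong fair alternating simulation (so they are the maximum ones), and $$\preceq^{\mathsf{weak}}_{\mathsf{fairalt}}\;=\;\preceq^{\mathsf{strong}}_{\mathsf{fairalt}}.$$ 2. Given two fair ATSs, $\preceq^{\mathsf{strong}}_{\mathsf{fairalt}}$ can be computed in time $$O\big(|W|^2\cdot|W'|^2\cdot|A_1|^2\cdot|A_1'|\cdot(|A_1'|\cdot|A_2'|+|A_2|)\big).$$ 3. For all fair TSs over the same observations, $\preceq_{\mathsf{fair}}$ is a fair simulation (so it is the maximum one). Given two fair TSs, $\preceq_{\mathsf{fair}}$ can be computed in time $$O\big(|W|\cdot|W'|\cdot(|W|\cdot|R'|+|W'|\cdot|R|)\big),$$ which is $O(n^3\cdot m)$ for $n=\max(|W|,|W'|)$ and $m=\max(|R|,|R'|)$. -/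

import Mathlib

open Filter

namespace FairSim

/-! ### Transition systems and alternating transition systems with a Büchi constraint -/

/-- The set of states that occur infinitely often in an infinite sequence. -/
def infOften {W : Type*} (u : ℕ → W) : Set W := {v | ∃ᶠ i in atTop, u i = v}

/-- Labeled transition systems (every state has a successor). -/
structure TS (Obs W : Type*) where
  init : W
  R : W → W → Prop
  total : ∀ w, ∃ v, R w v
  L : W → Obs

/-- Fair transition systems: a transition system with a set `F` of Büchi states. -/
structure FairTS (Obs W : Type*) extends TS Obs W where
  F : Set W

/-- The infinite sequence `u` is a fair `w`-run. -/
def FairTS.IsFairRun {Obs W : Type*} (K : FairTS Obs W) (w : W) (u : ℕ → W) : Prop :=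
  u 0 = w ∧ (∀ i, K.R (u i) (u (i + 1))) ∧ (infOften u ∩ K.F).Nonempty

/-- The number of transitions of a transition system. -/
noncomputable def TS.numTrans {Obs W : Type*} (K : TS Obs W) : ℕ :=
  {e : W × W | K.R e.1 e.2}.ncard

/-- Labeled alternating transition systems: `P₁ w` and `P₂ w` are the non-empty sets of actions
available to Agent 1 and to Agent 2 at `w`. -/
structure ATS (Obs W A₁ A₂ : Type*) where
  init : W
  P₁ : W → Set A₁
  P₂ : W → Set A₂
  P₁_nonempty : ∀ w, (P₁ w).Nonempty
  P₂_nonempty : ∀ w, (P₂ w).Nonempty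
  L : W → Obs
  δ : W → A₁ → A₂ → W

/-- Fair alternating transition systems: an ATS with a set `F` of Büchi states. -/
structure FairATS (Obs W A₁ A₂ : Type*) extends ATS Obs W A₁ A₂ where
  F : Set W

/-- The infinite sequence `u` is a fair `w`-run. -/
def FairATS.IsFairRun {Obs W A₁ A₂ : Type*} (K : FairATS Obs W A₁ A₂) (w : W) (u : ℕ → W) :
    Prop :=
  u 0 = w ∧ (∀ i, ∃ a ∈ K.P₁ (u i), ∃ b ∈ K.P₂ (u i), u (i + 1) = K.δ (u i) a b) ∧
    (infOften u ∩ K.F).Nonempty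

/-! ### Fair simulation of transition systems -/

section FairSimulation

variable {Obs W₁ W₂ : Type*}

/-- The history `(u₀,u₀'), …, (uᵢ₋₁,uᵢ₋₁')` that arises when the strategy `τ` answers the
sequence `u`; a strategy maps such a history and the next state `uᵢ` to the answer `uᵢ'`. -/
def outcomeHist (τ : List (W₁ × W₂) → W₁ → W₂) (u : ℕ → W₁) : ℕ → List (W₁ × W₂)
  | 0 => []
  | i + 1 => outcomeHist τ u i ++ [(u i, τ (outcomeHist τ u i) (u i))]

/-- The outcome `τ[u]`. -/
def outcome (τ : List (W₁ × W₂) → W₁ → W₂) (u : ℕ → W₁) (i : ℕ) : W₂ :=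
  τ (outcomeHist τ u i) (u i)

/-- `S` is a fair simulation of `K₁` by `K₂`. -/
def IsFairSimulation (K₁ : FairTS Obs W₁) (K₂ : FairTS Obs W₂) (S : W₁ → W₂ → Prop) : Prop :=
  ∀ w₁ w₂, (S w₁ w₂ → K₁.L w₁ = K₂.L w₂) ∧
    ∃ τ : List (W₁ × W₂) → W₁ → W₂, S w₁ w₂ → ∀ u : ℕ → W₁, K₁.IsFairRun w₁ u →
      K₂.IsFairRun w₂ (outcome τ u) ∧ ∀ i, S (u i) (outcome τ u i)

/-- The maximum fair simulation relation (the union of all fair simulations). -/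
def fairSim (K₁ : FairTS Obs W₁) (K₂ : FairTS Obs W₂) (w₁ : W₁) (w₂ : W₂) : Prop :=
  ∃ S, IsFairSimulation K₁ K₂ S ∧ S w₁ w₂

end FairSimulation

/-! ### Weak and strong fair alternating simulation

A non-empty history in `(W × W')⁺` is given as the list `h` of its pairs before the last one,
followed by its last pair `q`. The `Legal` predicates say that a strategy only chooses actions
that are available at the last pair. -/

section FairAlternating

variable {Obs W A₁ A₂ W' A₁' A₂' : Type*}

/-- Strategies `τ` of Agent 1 in `K`. -/
abbrev Strat₁ (W W' A₁ : Type*) := List (W × W') → W × W' → A₁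

/-- Strategies `τ'` of Agent 1 in `K'`, who also sees the action of Agent 1 in `K`. -/
abbrev Strat₁' (W W' A₁ A₁' : Type*) := List (W × W') → W × W' → A₁ → A₁'

/-- Strategies `ξ'` of Agent 2 in `K'`, who also sees the actions of Agent 1 in `K` and `K'`. -/
abbrev Strat₂' (W W' A₁ A₁' A₂' : Type*) := List (W × W') → W × W' → A₁ → A₁' → A₂'

/-- Strategies `ξ` of Agent 2 in `K`, who also sees the actions of Agent 1 in `K` and of both
agents in `K'`. -/
abbrev Strat₂ (W W' A₁ A₁' A₂' A₂ : Type*) :=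
  List (W × W') → W × W' → A₁ → A₁' → A₂' → A₂

def Legal₁ (K : FairATS Obs W A₁ A₂) (τ : Strat₁ W W' A₁) : Prop :=
  ∀ h q, τ h q ∈ K.P₁ q.1

def Legal₁' (K' : FairATS Obs W' A₁' A₂') (τ' : Strat₁' W W' A₁ A₁') : Prop :=
  ∀ h q a, τ' h q a ∈ K'.P₁ q.2

def Legal₂' (K' : FairATS Obs W' A₁' A₂') (ξ' : Strat₂' W W' A₁ A₁' A₂') : Prop :=
  ∀ h q a a', ξ' h q a a' ∈ K'.P₂ q.2

def Legal₂ (K : FairATS Obs W A₁ A₂) (ξ : Strat₂ W W' A₁ A₁' A₂' A₂) : Prop :=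
  ∀ h q a a' b', ξ h q a a' b' ∈ K.P₂ q.1

/-- The past pairs and the current pair after `i` rounds of the joint play from `(w, w')`. -/
def play (K : FairATS Obs W A₁ A₂) (K' : FairATS Obs W' A₁' A₂') (w : W) (w' : W')
    (τ : Strat₁ W W' A₁) (τ' : Strat₁' W W' A₁ A₁')
    (ξ : Strat₂ W W' A₁ A₁' A₂' A₂) (ξ' : Strat₂' W W' A₁ A₁' A₂') :
    ℕ → List (W × W') × (W × W')
  | 0 => ([], (w, w'))
  | i + 1 =>
    let h := (play K K' w w' τ τ' ξ ξ' i).1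
    let q := (play K K' w w' τ τ' ξ ξ' i).2
    let a := τ h q
    let a' := τ' h q a
    let b' := ξ' h q a a'
    let b := ξ h q a a' b'
    (h ++ [q], (K.δ q.1 a b, K'.δ q.2 a' b'))

/-- If `S w w'` and the run `ρ` that emerges in `K` is a fair `w`-run, then the run `ρ'` that
emerges in `K'` is a fair `w'`-run and `S`-matches `ρ`. -/
def Succeeds (K : FairATS Obs W A₁ A₂) (K' : FairATS Obs W' A₁' A₂') (S : W → W' → Prop)
    (w : W) (w' : W') (τ : Strat₁ W W' A₁) (τ' : Strat₁' W W' A₁ A₁')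
    (ξ : Strat₂ W W' A₁ A₁' A₂' A₂) (ξ' : Strat₂' W W' A₁ A₁' A₂') : Prop :=
  let ρ : ℕ → W := fun i => (play K K' w w' τ τ' ξ ξ' i).2.1
  let ρ' : ℕ → W' := fun i => (play K K' w w' τ τ' ξ ξ' i).2.2
  S w w' → K.IsFairRun w ρ → K'.IsFairRun w' ρ' ∧ ∀ i, S (ρ i) (ρ' i)

/-- `S` is a weak fair alternating simulation of `K` by `K'`. -/
def IsWFAS (K : FairATS Obs W A₁ A₂) (K' : FairATS Obs W' A₁' A₂') (S : W → W' → Prop) : Prop :=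
  ∀ w w', (S w w' → K.L w = K'.L w') ∧
    ∃ τ' : Strat₁' W W' A₁ A₁', Legal₁' K' τ' ∧
      ∀ τ : Strat₁ W W' A₁, Legal₁ K τ →
        ∃ ξ : Strat₂ W W' A₁ A₁' A₂' A₂, Legal₂ K ξ ∧
          ∀ ξ' : Strat₂' W W' A₁ A₁' A₂', Legal₂' K' ξ' → Succeeds K K' S w w' τ τ' ξ ξ'

/-- `S` is a strong fair alternating simulation of `K` by `K'`. -/
def IsSFAS (K : FairATS Obs W A₁ A₂) (K' : FairATS Obs W' A₁' A₂') (S : W → W' → Prop) : Prop :=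
  ∀ w w', (S w w' → K.L w = K'.L w') ∧
    ∃ τ' : Strat₁' W W' A₁ A₁', Legal₁' K' τ' ∧
      ∃ ξ : Strat₂ W W' A₁ A₁' A₂' A₂, Legal₂ K ξ ∧
        ∀ τ : Strat₁ W W' A₁, Legal₁ K τ →
          ∀ ξ' : Strat₂' W W' A₁ A₁' A₂', Legal₂' K' ξ' → Succeeds K K' S w w' τ τ' ξ ξ'

/-- The maximum weak fair alternating simulation relation (the union of all of them). -/
def weakFairAlt (K : FairATS Obs W A₁ A₂) (K' : FairATS Obs W' A₁' A₂') (w : W) (w' : W') :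
    Prop :=
  ∃ S, IsWFAS K K' S ∧ S w w'

/-- The maximum strong fair alternating simulation relation (the union of all of them). -/
def strongFairAlt (K : FairATS Obs W A₁ A₂) (K' : FairATS Obs W' A₁' A₂') (w : W) (w' : W') :
    Prop :=
  ∃ S, IsSFAS K K' S ∧ S w w'

end FairAlternating

/-! ### The machine model: a word RAM with structured programs

A program has registers and arrays, both named by natural numbers, that hold natural numbers
below a bound `M` (machine words). Every operation on words, every array access, every assignment
and every test costs one step. Overflow is not possible: an operation whose result is not below
`M` cannot be executed. -/

/-- Contents of the registers and arrays. -/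
structure Store where
  reg : ℕ → ℕ
  arr : ℕ → ℕ → ℕ

inductive BinOp
  | add | sub | mul | lt | eq

/-- `sub` is truncated subtraction; `lt` and `eq` return `1` for true and `0` for false. -/
def BinOp.eval : BinOp → ℕ → ℕ → ℕ
  | .add, x, y => x + y
  | .sub, x, y => x - y
  | .mul, x, y => x * y
  | .lt, x, y => if x < y then 1 else 0
  | .eq, x, y => if x = y then 1 else 0

inductive Expr
  | const (n : ℕ)
  | reg (r : ℕ)
  | load (a : ℕ) (i : Expr)
  | op (o : BinOp) (e f : Expr)

def Expr.eval (s : Store) : Expr → ℕ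
  | .const n => n
  | .reg r => s.reg r
  | .load a i => s.arr a (i.eval s)
  | .op o e f => o.eval (e.eval s) (f.eval s)

/-- The number of steps needed to evaluate an expression: one for each of its nodes. -/
def Expr.cost : Expr → ℕ
  | .const _ => 1
  | .reg _ => 1
  | .load _ i => i.cost + 1
  | .op _ e f => e.cost + f.cost + 1

/-- All values that occur in the evaluation of the expression are below `M`. -/
def Expr.Fits (M : ℕ) (s : Store) : Expr → Prop
  | .const n => n < M
  | .reg r => s.reg r < M
  | .load a i => i.Fits M s ∧ s.arr a (i.eval s) < M
  | .op o e f => e.Fits M s ∧ f.Fits M s ∧ o.eval (e.eval s) (f.eval s) < M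

inductive Prog
  | skip
  | assign (r : ℕ) (e : Expr)
  | store (a : ℕ) (i e : Expr)
  | seq (p q : Prog)
  | cond (e : Expr) (p q : Prog)
  | loop (e : Expr) (p : Prog)

/-- `Exec M p s t s'`: with words below `M`, the program `p` started in `s` halts after exactly
`t` steps in `s'`. Tests succeed if and only if the value is nonzero. -/
inductive Exec (M : ℕ) : Prog → Store → ℕ → Store → Prop
  | skip (s : Store) : Exec M .skip s 1 s
  | assign (r : ℕ) (e : Expr) (s : Store) (he : e.Fits M s) :
      Exec M (.assign r e) s (e.cost + 1) { s with reg := Function.update s.reg r (e.eval s) }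
  | store (a : ℕ) (i e : Expr) (s : Store) (hi : i.Fits M s) (he : e.Fits M s) :
      Exec M (.store a i e) s (i.cost + e.cost + 1)
        { s with arr := Function.update s.arr a
                          (Function.update (s.arr a) (i.eval s) (e.eval s)) }
  | seq {p q : Prog} {s₁ s₂ s₃ : Store} {t₁ t₂ : ℕ} (hp : Exec M p s₁ t₁ s₂)
      (hq : Exec M q s₂ t₂ s₃) : Exec M (.seq p q) s₁ (t₁ + t₂) s₃
  | condTrue {e : Expr} {p q : Prog} {s₁ s₂ : Store} {t : ℕ} (he : e.Fits M s₁)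
      (h : e.eval s₁ ≠ 0) (hp : Exec M p s₁ t s₂) :
      Exec M (.cond e p q) s₁ (e.cost + 1 + t) s₂
  | condFalse {e : Expr} {p q : Prog} {s₁ s₂ : Store} {t : ℕ} (he : e.Fits M s₁)
      (h : e.eval s₁ = 0) (hq : Exec M q s₁ t s₂) :
      Exec M (.cond e p q) s₁ (e.cost + 1 + t) s₂
  | loopTrue {e : Expr} {p : Prog} {s₁ s₂ s₃ : Store} {t₁ t₂ : ℕ} (he : e.Fits M s₁)
      (h : e.eval s₁ ≠ 0) (hp : Exec M p s₁ t₁ s₂) (hl : Exec M (.loop e p) s₂ t₂ s₃) :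
      Exec M (.loop e p) s₁ (e.cost + 1 + t₁ + t₂) s₃
  | loopFalse {e : Expr} {p : Prog} {s : Store} (he : e.Fits M s) (h : e.eval s = 0) :
      Exec M (.loop e p) s (e.cost + 1) s

/-! ### Inputs and outputs -/

/-- The truth value of a proposition as a number. -/
noncomputable def bit (P : Prop) : ℕ :=
  open Classical in if P then 1 else 0

/-- The array with entries `f 0, …, f (n - 1)`, followed by zeros. -/
def table {n : ℕ} (f : Fin n → ℕ) : ℕ → ℕ :=
  fun j => if h : j < n then f ⟨j, h⟩ else 0

/-- The array that holds `f i j` at position `i * n + j`. -/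
def table₂ {m n : ℕ} (f : Fin m → Fin n → ℕ) : ℕ → ℕ :=
  table fun j : Fin (m * n) => f j.divNat j.modNat

/-- The array that holds `f i j l` at position `(i * n + j) * k + l`. -/
def table₃ {m n k : ℕ} (f : Fin m → Fin n → Fin k → ℕ) : ℕ → ℕ :=
  table₂ fun (q : Fin (m * n)) l => f q.divNat q.modNat l

/-- The initial store for a pair of fair ATSs whose states, actions and observations are numbered:
sizes and initial states are in the registers, the tables of `P₁`, `P₂`, `L`, `δ` and `F` of both
systems are in the arrays `1, …, 10`, everything else is zero. -/
noncomputable def atsInput {s n k₁ k₂ n' k₁' k₂' : ℕ}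
    (K : FairATS (Fin s) (Fin n) (Fin k₁) (Fin k₂))
    (K' : FairATS (Fin s) (Fin n') (Fin k₁') (Fin k₂')) : Store where
  reg := fun r => [s, n, k₁, k₂, K.init, n', k₁', k₂', K'.init].getD r 0
  arr := fun a =>
    [fun _ => 0,
      table₂ fun w a => bit (a ∈ K.P₁ w),
      table₂ fun w b => bit (b ∈ K.P₂ w),
      table fun w => K.L w,
      table₃ fun w a b => K.δ w a b,
      table fun w => bit (w ∈ K.F),
      table₂ fun w a => bit (a ∈ K'.P₁ w),
      table₂ fun w b => bit (b ∈ K'.P₂ w),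
      table fun w => K'.L w,
      table₃ fun w a b => K'.δ w a b,
      table fun w => bit (w ∈ K'.F)].getD a (fun _ => 0)

/-- The initial store for a pair of fair TSs whose states and observations are numbered:
sizes and initial states are in the registers, the tables of `R`, `L` and `F` of both systems are
in the arrays `1, …, 6`, everything else is zero. -/
noncomputable def tsInput {s n n' : ℕ} (K : FairTS (Fin s) (Fin n))
    (K' : FairTS (Fin s) (Fin n')) : Store where
  reg := fun r => [s, n, K.init, n', K'.init].getD r 0
  arr := fun a =>
    [fun _ => 0,
      table₂ fun w v => bit (K.R w v),
      table fun w => K.L w,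
      table fun w => bit (w ∈ K.F),
      table₂ fun w v => bit (K'.R w v),
      table fun w => K'.L w,
      table fun w => bit (w ∈ K'.F)].getD a (fun _ => 0)

/-- With words below `M`, the program `p` started in `s₀` halts after at most `T` steps, and then
array `0` holds the table of the relation `S`, row by row. -/
def Prog.Computes (p : Prog) (M : ℕ) (s₀ : Store) {n n' : ℕ} (S : Fin n → Fin n' → Prop)
    (T : ℕ) : Prop :=
  ∃ (t : ℕ) (s : Store), Exec M p s₀ t s ∧ t ≤ T ∧
    ∀ (w : Fin n) (w' : Fin n'), s.arr 0 (w * n' + w') = bit (S w w')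

end FairSim

open FairSim

/-! Fair simulation is read as a game between a spoiler, who moves for Agent 1 of `K` and Agent 2 of
`K'`, and a duplicator, who moves for the other two. A position is a pair of states with a flag that
is raised for good once the labels differ. It is bad if the state of `K` is a Büchi state, and good
if the flag is down and the state of `K'` is a Büchi state. The spoiler wants bad positions
infinitely often and good ones only finitely often.

A counter of the bad positions since the last good one turns this into a safety game. Let `N` be at
least the number of positions. If the spoiler cannot force the counter above `N`, the duplicator
keeps it bounded by a strategy that looks at position and counter only. Then infinitely many bad
positions entail infinitely many good ones (`frequently_good_of_bounded`), and these also show that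
the flag stays down, so all labels agree. If the spoiler can force the counter above `N`, then
nested fixed points, whose descending iteration stabilises within as many steps as there are
positions, provide ranks (`exists_rank_of_lose`). Decreasing them is a positional winning strategy
for the unbounded condition (`frequently_bad_of_progress`).

Hence the safe pairs form a strong simulation (`isSFAS_safePair`). They also contain every weak one
(`safePair_of_isWFAS`): a positional spoiler strategy does not depend on the duplicator's
strategies, so the order of quantifiers is immaterial. Both maximum relations are therefore the set
of safe pairs. A transition system is an alternating one in which Agent 1 chooses the successor
(`isFairSimulation_iff_isSFAS`), which gives the maximum fair simulation too.

The relation is computed by solving the safety game with `N = 2 * n * n'` on an explicit graph. Its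
edges are emitted by nested loops, and a backward search from a root below all overflowing positions
finds the lost nodes in time linear in the number of edges (`run_solve`). A round is split into
small moves through intermediate nodes that forget what is no longer needed: `movedId` keeps the new
state of `K'` but not the old one nor the actions that led there. So the costs of `K'` and of `K`
add up instead of multiplying, as in `k₁' * k₂' + k₂` and in `n * |R'| + n' * |R|`; there are `2 * n
* n' + 1` counter values. -/

namespace FairSim

/-! ### Büchi implication games with a counter

An arena is given by its monotone operator `Pre`: the position `x` is in `Pre Q` if the spoiler
can force that the next position is in `Q`. The spoiler wants to see `bad` positions infinitely
often and `good` positions only finitely often. -/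

section Game

variable {X : Type*}

/-- The counter after entering `y`: reset on good, incremented on bad positions. -/
noncomputable def bump (good bad : Set X) (c : ℕ) (y : X) : ℕ :=
  open Classical in if y ∈ good then 0 else if y ∈ bad then c + 1 else c

/-- The spoiler can force from `x` with counter `c` that the counter exceeds `N`. -/
def Lose (Pre : Set X → Set X) (good bad : Set X) (N : ℕ) (x : X) (c : ℕ) : Prop :=
  ∀ Q : X → ℕ → Prop, (∀ x c, N < c → Q x c) →
    (∀ x c, x ∈ Pre {y | Q y (bump good bad c y)} → Q x c) → Q x c

section

variable {Pre : Set X → Set X} {good bad : Set X} {N : ℕ}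

theorem Lose.of_lt {x : X} {c : ℕ} (h : N < c) : Lose Pre good bad N x c :=
  fun _ h₁ _ => h₁ _ _ h

/-- `Lose` is the intersection of all relations closed under the two rules; monotonicity of `Pre`
makes the intersection itself closed, so it is the least fixed point. Induction over it is
application to a relation. -/
theorem Lose.of_pre (hPre : Monotone Pre) {x : X} {c : ℕ}
    (h : x ∈ Pre {y | Lose Pre good bad N y (bump good bad c y)}) : Lose Pre good bad N x c :=
  fun Q h₁ h₂ => h₂ _ _ (hPre (fun _ (hy : Lose _ _ _ _ _ _) => hy Q h₁ h₂) h)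

theorem bump_mono {c c' : ℕ} (h : c ≤ c') (y : X) : bump good bad c y ≤ bump good bad c' y := by
  unfold bump
  split_ifs <;> omega

/-- A head start of the counter only helps the spoiler. This is why a pair met in mid-play with a
positive counter is still safe when the counter starts again at `0`. -/
theorem Lose.mono (hPre : Monotone Pre) {x : X} {c c' : ℕ} (h : Lose Pre good bad N x c)
    (hc : c ≤ c') : Lose Pre good bad N x c' := by
  refine h (fun x c => ∀ c', c ≤ c' → Lose Pre good bad N x c') ?_ ?_ c' hc
  · intro x c h c' hc
    exact Lose.of_lt (by omega)
  · intro x c h c' hc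
    exact Lose.of_pre hPre (hPre (fun y hy => (hy : ∀ c', _ ≤ c' → Lose _ _ _ _ _ c') _ (bump_mono hc y)) h)

end

/-- Membership in `A`, `B` or `C` for good, bad and neutral positions, respectively. -/
def byPrio (good bad A B C : Set X) : Set X :=
  {y | (y ∈ good ∧ y ∈ A) ∨ (y ∉ good ∧ y ∈ bad ∧ y ∈ B) ∨ (y ∉ good ∧ y ∉ bad ∧ y ∈ C)}

theorem byPrio_mono {good bad A B C A' B' C' : Set X} (hA : A ⊆ A') (hB : B ⊆ B') (hC : C ⊆ C') :
    byPrio good bad A B C ⊆ byPrio good bad A' B' C' := by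
  rintro y (⟨h, h'⟩ | ⟨h, h₁, h'⟩ | ⟨h, h₁, h'⟩)
  · exact Or.inl ⟨h, hA h'⟩
  · exact Or.inr (Or.inl ⟨h, h₁, hB h'⟩)
  · exact Or.inr (Or.inr ⟨h, h₁, hC h'⟩)

variable (Pre : Set X → Set X) (good bad : Set X)

/-- The approximants of the least `C` with `Pre (byPrio good bad A B C) ⊆ C`. -/
def reachStage (A B : Set X) : ℕ → Set X
  | 0 => ∅
  | n + 1 => Pre (byPrio good bad A B (reachStage A B n))

/-- The spoiler forces a path through neutral positions that ends in a good position in `A` or a bad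
one in `B`. -/
def reach (A B : Set X) : Set X := ⋃ n, reachStage Pre good bad A B n

/-- The approximants of the greatest fixed point of `reach A`. -/
def holdStage (A : Set X) : ℕ → Set X
  | 0 => Set.univ
  | i + 1 => reach Pre good bad A (holdStage A i)

/-- The spoiler visits bad positions again and again, and any good position entered lies in `A`. -/
def hold (A : Set X) : Set X := ⋂ i, holdStage Pre good bad A i

/-- The positions from which the spoiler wins with fewer than `j` visits of good positions. -/
def winStage : ℕ → Set X
  | 0 => ∅
  | j + 1 => hold Pre good bad (winStage j)

variable {Pre good bad}

/-! ### Monotonicity and stabilisation of the fixed-point approximants -/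

theorem exists_stable_of_monotone [Finite X] {f : ℕ → Set X} (hf : Monotone f) :
    ∃ n, ∀ m, n ≤ m → f n = f m :=
  WellFoundedGT.monotone_chain_condition ⟨f, hf⟩

theorem reachStage_mono (hPre : Monotone Pre) {A B A' B' : Set X} (hA : A ⊆ A') (hB : B ⊆ B')
    (n : ℕ) : reachStage Pre good bad A B n ⊆ reachStage Pre good bad A' B' n := by
  induction n with
  | zero => exact subset_rfl
  | succ n ih => exact hPre (byPrio_mono hA hB ih)

theorem reach_mono (hPre : Monotone Pre) {A B A' B' : Set X} (hA : A ⊆ A') (hB : B ⊆ B') :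
    reach Pre good bad A B ⊆ reach Pre good bad A' B' :=
  Set.iUnion_mono fun n => reachStage_mono hPre hA hB n

theorem monotone_reachStage (hPre : Monotone Pre) (A B : Set X) :
    Monotone (reachStage Pre good bad A B) := by
  refine monotone_nat_of_le_succ fun n => ?_
  induction n with
  | zero => exact Set.empty_subset _
  | succ n ih => exact hPre (byPrio_mono subset_rfl subset_rfl ih)

/-- By finiteness the union is already one of the stages, and `Pre` leads from each stage to the
next one. -/
theorem pre_reach_subset [Finite X] (hPre : Monotone Pre) (A B : Set X) :
    Pre (byPrio good bad A B (reach Pre good bad A B)) ⊆ reach Pre good bad A B := by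
  obtain ⟨n, hn⟩ := exists_stable_of_monotone (monotone_reachStage (good := good) (bad := bad)
    hPre A B)
  have h : reach Pre good bad A B ⊆ reachStage Pre good bad A B n := by
    refine Set.iUnion_subset fun m => ?_
    rcases le_total n m with h | h
    · exact (hn m h).ge
    · exact monotone_reachStage hPre A B h
  refine fun x hx => Set.mem_iUnion.2 ⟨n + 1, ?_⟩
  exact hPre (byPrio_mono subset_rfl subset_rfl h) hx

theorem holdStage_mono (hPre : Monotone Pre) {A A' : Set X} (hA : A ⊆ A') (i : ℕ) :
    holdStage Pre good bad A i ⊆ holdStage Pre good bad A' i := by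
  induction i with
  | zero => exact subset_rfl
  | succ i ih => exact reach_mono hPre hA ih

theorem antitone_holdStage (hPre : Monotone Pre) (A : Set X) :
    Antitone (holdStage Pre good bad A) := by
  refine antitone_nat_of_succ_le fun i => ?_
  induction i with
  | zero => exact Set.subset_univ _
  | succ i ih => exact reach_mono hPre subset_rfl ih

/-- A descending chain of subsets that stops once it repeats can shrink strictly at most `Nat.card
X` times. This is the source of the bound on the counter. -/
theorem hold_eq_holdStage [Finite X] (hPre : Monotone Pre) (A : Set X) {i : ℕ}
    (hi : Nat.card X ≤ i) : hold Pre good bad A = holdStage Pre good bad A i := by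
  have hanti := antitone_holdStage (good := good) (bad := bad) hPre A
  have hstab : ∀ k, holdStage Pre good bad A k = holdStage Pre good bad A (k + 1) → ∀ m, k ≤ m →
      holdStage Pre good bad A m = holdStage Pre good bad A k := by
    intro k hk m hm
    induction m, hm using Nat.le_induction with
    | base => rfl
    | succ m _ ih => rw [holdStage, ih]; exact hk.symm
  have hex : ∃ k ≤ i, holdStage Pre good bad A k = holdStage Pre good bad A (k + 1) := by
    by_contra! hne
    have hcard : ∀ k ≤ i + 1, (holdStage Pre good bad A k).ncard + k ≤ Nat.card X := by
      intro k hk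
      induction k with
      | zero => simp [holdStage, Set.ncard_univ]
      | succ k ih =>
        have h₁ : holdStage Pre good bad A (k + 1) ⊂ holdStage Pre good bad A k :=
          lt_of_le_of_ne (hanti (Nat.le_succ k)) (hne k (by omega)).symm
        have h₂ := Set.ncard_lt_ncard h₁ (Set.toFinite _)
        have h₃ := ih (by omega)
        omega
    have := hcard (i + 1) le_rfl
    omega
  obtain ⟨k, hki, hk⟩ := hex
  refine subset_antisymm (Set.iInter_subset _ i) (Set.subset_iInter fun m => ?_)
  rcases le_total m i with h | h
  · exact hanti h
  · rw [hstab k hk m (hki.trans h), hstab k hk i hki]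

theorem hold_eq_reach [Finite X] (hPre : Monotone Pre) (A : Set X) :
    hold Pre good bad A = reach Pre good bad A (hold Pre good bad A) := by
  conv_lhs => rw [hold_eq_holdStage hPre A (Nat.le_succ (Nat.card X))]
  rw [hold_eq_holdStage hPre A le_rfl]
  rfl

theorem monotone_winStage (hPre : Monotone Pre) : Monotone (winStage Pre good bad) := by
  refine monotone_nat_of_le_succ fun j => ?_
  induction j with
  | zero => exact Set.empty_subset _
  | succ j ih => exact Set.iInter_mono fun i => holdStage_mono hPre ih i

/-- If the spoiler can drive the counter beyond the number of positions, then positions can be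
ranked such that the spoiler can always force progress: the first rank does not increase and
decreases on good positions, and on neutral positions one of the ranks decreases. -/
theorem exists_rank_of_lose [Finite X] (hPre : Monotone Pre) {N : ℕ} (hN : Nat.card X ≤ N) :
    ∃ (T : Set X) (α γ : X → ℕ), (∀ x, Lose Pre good bad N x 0 → x ∈ T) ∧
      ∀ x ∈ T, x ∈ Pre {y | y ∈ T ∧ ((y ∈ good ∧ α y < α x) ∨ (y ∉ good ∧ y ∈ bad ∧ α y ≤ α x) ∨
        (y ∉ good ∧ y ∉ bad ∧ (α y < α x ∨ (α y = α x ∧ γ y < γ x))))} := by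
  classical
  set A := winStage Pre good bad with hA
  have hAmono : Monotone A := monotone_winStage hPre
  obtain ⟨j, hj⟩ := exists_stable_of_monotone hAmono
  have hfix : hold Pre good bad (A j) = A j := (hj (j + 1) (Nat.le_succ j)).symm
  -- As `A 0` is empty, ranks are shifted by one: `α x` is the least `i` with `x ∈ A (i + 1)`.
  -- Below, `γ x` is the analogous rank in the reachability stages between `A (α x)` and `A (α x +
  -- 1)`. Both default to `0`, which is never used on `A j`.
  have hmemA : ∀ {x}, x ∈ A j → ∃ i, x ∈ A (i + 1) := fun {x} hx => ⟨j, hAmono (Nat.le_succ j) hx⟩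
  let α : X → ℕ := fun x => if h : ∃ i, x ∈ A (i + 1) then Nat.find h else 0
  have hα : ∀ {x}, (∃ i, x ∈ A (i + 1)) → x ∈ A (α x + 1) := by
    intro x h
    simp only [α, dif_pos h]
    exact Nat.find_spec h
  have hα' : ∀ {x i}, x ∈ A (i + 1) → α x ≤ i := by
    intro x i h
    have h' : ∃ i, x ∈ A (i + 1) := ⟨i, h⟩
    simp only [α, dif_pos h']
    exact Nat.find_min' h' h
  let C : X → ℕ → Set X := fun x => reachStage Pre good bad (A (α x)) (A (α x + 1))
  have hAC : ∀ i, A (i + 1) = reach Pre good bad (A i) (A (i + 1)) := fun i => hold_eq_reach hPre _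
  let γ : X → ℕ := fun x => if h : ∃ i, x ∈ C x (i + 1) then Nat.find h else 0
  have hC : ∀ {x}, x ∈ A (α x + 1) → ∃ i, x ∈ C x (i + 1) := by
    intro x hx
    rw [hAC] at hx
    obtain ⟨n, hn⟩ := Set.mem_iUnion.1 hx
    cases n with
    | zero => exact absurd hn (Set.notMem_empty _)
    | succ n => exact ⟨n, hn⟩
  refine ⟨A j, α, γ, ?_, ?_⟩
  · intro x hx
    -- Induction over `Lose`: a position lost with counter `c` lies in stage `N + 1 - c`, since `N +
    -- 1 - c` further increments remain to be forced.
    have h : x ∈ holdStage Pre good bad (A j) (N + 1 - 0) := by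
      refine hx (fun x c => x ∈ holdStage Pre good bad (A j) (N + 1 - c)) ?_ ?_
      · intro x c hc
        have : N + 1 - c = 0 := by omega
        rw [this]
        exact Set.mem_univ x
      · intro x c hx
        rcases Nat.lt_or_ge N c with hc | hc
        · have : N + 1 - c = 0 := by omega
          rw [this]
          exact Set.mem_univ x
        · have hs : N + 1 - c = (N - c) + 1 := by omega
          rw [hs]
          refine pre_reach_subset hPre _ _ (hPre ?_ hx)
          intro y hy
          simp only [Set.mem_ofPred_eq, bump] at hy
          -- A good position resets the counter and so returns to stage `N + 1`, which has
          -- stabilised at `hold`, that is at `A j`. A bad position lowers the stage by one, and a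
          -- neutral one keeps it.
          by_cases hg : y ∈ good
          · rw [if_pos hg, Nat.sub_zero, ← hold_eq_holdStage hPre _ (by omega), hfix] at hy
            exact Or.inl ⟨hg, hy⟩
          · by_cases hb : y ∈ bad
            · rw [if_neg hg, if_pos hb] at hy
              refine Or.inr (Or.inl ⟨hg, hb, ?_⟩)
              rwa [show N + 1 - (c + 1) = N - c by omega] at hy
            · rw [if_neg hg, if_neg hb, hs] at hy
              exact Or.inr (Or.inr ⟨hg, hb, hy⟩)
    rwa [← hold_eq_holdStage hPre _ (by omega), hfix] at h
  · intro x hx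
    have hx₁ := hα (hmemA hx)
    have hx₂ := hC hx₁
    have hγ : x ∈ C x (γ x + 1) := by
      simp only [γ, dif_pos hx₂]
      exact Nat.find_spec hx₂
    have hAj : ∀ i, A i ⊆ A j := fun i => by
      rcases le_total i j with h | h
      · exact hAmono h
      · exact (hj i h).ge
    -- One stage is unfolded. Good successors lie in `A (α x)`, so `α` drops; bad ones lie in `A (α
    -- x + 1)`, so `α` does not grow. Neutral ones lie in stage `γ x`; if `α` stays the same, the
    -- family of stages is the same too, and `γ` drops.
    refine hPre ?_ hγ
    rintro y (⟨hg, hy⟩ | ⟨hg, hb, hy⟩ | ⟨hg, hb, hy⟩)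
    · refine ⟨hAj _ hy, Or.inl ⟨hg, ?_⟩⟩
      cases hi : α x with
      | zero => rw [hi] at hy; exact absurd hy (Set.notMem_empty _)
      | succ i => rw [hi] at hy; exact Nat.lt_succ_of_le (hα' hy)
    · exact ⟨hAj _ hy, Or.inr (Or.inl ⟨hg, hb, hα' hy⟩)⟩
    · have hy' : y ∈ A (α x + 1) := by
        rw [hAC]
        exact Set.mem_iUnion.2 ⟨_, hy⟩
      refine ⟨hAj _ hy', Or.inr (Or.inr ⟨hg, hb, ?_⟩)⟩
      rcases (hα' hy').lt_or_eq with h | h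
      · exact Or.inl h
      · refine Or.inr ⟨h, ?_⟩
        have hyC : y ∈ C y (γ x) := by
          simp only [C, h]
          exact hy
        cases hi : γ x with
        | zero => rw [hi] at hyC; exact absurd hyC (Set.notMem_empty _)
        | succ i =>
          rw [hi] at hyC
          have h' : ∃ i, y ∈ C y (i + 1) := ⟨i, hyC⟩
          simp only [γ, dif_pos h']
          exact Nat.lt_succ_of_le (Nat.find_min' h' hyC)

/-- Along a sequence of positions that makes progress, good positions occur only finitely often
and bad positions infinitely often. -/
theorem frequently_bad_of_progress {x : ℕ → X} {α γ : X → ℕ}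
    (h : ∀ i, (x (i + 1) ∈ good ∧ α (x (i + 1)) < α (x i)) ∨
      (x (i + 1) ∉ good ∧ x (i + 1) ∈ bad ∧ α (x (i + 1)) ≤ α (x i)) ∨
      (x (i + 1) ∉ good ∧ x (i + 1) ∉ bad ∧ (α (x (i + 1)) < α (x i) ∨
        (α (x (i + 1)) = α (x i) ∧ γ (x (i + 1)) < γ (x i))))) :
    (∃ᶠ i in atTop, x i ∈ bad) ∧ ∀ᶠ i in atTop, x i ∉ good := by
  have hanti : Antitone fun i => α (x i) := by
    refine antitone_nat_of_succ_le fun i => ?_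
    have := h i
    show α (x (i + 1)) ≤ α (x i)
    omega
  -- From `n` on, `α` is constant, which excludes good positions; a tail without bad positions would
  -- then let `γ` descend forever.
  obtain ⟨n, hn⟩ := WellFoundedLT.antitone_chain_condition hanti
  have hc : ∀ i, n ≤ i → α (x (i + 1)) = α (x i) := fun i hi =>
    (hn (i + 1) (by omega)).symm.trans (hn i hi)
  constructor
  · rw [frequently_atTop]
    intro a
    by_contra! hne
    have hdec : ∀ k, γ (x (max a n + k)) + k ≤ γ (x (max a n)) := by
      intro k
      induction k with
      | zero => simp
      | succ k ih =>
        have h₁ := hc (max a n + k) (by omega)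
        have h₂ := hne (max a n + k + 1) (by omega)
        have h₃ := h (max a n + k)
        have h₄ : γ (x (max a n + (k + 1))) < γ (x (max a n + k)) := by
          rw [← add_assoc]
          rcases h₃ with h₃ | h₃ | h₃
          · omega
          · exact absurd h₃.2.1 h₂
          · omega
        omega
    have := hdec (γ (x (max a n)) + 1)
    omega
  · refine eventually_atTop.2 ⟨n + 1, fun i hi => ?_⟩
    obtain ⟨i, rfl⟩ : ∃ k, i = k + 1 := ⟨i - 1, by omega⟩
    have h₁ := hc i (by omega)
    rcases h i with h₂ | h₂ | h₂
    · omega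
    · exact h₂.1
    · exact h₂.1

/-- If the counter stays bounded and bad positions occur infinitely often, then so do good ones. -/
theorem frequently_good_of_bounded {x : ℕ → X} {c : ℕ → ℕ} {N : ℕ} (hN : ∀ i, c i ≤ N)
    (hc : ∀ i, c (i + 1) = bump good bad (c i) (x (i + 1))) (hbad : ∃ᶠ i in atTop, x i ∈ bad) :
    ∃ᶠ i in atTop, x i ∈ good := by
  classical
  by_contra hg
  rw [not_frequently, eventually_atTop] at hg
  obtain ⟨a, ha⟩ := hg
  have hstep : ∀ i, a ≤ i → c (i + 1) = if x (i + 1) ∈ bad then c i + 1 else c i := fun i hi => by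
    rw [hc, bump, if_neg (ha _ (by omega))]
  have hmono : ∀ i k, a ≤ i → c i ≤ c (i + k) := by
    intro i k hi
    induction k with
    | zero => simp
    | succ k ih =>
      have := hstep (i + k) (by omega)
      rw [← add_assoc, this]
      split_ifs <;> omega
  -- After the last good position the counter is never reset, and each bad position increments it,
  -- so it passes every bound.
  have hex : ∀ m, ∃ i, a ≤ i ∧ m ≤ c i := by
    intro m
    induction m with
    | zero => exact ⟨a, le_rfl, Nat.zero_le _⟩
    | succ m ih =>
      obtain ⟨i, hi, hm⟩ := ih
      obtain ⟨k, hk, hb⟩ := frequently_atTop.1 hbad (i + 1)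
      obtain ⟨k, rfl⟩ : ∃ l, k = i + l + 1 := ⟨k - (i + 1), by omega⟩
      refine ⟨i + k + 1, by omega, ?_⟩
      have := hmono i k hi
      rw [hstep (i + k) (by omega), if_pos hb]
      omega
  obtain ⟨i, _, hi⟩ := hex (N + 1)
  have := hN i
  omega

end Game

end FairSim

namespace FairSim

/-! ### Fair alternating simulation as a Büchi implication game -/

/-- Pigeonhole: if each state of `F` is eventually avoided, then finitely many such conditions hold
together eventually, so `F` is avoided as a whole. -/
theorem infOften_inter_nonempty_iff {W : Type*} [Finite W] {u : ℕ → W} {F : Set W} :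
    (infOften u ∩ F).Nonempty ↔ ∃ᶠ i in atTop, u i ∈ F := by
  constructor
  · rintro ⟨v, hv, hF⟩
    exact Frequently.mono hv fun i hi => hi ▸ hF
  · intro h
    by_contra hne
    refine h ?_
    have : ∀ᶠ i in atTop, ∀ v : W, v ∈ F → u i ≠ v := by
      refine eventually_all.2 fun v => ?_
      by_cases hF : v ∈ F
      · by_contra hv
        exact hne ⟨v, not_not.1 fun h' => hv (by
          filter_upwards [not_frequently.1 h'] with i hi _ using hi), hF⟩
      · exact Eventually.of_forall fun i h' => absurd h' hF
    filter_upwards [this] with i hi hF using hi _ hF rfl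

section Alternating

variable {Obs W A₁ A₂ W' A₁' A₂' : Type*}

/-- The flag after entering `(v, v')`: it records whether labels have ever been different. -/
noncomputable def mismatch (K : FairATS Obs W A₁ A₂) (K' : FairATS Obs W' A₁' A₂') (f : Bool)
    (v : W) (v' : W') : Bool :=
  open Classical in f || decide (K.L v ≠ K'.L v')

/-- The spoiler chooses the actions of Agent 1 in `K` and of Agent 2 in `K'`. -/
def forcePre (K : FairATS Obs W A₁ A₂) (K' : FairATS Obs W' A₁' A₂')
    (Q : Set (W × W' × Bool)) : Set (W × W' × Bool) :=
  {x | ∃ a ∈ K.P₁ x.1, ∀ a' ∈ K'.P₁ x.2.1, ∃ b' ∈ K'.P₂ x.2.1, ∀ b ∈ K.P₂ x.1,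
    (K.δ x.1 a b, K'.δ x.2.1 a' b',
      mismatch K K' x.2.2 (K.δ x.1 a b) (K'.δ x.2.1 a' b')) ∈ Q}

theorem forcePre_mono (K : FairATS Obs W A₁ A₂) (K' : FairATS Obs W' A₁' A₂') :
    Monotone (forcePre K K') := by
  rintro P Q h x ⟨a, ha, hx⟩
  refine ⟨a, ha, fun a' ha' => ?_⟩
  obtain ⟨b', hb', hx⟩ := hx a' ha'
  exact ⟨b', hb', fun b hb => h (hx b hb)⟩

/-- A mismatch of labels harms the duplicator only if the run of `K` turns out fair. It is therefore
not an immediate loss; instead it rules out all later good positions. -/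
def goodPos (W : Type*) (F' : Set W') : Set (W × W' × Bool) := {x | x.2.2 = false ∧ x.2.1 ∈ F'}

def badPos (W' : Type*) (F : Set W) : Set (W × W' × Bool) := {x | x.1 ∈ F}

/-- The positions at which the spoiler can drive the counter beyond `N`. -/
def losing (K : FairATS Obs W A₁ A₂) (K' : FairATS Obs W' A₁' A₂') (N : ℕ) :
    W × W' × Bool → ℕ → Prop :=
  Lose (forcePre K K') (goodPos W K'.F) (badPos W' K.F) N

/-- The labels agree, and the spoiler cannot drive the counter beyond `N`. -/
def safePair (K : FairATS Obs W A₁ A₂) (K' : FairATS Obs W' A₁' A₂') (N : ℕ) (w : W) (w' : W') :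
    Prop :=
  K.L w = K'.L w' ∧ ¬ losing K K' N (w, w', false) 0

/-- Flag and counter of a play. -/
noncomputable def memStep (K : FairATS Obs W A₁ A₂) (K' : FairATS Obs W' A₁' A₂')
    (m : Bool × ℕ) (q : W × W') : Bool × ℕ :=
  (mismatch K K' m.1 q.1 q.2,
    bump (goodPos W K'.F) (badPos W' K.F) m.2 (q.1, q.2, mismatch K K' m.1 q.1 q.2))

/-- The first pair is dropped by `tail`: only pairs that are entered update flag and counter, and
every play starts with `(false, 0)`. The labels of the initial pair are handled by `safePair`. -/
noncomputable def mem (K : FairATS Obs W A₁ A₂) (K' : FairATS Obs W' A₁' A₂')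
    (h : List (W × W')) (q : W × W') : Bool × ℕ :=
  ((h ++ [q]).tail).foldl (memStep K K') (false, 0)

variable {K : FairATS Obs W A₁ A₂} {K' : FairATS Obs W' A₁' A₂'}

theorem mem_append (h : List (W × W')) (q r : W × W') :
    mem K K' (h ++ [q]) r = memStep K K' (mem K K' h q) r := by
  unfold mem
  rw [List.tail_append_of_ne_nil (by simp), List.foldl_append]
  rfl

/-- The current pair and its flag. -/
noncomputable def curPos (K : FairATS Obs W A₁ A₂) (K' : FairATS Obs W' A₁' A₂')
    (h : List (W × W')) (q : W × W') : W × W' × Bool := (q.1, q.2, (mem K K' h q).1)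

/-- Negating `forcePre` at a position that is not lost gives, for every `a`, some `a'` such that
every `b'` has an answer `b` that is safe again. These answers are selected as functions of position
and counter, with arbitrary available actions elsewhere. The successor is given through equations so
that it can be matched with the states of a play. -/
theorem exists_duplicator (N : ℕ) : ∃ (d' : W × W' × Bool → ℕ → A₁ → A₁')
    (d : W × W' × Bool → ℕ → A₁ → A₁' → A₂' → A₂),
    (∀ x c a, d' x c a ∈ K'.P₁ x.2.1) ∧ (∀ x c a a' b', d x c a a' b' ∈ K.P₂ x.1) ∧
    ∀ x c, ¬ losing K K' N x c → ∀ a ∈ K.P₁ x.1, ∀ b' ∈ K'.P₂ x.2.1,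
      ∀ v v' f, v = K.δ x.1 a (d x c a (d' x c a) b') → v' = K'.δ x.2.1 (d' x c a) b' →
        f = mismatch K K' x.2.2 v v' →
        ¬ losing K K' N (v, v', f) (bump (goodPos W K'.F) (badPos W' K.F) c (v, v', f)) := by
  let next : W × W' × Bool → ℕ → A₁ → A₁' → A₂' → A₂ → Prop := fun x c a a' b' b =>
    ∀ v v' f, v = K.δ x.1 a b → v' = K'.δ x.2.1 a' b' → f = mismatch K K' x.2.2 v v' →
      ¬ losing K K' N (v, v', f) (bump (goodPos W K'.F) (badPos W' K.F) c (v, v', f))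
  have h₁ : ∀ x c a, ∃ a', a' ∈ K'.P₁ x.2.1 ∧ (¬ losing K K' N x c → a ∈ K.P₁ x.1 →
      ∀ b' ∈ K'.P₂ x.2.1, ∃ b ∈ K.P₂ x.1, next x c a a' b' b) := by
    intro x c a
    by_cases hx : ¬ losing K K' N x c ∧ a ∈ K.P₁ x.1
    · by_contra hne
      push Not at hne
      refine hx.1 (Lose.of_pre (forcePre_mono K K') ⟨a, hx.2, fun a' ha' => ?_⟩)
      obtain ⟨-, -, b', hb', hb⟩ := hne a' ha'
      refine ⟨b', hb', fun b hb₂ => ?_⟩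
      have := hb b hb₂
      simp only [next] at this
      push Not at this
      obtain ⟨v, v', f, rfl, rfl, rfl, h⟩ := this
      exact h
    · obtain ⟨a', ha'⟩ := K'.P₁_nonempty x.2.1
      exact ⟨a', ha', fun h h' => absurd ⟨h, h'⟩ hx⟩
  choose d' hd' hd₂ using h₁
  have h₂ : ∀ x c a a' b', ∃ b, b ∈ K.P₂ x.1 ∧ (¬ losing K K' N x c → a ∈ K.P₁ x.1 →
      b' ∈ K'.P₂ x.2.1 → a' = d' x c a → next x c a a' b' b) := by
    intro x c a a' b'
    by_cases hx : ¬ losing K K' N x c ∧ a ∈ K.P₁ x.1 ∧ b' ∈ K'.P₂ x.2.1 ∧ a' = d' x c a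
    · obtain ⟨h₁, h₂, h₃, rfl⟩ := hx
      obtain ⟨b, hb, h⟩ := hd₂ x c a h₁ h₂ b' h₃
      exact ⟨b, hb, fun _ _ _ _ => h⟩
    · obtain ⟨b, hb⟩ := K.P₂_nonempty x.1
      exact ⟨b, hb, fun h₁ h₂ h₃ h₄ => absurd ⟨h₁, h₂, h₃, h₄⟩ hx⟩
  choose d hd hd₃ using h₂
  exact ⟨d', d, hd', hd, fun x c hx a ha b' hb' v v' f hv hv' hf =>
    hd₃ x c a (d' x c a) b' hx ha hb' rfl v v' f hv hv' hf⟩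

theorem losing.mono {N : ℕ} {x : W × W' × Bool} {c c' : ℕ} (h : losing K K' N x c)
    (hc : c ≤ c') : losing K K' N x c' :=
  Lose.mono (forcePre_mono K K') h hc

theorem mismatch_eq_false {f : Bool} {v : W} {v' : W'} :
    mismatch K K' f v v' = false ↔ f = false ∧ K.L v = K'.L v' := by
  simp [mismatch]

/-- The duplicator recomputes flag and counter from the history and keeps to positions that are not
lost, so the counter never exceeds `N`. On a fair run of `K` this makes good positions recur. Any
`N` works here. -/
theorem isSFAS_safePair [Finite W] [Finite W'] (N : ℕ) : IsSFAS K K' (safePair K K' N) := by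
  intro w w'
  refine ⟨fun h => h.1, ?_⟩
  obtain ⟨d', d, hd', hd, hdup⟩ := exists_duplicator (K := K) (K' := K') N
  refine ⟨fun h q a => d' (curPos K K' h q) (mem K K' h q).2 a, fun h q a => hd' (curPos K K' h q) _ _,
    fun h q a a' b' => d (curPos K K' h q) (mem K K' h q).2 a a' b', fun h q a a' b' => hd (curPos K K' h q) _ _ _ _,
    fun τ hτ ξ' hξ' => ?_⟩
  unfold Succeeds
  intro ρ ρ' hS hρ
  set pl := play K K' w w' τ (fun h q a => d' (curPos K K' h q) (mem K K' h q).2 a)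
    (fun h q a a' b' => d (curPos K K' h q) (mem K K' h q).2 a a' b') ξ' with hpl
  let m : ℕ → Bool × ℕ := fun i => mem K K' (pl i).1 (pl i).2
  have hm0 : m 0 = (false, 0) := rfl
  have hm : ∀ i, m (i + 1) = memStep K K' (m i) (pl (i + 1)).2 := fun i => mem_append _ _ _
  let x : ℕ → W × W' × Bool := fun i => (ρ i, ρ' i, (m i).1)
  have hsafe : ∀ i, ¬ losing K K' N (x i) (m i).2 := by
    intro i
    induction i with
    | zero => exact hS.2
    | succ i ih =>
      have h := hdup (x i) (m i).2 ih (τ (pl i).1 (pl i).2) (hτ _ _)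
        (ξ' (pl i).1 (pl i).2 _ _) (hξ' _ _ _ _) (ρ (i + 1)) (ρ' (i + 1)) (m (i + 1)).1 rfl rfl
        (by rw [hm]; rfl)
      have h₂ : (m (i + 1)).2 = bump (goodPos W K'.F) (badPos W' K.F) (m i).2 (x (i + 1)) := by
        simp only [x, hm]
        rfl
      rw [h₂]
      exact h
  have hN : ∀ i, (m i).2 ≤ N := fun i => by
    by_contra h
    exact hsafe i (Lose.of_lt (by omega))
  have hbad : ∃ᶠ i in atTop, x i ∈ badPos W' K.F :=
    (infOften_inter_nonempty_iff.1 hρ.2.2).mono fun i hi => hi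
  have hgood : ∃ᶠ i in atTop, x i ∈ goodPos W K'.F :=
    frequently_good_of_bounded hN (fun i => by simp only [x, hm]; rfl) hbad
  -- The flag never comes down again, so a good position after time `i` shows that it is down at
  -- time `i`.
  have hflag : ∀ i, (m i).1 = false := by
    intro i
    obtain ⟨j, hij, hj⟩ := frequently_atTop.1 hgood i
    replace hj : (m j).1 = false := hj.1
    induction j, hij using Nat.le_induction with
    | base => exact hj
    | succ j _ ih =>
      rw [hm] at hj
      exact ih (mismatch_eq_false.1 hj).1
  refine ⟨⟨rfl, fun i => ⟨_, hd' (x i) _ _, _, hξ' _ _ _ _, rfl⟩, ?_⟩, fun i => ⟨?_, ?_⟩⟩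
  · exact infOften_inter_nonempty_iff.2 (hgood.mono fun i hi => hi.2)
  · cases i with
    | zero => exact hS.1
    | succ i =>
      have := hflag (i + 1)
      rw [hm] at this
      exact (mismatch_eq_false.1 this).2
  · intro h
    refine hsafe i ?_
    simp only [x, hflag]
    -- The play is safe with its current counter; `S` asks for safety with counter `0`, which is
    -- weaker.
    exact h.mono (Nat.zero_le _)

/-- From a lost position the ranks give the spoiler a strategy that reads only the current position.
It is fixed before the duplicator's strategies are known, so it refutes even the weak condition, in
which `ξ` may depend on `τ`. -/
theorem safePair_of_isWFAS [Finite W] [Finite W'] {N : ℕ} (hN : Nat.card (W × W' × Bool) ≤ N)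
    {S : W → W' → Prop} (hS : IsWFAS K K' S) {w : W} {w' : W'} (h : S w w') :
    safePair K K' N w w' := by
  refine ⟨(hS w w').1 h, fun hlose => ?_⟩
  obtain ⟨T, α, γ, hT, hrank⟩ := exists_rank_of_lose (good := goodPos W K'.F)
    (bad := badPos W' K.F) (forcePre_mono K K') hN
  let prog : W × W' × Bool → W × W' × Bool → Prop := fun x y =>
    y ∈ T ∧ ((y ∈ goodPos W K'.F ∧ α y < α x) ∨
      (y ∉ goodPos W K'.F ∧ y ∈ badPos W' K.F ∧ α y ≤ α x) ∨
      (y ∉ goodPos W K'.F ∧ y ∉ badPos W' K.F ∧ (α y < α x ∨ (α y = α x ∧ γ y < γ x))))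
  have h₁ : ∀ x : W × W' × Bool, ∃ a, a ∈ K.P₁ x.1 ∧ (x ∈ T → ∀ a' ∈ K'.P₁ x.2.1,
      ∃ b' ∈ K'.P₂ x.2.1, ∀ b ∈ K.P₂ x.1, prog x (K.δ x.1 a b, K'.δ x.2.1 a' b',
        mismatch K K' x.2.2 (K.δ x.1 a b) (K'.δ x.2.1 a' b'))) := by
    intro x
    by_cases hx : x ∈ T
    · obtain ⟨a, ha, h⟩ := hrank x hx
      exact ⟨a, ha, fun _ => h⟩
    · obtain ⟨a, ha⟩ := K.P₁_nonempty x.1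
      exact ⟨a, ha, fun h => absurd h hx⟩
  choose t ht ht₂ using h₁
  have h₂ : ∀ (x : W × W' × Bool) a', ∃ b', b' ∈ K'.P₂ x.2.1 ∧ (x ∈ T → a' ∈ K'.P₁ x.2.1 →
      ∀ b ∈ K.P₂ x.1, prog x (K.δ x.1 (t x) b, K'.δ x.2.1 a' b',
        mismatch K K' x.2.2 (K.δ x.1 (t x) b) (K'.δ x.2.1 a' b'))) := by
    intro x a'
    by_cases hx : x ∈ T ∧ a' ∈ K'.P₁ x.2.1
    · obtain ⟨b', hb', h⟩ := ht₂ x hx.1 a' hx.2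
      exact ⟨b', hb', fun _ _ => h⟩
    · obtain ⟨b', hb'⟩ := K'.P₂_nonempty x.2.1
      exact ⟨b', hb', fun h h' => absurd ⟨h, h'⟩ hx⟩
  choose s hs hs₂ using h₂
  obtain ⟨τ', hτ', hτ⟩ := (hS w w').2
  -- The history serves only to recover the flag.
  let τ : Strat₁ W W' A₁ := fun h q => t (curPos K K' h q)
  let ξ' : Strat₂' W W' A₁ A₁' A₂' := fun h q _ a' => s (curPos K K' h q) a'
  have hτl : Legal₁ K τ := fun h q => ht (curPos K K' h q)
  have hξl : Legal₂' K' ξ' := fun h q a a' => hs (curPos K K' h q) _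
  obtain ⟨ξ, hξ, hwin⟩ := hτ τ hτl
  have hsucc := hwin ξ' hξl
  set pl := play K K' w w' τ τ' ξ ξ' with hpl
  let m : ℕ → Bool × ℕ := fun i => mem K K' (pl i).1 (pl i).2
  have hm : ∀ i, m (i + 1) = memStep K K' (m i) (pl (i + 1)).2 := fun i => mem_append _ _ _
  let x : ℕ → W × W' × Bool := fun i => curPos K K' (pl i).1 (pl i).2
  have hmx : ∀ i, (x i).2.2 = (m i).1 := fun i => rfl
  have hstep : ∀ i, x i ∈ T → prog (x i) (x (i + 1)) := by
    intro i hi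
    have h := hs₂ (x i) (τ' (pl i).1 (pl i).2 (t (x i))) hi (hτ' _ _ _)
      (ξ (pl i).1 (pl i).2 (t (x i)) (τ' (pl i).1 (pl i).2 (t (x i)))
        (s (x i) (τ' (pl i).1 (pl i).2 (t (x i))))) (hξ _ _ _ _ _)
    have h₂ : x (i + 1) = ((pl (i + 1)).2.1, (pl (i + 1)).2.2,
        mismatch K K' (x i).2.2 (pl (i + 1)).2.1 (pl (i + 1)).2.2) := by
      show (_, _, (m (i + 1)).1) = _
      rw [hm]
      rfl
    rw [h₂]
    exact h
  have hxT : ∀ i, x i ∈ T := by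
    intro i
    induction i with
    | zero => exact hT _ hlose
    | succ i ih => exact (hstep i ih).1
  obtain ⟨hbad, hngood⟩ := frequently_bad_of_progress fun i => (hstep i (hxT i)).2
  have hfair := hsucc h ⟨rfl, fun i => ⟨_, hτl _ _, _, hξ _ _ _ _ _, rfl⟩,
    infOften_inter_nonempty_iff.2 hbad⟩
  -- `S`-matching makes all labels agree. Hence every visit of a Büchi state of `K'` is a good
  -- position, whereas progress of the ranks allows only finitely many.
  have hflag : ∀ i, (m i).1 = false := by
    intro i
    induction i with
    | zero => rfl
    | succ i ih =>
      rw [hm]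
      exact mismatch_eq_false.2 ⟨ih, (hS _ _).1 (hfair.2 (i + 1))⟩
  obtain ⟨i, hi₁, hi₂⟩ := ((infOften_inter_nonempty_iff.1 hfair.1.2.2).and_eventually hngood).exists
  exact hi₂ ⟨hflag i, hi₁⟩

theorem IsSFAS.isWFAS {S : W → W' → Prop} (h : IsSFAS K K' S) : IsWFAS K K' S := by
  intro w w'
  obtain ⟨h₁, τ', hτ', ξ, hξ, h₂⟩ := h w w'
  exact ⟨h₁, τ', hτ', fun τ hτ => ⟨ξ, hξ, h₂ τ hτ⟩⟩

/-! ### The maximum relations as the set of safe pairs -/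

theorem weakFairAlt_eq_safePair [Finite W] [Finite W'] {N : ℕ}
    (hN : Nat.card (W × W' × Bool) ≤ N) : weakFairAlt K K' = safePair K K' N := by
  funext w w'
  exact propext ⟨fun ⟨_, hS, h⟩ => safePair_of_isWFAS hN hS h,
    fun h => ⟨_, (isSFAS_safePair N).isWFAS, h⟩⟩

theorem strongFairAlt_eq_safePair [Finite W] [Finite W'] {N : ℕ}
    (hN : Nat.card (W × W' × Bool) ≤ N) : strongFairAlt K K' = safePair K K' N := by
  funext w w'
  exact propext ⟨fun ⟨_, hS, h⟩ => safePair_of_isWFAS hN hS.isWFAS h,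
    fun h => ⟨_, isSFAS_safePair N, h⟩⟩

theorem isGreatest_weakFairAlt [Finite W] [Finite W'] :
    IsGreatest {S : W → W' → Prop | IsWFAS K K' S} (weakFairAlt K K') := by
  refine ⟨?_, fun S hS w w' h => ⟨S, hS, h⟩⟩
  rw [weakFairAlt_eq_safePair le_rfl]
  exact (isSFAS_safePair _).isWFAS

theorem isGreatest_strongFairAlt [Finite W] [Finite W'] :
    IsGreatest {S : W → W' → Prop | IsSFAS K K' S} (strongFairAlt K K') := by
  refine ⟨?_, fun S hS w w' h => ⟨S, hS, h⟩⟩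
  rw [strongFairAlt_eq_safePair le_rfl]
  exact isSFAS_safePair _

theorem weakFairAlt_eq_strongFairAlt [Finite W] [Finite W'] :
    weakFairAlt K K' = strongFairAlt K K' := by
  rw [weakFairAlt_eq_safePair le_rfl, strongFairAlt_eq_safePair le_rfl]

end Alternating

end FairSim

namespace FairSim

/-! ### Transition systems as alternating transition systems -/

section Embedding

variable {Obs W W' : Type*}

/-- The transition system in which Agent 1 chooses the successor. -/
def FairTS.toFairATS (K : FairTS Obs W) : FairATS Obs W W Unit where
  init := K.init
  P₁ w := {v | K.R w v}
  P₂ _ := Set.univ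
  P₁_nonempty := K.total
  P₂_nonempty _ := Set.univ_nonempty
  L := K.L
  δ _ v _ := v
  F := K.F

theorem FairTS.isFairRun_toFairATS {K : FairTS Obs W} {w : W} {u : ℕ → W} :
    K.toFairATS.IsFairRun w u ↔ K.IsFairRun w u := by
  refine and_congr_right fun _ => and_congr_left fun _ => forall_congr' fun i => ?_
  constructor
  · rintro ⟨a, ha, b, -, h⟩
    rw [h]
    exact ha
  · exact fun h => ⟨_, h, (), trivial, rfl⟩

theorem length_outcomeHist (τ : List (W × W') → W → W') (u : ℕ → W) (i : ℕ) :
    (outcomeHist τ u i).length = i := by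
  induction i with
  | zero => rfl
  | succ i ih => simp [outcomeHist, ih]

variable {K : FairTS Obs W} {K' : FairTS Obs W'} {S : W → W' → Prop}

/-- A simulation strategy need not follow `K'.R` on arbitrary histories, so it is replaced by some
successor where it does not. Along a fair run of `K` the outcome is a run, and the replacement never
takes effect. -/
theorem IsFairSimulation.isSFAS (h : IsFairSimulation K K' S) :
    IsSFAS K.toFairATS K'.toFairATS S := by
  classical
  intro w w'
  obtain ⟨hL, τ, hτ⟩ := h w w'
  refine ⟨hL, fun h q a => if K'.R q.2 (τ (h ++ [q]) a) then τ (h ++ [q]) a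
    else (K'.total q.2).choose, ?_, fun _ _ _ _ _ => (), fun _ _ _ _ _ => trivial, ?_⟩
  · intro h q a
    show K'.R _ _
    simp only
    split_ifs with hR
    · exact hR
    · exact (K'.total q.2).choose_spec
  · intro σ hσ ξ' hξ'
    unfold Succeeds
    intro ρ ρ' hS hρ
    rw [FairTS.isFairRun_toFairATS] at hρ ⊢
    obtain ⟨hrun, hmatch⟩ := hτ hS ρ hρ
    set pl := play K.toFairATS K'.toFairATS w w' σ (fun h q a => if K'.R q.2 (τ (h ++ [q]) a)
      then τ (h ++ [q]) a else (K'.total q.2).choose) (fun _ _ _ _ _ => ()) ξ' with hpl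
    have key : ∀ i, (pl i).1 = outcomeHist τ ρ i ∧ (pl i).2.2 = outcome τ ρ i := by
      intro i
      induction i with
      | zero => exact ⟨rfl, hrun.1.symm⟩
      | succ i ih =>
        have hq : (pl i).2 = (ρ i, outcome τ ρ i) := Prod.ext rfl ih.2
        have h₁ : (pl (i + 1)).1 = outcomeHist τ ρ (i + 1) := by
          show (pl i).1 ++ [(pl i).2] = _
          rw [ih.1, hq]
          rfl
        refine ⟨h₁, ?_⟩
        have h₂ : (pl (i + 1)).2.2 = if K'.R (pl i).2.2 (τ (pl (i + 1)).1 (ρ (i + 1)))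
          then τ (pl (i + 1)).1 (ρ (i + 1)) else (K'.total (pl i).2.2).choose := rfl
        rw [h₂, h₁, if_pos]
        · rfl
        · rw [ih.2]
          exact hrun.2.1 i
    have hρ' : ρ' = outcome τ ρ := funext fun i => (key i).2
    rw [hρ']
    exact ⟨hrun, hmatch⟩

/-- A given run `u` is turned into a strategy of Agent 1 that reads off the current time as the
length of the history. The first answer of `τ`, on the empty history, has to be `w'`. -/
theorem IsSFAS.isFairSimulation (h : IsSFAS K.toFairATS K'.toFairATS S) :
    IsFairSimulation K K' S := by
  classical
  intro w w'
  obtain ⟨hL, τ', hτ', ξ, hξ, hwin⟩ := h w w'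
  let τ : List (W × W') → W → W' := fun l v =>
    if hl : l = [] then w' else τ' l.dropLast (l.getLast hl) v
  refine ⟨hL, τ, fun hS u hu => ?_⟩
  let σ : Strat₁ W W' W := fun h q =>
    if K.R q.1 (u (h.length + 1)) then u (h.length + 1) else (K.total q.1).choose
  have hσ : Legal₁ K.toFairATS σ := by
    intro h q
    show K.R _ _
    simp only [σ]
    split_ifs with hR
    · exact hR
    · exact (K.total q.1).choose_spec
  let ξ' : Strat₂' W W' W W' Unit := fun _ _ _ _ => ()
  have hsucc := hwin σ hσ ξ' fun _ _ _ _ => trivial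
  unfold Succeeds at hsucc
  set pl := play K.toFairATS K'.toFairATS w w' σ τ' ξ ξ' with hpl
  have key : ∀ i, pl i = (outcomeHist τ u i, u i, outcome τ u i) := by
    intro i
    induction i with
    | zero =>
      have : u 0 = w := hu.1
      rw [this]
      rfl
    | succ i ih =>
      have h₀ : σ (pl i).1 (pl i).2 = u (i + 1) := by
        simp only [σ, ih, length_outcomeHist]
        rw [if_pos (hu.2.1 i)]
      have h₁ : pl (i + 1) = ((pl i).1 ++ [(pl i).2], σ (pl i).1 (pl i).2,
        τ' (pl i).1 (pl i).2 (σ (pl i).1 (pl i).2)) := rfl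
      rw [h₁, h₀, ih]
      refine Prod.ext rfl (Prod.ext rfl ?_)
      simp [outcome, outcomeHist, τ]
  simp only [key] at hsucc
  have := hsucc hS (FairTS.isFairRun_toFairATS.2 hu)
  exact ⟨FairTS.isFairRun_toFairATS.1 this.1, this.2⟩

theorem isFairSimulation_iff_isSFAS :
    IsFairSimulation K K' S ↔ IsSFAS K.toFairATS K'.toFairATS S :=
  ⟨IsFairSimulation.isSFAS, IsSFAS.isFairSimulation⟩

theorem fairSim_eq_strongFairAlt : fairSim K K' = strongFairAlt K.toFairATS K'.toFairATS := by
  funext w w'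
  simp only [fairSim, strongFairAlt, isFairSimulation_iff_isSFAS]

theorem isGreatest_fairSim [Finite W] [Finite W'] :
    IsGreatest {S : W → W' → Prop | IsFairSimulation K K' S} (fairSim K K') := by
  simp only [isFairSimulation_iff_isSFAS, fairSim_eq_strongFairAlt]
  exact isGreatest_strongFairAlt

end Embedding

end FairSim

namespace FairSim

/-! ### Reasoning about programs -/

/-- The program `p` started in `s` halts after at most `T` steps in a store that satisfies `Q`. -/
def Run (M : ℕ) (p : Prog) (s : Store) (T : ℕ) (Q : Store → Prop) : Prop :=
  ∃ (t : ℕ) (s' : Store), Exec M p s t s' ∧ t ≤ T ∧ Q s'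

def Store.setReg (s : Store) (r v : ℕ) : Store := { s with reg := Function.update s.reg r v }

def Store.setArr (s : Store) (a i v : ℕ) : Store :=
  { s with arr := Function.update s.arr a (Function.update (s.arr a) i v) }

theorem Store.reg_setReg (s : Store) (r v i : ℕ) :
    (s.setReg r v).reg i = if i = r then v else s.reg i := by
  simp [Store.setReg, Function.update_apply]

theorem Store.arr_setReg (s : Store) (r v : ℕ) : (s.setReg r v).arr = s.arr := rfl

theorem Store.reg_setArr (s : Store) (a i v : ℕ) : (s.setArr a i v).reg = s.reg := rfl

theorem Store.arr_setArr (s : Store) (a i v b j : ℕ) :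
    (s.setArr a i v).arr b j = if b = a ∧ j = i then v else s.arr b j := by
  by_cases h : b = a
  · subst h
    simp [Store.setArr, Function.update_apply]
  · simp [Store.setArr, h]

theorem Store.arr_setArr_of_ne (s : Store) {a b : ℕ} (i v : ℕ) (h : b ≠ a) :
    (s.setArr a i v).arr b = s.arr b := by
  funext j
  simp [Store.arr_setArr, h]

section Rules

variable {M : ℕ} {p q : Prog} {s : Store} {T T' : ℕ} {Q Q' : Store → Prop}

theorem Run.mono (h : Run M p s T Q) (hT : T ≤ T') (hQ : ∀ s', Q s' → Q' s') :
    Run M p s T' Q' := by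
  obtain ⟨t, s', he, ht, h⟩ := h
  exact ⟨t, s', he, ht.trans hT, hQ _ h⟩

theorem Run.skip (h : Q s) : Run M .skip s 1 Q := ⟨1, s, .skip s, le_rfl, h⟩

theorem Run.assign {r : ℕ} {e : Expr} (he : e.Fits M s) (h : Q (s.setReg r (e.eval s))) :
    Run M (.assign r e) s (e.cost + 1) Q := ⟨_, _, .assign r e s he, le_rfl, h⟩

theorem Run.store {a : ℕ} {i e : Expr} (hi : i.Fits M s) (he : e.Fits M s)
    (h : Q (s.setArr a (i.eval s) (e.eval s))) :
    Run M (.store a i e) s (i.cost + e.cost + 1) Q := ⟨_, _, .store a i e s hi he, le_rfl, h⟩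

theorem Run.seq (h : Run M p s T fun s' => Run M q s' T' Q) : Run M (.seq p q) s (T + T') Q := by
  obtain ⟨t, s', he, ht, t', s'', he', ht', h⟩ := h
  exact ⟨t + t', s'', .seq he he', by omega, h⟩

theorem Run.cond {e : Expr} (he : e.Fits M s) (h₁ : e.eval s ≠ 0 → Run M p s T Q)
    (h₂ : e.eval s = 0 → Run M q s T Q) : Run M (.cond e p q) s (e.cost + 1 + T) Q := by
  by_cases h : e.eval s = 0
  · obtain ⟨t, s', hr, ht, hQ⟩ := h₂ h
    exact ⟨_, s', .condFalse he h hr, by omega, hQ⟩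
  · obtain ⟨t, s', hr, ht, hQ⟩ := h₁ h
    exact ⟨_, s', .condTrue he h hr, by omega, hQ⟩

/-- A loop whose iterations are paid for by a potential. -/
theorem Run.loop {e : Expr} (I : ℕ → Store → Prop) (he : ∀ φ s, I φ s → e.Fits M s)
    (hstep : ∀ φ s, I φ s → e.eval s ≠ 0 →
      ∃ T, Run M p s T fun s' => ∃ φ', I φ' s' ∧ φ' + T + e.cost + 1 ≤ φ)
    (hend : ∀ φ s, I φ s → e.eval s = 0 → Q s) {φ : ℕ} (hI : I φ s) :
    Run M (.loop e p) s (φ + e.cost + 1) Q := by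
  induction φ using Nat.strong_induction_on generalizing s with
  | _ φ ih =>
    by_cases h : e.eval s = 0
    · exact ⟨_, s, .loopFalse (he _ _ hI) h, by omega, hend _ _ hI h⟩
    · obtain ⟨T, t, s', hr, ht, φ', hI', hφ⟩ := hstep _ _ hI h
      obtain ⟨t', s'', hr', ht', hQ⟩ := ih φ' (by omega) hI'
      exact ⟨_, s'', .loopTrue (he _ _ hI) h hr hr', by omega, hQ⟩

end Rules

/-! ### Bounded stores -/

/-- All values in the store are at most `B`. -/
def Store.Bdd (B : ℕ) (s : Store) : Prop := (∀ r, s.reg r ≤ B) ∧ ∀ a i, s.arr a i ≤ B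

theorem Store.Bdd.setReg {B : ℕ} {s : Store} (h : s.Bdd B) {r v : ℕ} (hv : v ≤ B) :
    (s.setReg r v).Bdd B := by
  refine ⟨fun i => ?_, h.2⟩
  rw [Store.reg_setReg]
  split_ifs
  exacts [hv, h.1 i]

theorem Store.Bdd.setArr {B : ℕ} {s : Store} (h : s.Bdd B) {a i v : ℕ} (hv : v ≤ B) :
    (s.setArr a i v).Bdd B := by
  refine ⟨h.1, fun b j => ?_⟩
  rw [Store.arr_setArr]
  split_ifs
  exacts [hv, h.2 b j]

/-- All constants in the expression are at most `2`. -/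
def Expr.small : Expr → Bool
  | .const n => n ≤ 2
  | .reg _ => true
  | .load _ i => i.small
  | .op _ e f => e.small && f.small

/-- The exponents add up like the costs of expressions: a product needs `i + j`, and the extra `1`
pays for the factor `2` of a sum. Thus a value is at most `B` to the number of nodes of its
expression. -/
theorem BinOp.eval_le_pow (o : BinOp) {B x y i j : ℕ} (hB : 2 ≤ B) (hx : x ≤ B ^ i)
    (hy : y ≤ B ^ j) : o.eval x y ≤ B ^ (i + j + 1) := by
  have h₁ : B ^ i * B ^ j ≤ B ^ (i + j + 1) := by
    rw [← pow_add]
    exact Nat.pow_le_pow_right (by omega) (by omega)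
  have h₂ : B ^ i ≤ B ^ (i + j) := Nat.pow_le_pow_right (by omega) (by omega)
  have h₃ : B ^ j ≤ B ^ (i + j) := Nat.pow_le_pow_right (by omega) (by omega)
  have h₄ : B ^ (i + j) * 2 ≤ B ^ (i + j + 1) := by
    rw [pow_succ]
    exact Nat.mul_le_mul_left _ hB
  have h₅ : 1 ≤ B ^ i := Nat.one_le_pow _ _ (by omega)
  cases o with
  | add => simp only [BinOp.eval]; omega
  | sub => simp only [BinOp.eval]; omega
  | mul => exact (Nat.mul_le_mul hx hy).trans h₁
  | lt => simp only [BinOp.eval]; split_ifs <;> omega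
  | eq => simp only [BinOp.eval]; split_ifs <;> omega

theorem Expr.eval_le_pow {B : ℕ} (hB : 2 ≤ B) {s : Store} (hs : s.Bdd B) {e : Expr}
    (he : e.small = true) : e.eval s ≤ B ^ e.cost := by
  induction e with
  | const n =>
    simp only [Expr.small, decide_eq_true_eq] at he
    simp only [Expr.eval, Expr.cost, pow_one]
    omega
  | reg r => simpa [Expr.eval, Expr.cost] using hs.1 r
  | load a i ih => exact (hs.2 _ _).trans (Nat.le_self_pow (by simp [Expr.cost]) B)
  | op o e f ihe ihf =>
    simp only [Expr.small, Bool.and_eq_true] at he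
    exact o.eval_le_pow hB (ihe he.1) (ihf he.2)

theorem Expr.fits {B M D : ℕ} (hB : 2 ≤ B) (hM : B ^ D < M) {s : Store} (hs : s.Bdd B) {e : Expr}
    (he : e.small = true) (hD : e.cost ≤ D) : e.Fits M s := by
  have key : ∀ f : Expr, f.small = true → f.cost ≤ D → f.eval s < M := fun f hf hD =>
    (f.eval_le_pow hB hs hf).trans_lt ((Nat.pow_le_pow_right (by omega) hD).trans_lt hM)
  induction e with
  | const n => exact key _ he hD
  | reg r => exact key _ he hD
  | load a i ih => exact ⟨ih he (by simp [Expr.cost] at hD; omega), key (.load a i) he hD⟩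
  | op o e f ihe ihf =>
    have he' := he
    simp only [Expr.small, Bool.and_eq_true] at he
    simp only [Expr.cost] at hD
    exact ⟨ihe he.1 (by omega), ihf he.2 (by omega), key (.op o e f) he' hD⟩

/-- The word length suffices for the expression. -/
def Expr.ok (D : ℕ) (e : Expr) : Bool := e.small && e.cost ≤ D

theorem Expr.ok_iff {D : ℕ} {e : Expr} : e.ok D = true ↔ e.small = true ∧ e.cost ≤ D := by
  simp [Expr.ok]

/-- Words below `M` can hold the values of all expressions of size at most `D` over values that
are at most `B`. -/
structure Roomy (M B D : ℕ) : Prop where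
  two_le : 2 ≤ B
  lt : B ^ D < M

theorem Roomy.fits {M B D : ℕ} (h : Roomy M B D) {s : Store} (hs : s.Bdd B) {e : Expr}
    (he : e.ok D = true) : e.Fits M s := by
  simp only [Expr.ok, Bool.and_eq_true, decide_eq_true_eq] at he
  exact Expr.fits h.two_le h.lt hs he.1 he.2

/-! ### Emission of edges

The edges of a game graph are emitted one by one. For every node, the sources of its incoming
edges form a linked list in the arrays `11` (sources), `12` (links) and `13` (heads). Array `14`
holds for every node the number of lost successors that makes it lost. The number of edges is in
cell `0` of array `15`. -/

/-- An edge with its kind: `0` if its source is a node of the spoiler, and `1` if it is a node of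
the duplicator. -/
abbrev Edge := ℕ × ℕ × ℕ

def preds : List Edge → ℕ → List ℕ
  | [], _ => []
  | (_, u, v) :: es, x => if v = x then u :: preds es x else preds es x

/-- The kind acts as a multiplier. Edges of kind `1` are counted, since all successors of a
duplicator node must be lost; an edge of kind `0` sets the need to `1`. This is the arithmetic that
`emit` performs. -/
def needOf : List Edge → ℕ → ℕ
  | [], _ => 0
  | (k, u, _) :: es, x => if u = x then 1 + k * needOf es x else needOf es x

/-- The linked list at `e` holds `l`. -/
def Chain (src next : ℕ → ℕ) (n : ℕ) : ℕ → List ℕ → Prop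
  | e, [] => e = 0
  | e, u :: l => ∃ k < n, e = k + 1 ∧ src k = u ∧ Chain src next n (next k) l

/-- A new edge writes only the fresh index `n`, so all existing lists survive. Links are shifted by
one, with `0` marking the end. -/
theorem Chain.congr {src next src' next' : ℕ → ℕ} {n n' : ℕ} (hn : n ≤ n')
    (hs : ∀ k < n, src' k = src k) (hx : ∀ k < n, next' k = next k) {e : ℕ} {l : List ℕ}
    (h : Chain src next n e l) : Chain src' next' n' e l := by
  induction l generalizing e with
  | nil => exact h
  | cons u l ih =>
    obtain ⟨k, hk, he, hu, h⟩ := h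
    exact ⟨k, by omega, he, by rw [hs k hk, hu], by rw [hx k hk]; exact ih h⟩

/-- The arrays hold the edges `es`, the latest one being the first one of the list. -/
structure EdgeInv (es : List Edge) (s : Store) : Prop where
  len : s.arr 15 0 = es.length
  chain : ∀ v, Chain (s.arr 11) (s.arr 12) es.length (s.arr 13 v) (preds es v)
  need : ∀ u, s.arr 14 u = needOf es u

/-- Registers up to `r` and arrays up to `10` hold the same values in both stores. -/
def Frame (r : ℕ) (s₀ s : Store) : Prop :=
  (∀ i ≤ r, s.reg i = s₀.reg i) ∧ ∀ a ≤ 10, s.arr a = s₀.arr a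

def Expr.inFrame (r : ℕ) : Expr → Bool
  | .const _ => true
  | .reg i => i ≤ r
  | .load a i => a ≤ 10 && i.inFrame r
  | .op _ e f => e.inFrame r && f.inFrame r

theorem Expr.eval_congr {r : ℕ} {s₀ s : Store} (h : Frame r s₀ s) {e : Expr}
    (he : e.inFrame r = true) : e.eval s = e.eval s₀ := by
  induction e with
  | const n => rfl
  | reg i => exact h.1 i (by simpa [Expr.inFrame] using he)
  | load a i ih =>
    simp only [Expr.inFrame, Bool.and_eq_true, decide_eq_true_eq] at he
    simp only [Expr.eval, ih he.2, h.2 a he.1]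
  | op o e f ihe ihf =>
    simp only [Expr.inFrame, Bool.and_eq_true] at he
    simp only [Expr.eval, ihe he.1, ihf he.2]

theorem Frame.refl (r : ℕ) (s : Store) : Frame r s s := ⟨fun _ _ => rfl, fun _ _ => rfl⟩

theorem Frame.setArr {r : ℕ} {s₀ s : Store} (h : Frame r s₀ s) {a : ℕ} (ha : 10 < a) (i v : ℕ) :
    Frame r s₀ (s.setArr a i v) :=
  ⟨h.1, fun b hb => by rw [Store.arr_setArr_of_ne _ _ _ (by omega), h.2 b hb]⟩

theorem Frame.setReg {r : ℕ} {s₀ s : Store} (h : Frame r s₀ s) {i : ℕ} (hi : r < i) (v : ℕ) :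
    Frame r s₀ (s.setReg i v) :=
  ⟨fun j hj => by rw [Store.reg_setReg, if_neg (by omega), h.1 j hj], h.2⟩

theorem Frame.enter {r : ℕ} {s₀ s : Store} (h : Frame r s₀ s) {v : ℕ} (hv : s.reg (r + 1) = v) :
    Frame (r + 1) (s₀.setReg (r + 1) v) s := by
  refine ⟨fun i hi => ?_, h.2⟩
  rw [Store.reg_setReg]
  split_ifs with hi'
  · rw [hi', hv]
  · exact h.1 i (by omega)

theorem Frame.exit {r v : ℕ} {s₀ s : Store} (h : Frame (r + 1) (s₀.setReg (r + 1) v) s) :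
    Frame r s₀ s ∧ s.reg (r + 1) = v := by
  refine ⟨⟨fun i hi => ?_, h.2⟩, ?_⟩
  · rw [h.1 i (by omega), Store.reg_setReg, if_neg (by omega)]
  · rw [h.1 (r + 1) le_rfl, Store.reg_setReg, if_pos rfl]

theorem EdgeInv.setReg {es : List Edge} {s : Store} (h : EdgeInv es s) (r v : ℕ) :
    EdgeInv es (s.setReg r v) := ⟨h.len, h.chain, h.need⟩

/-- Keeps the contents of array `14` within the bound of the store. -/
theorem needOf_le_length {es : List Edge} (h : ∀ e ∈ es, e.1 ≤ 1) (u : ℕ) :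
    needOf es u ≤ es.length := by
  induction es with
  | nil => simp [needOf]
  | cons e es ih =>
    obtain ⟨k, u', v⟩ := e
    have h₁ := ih fun e he => h e (List.mem_cons_of_mem _ he)
    have h₂ : k ≤ 1 := h (k, u', v) List.mem_cons_self
    simp only [needOf, List.length_cons]
    split_ifs
    · have := Nat.mul_le_mul h₂ h₁
      omega
    · omega

/-- The program emits the edges `l`, the latest one being the first one of the list, in at most
`T` steps, if the registers up to `r` and the input arrays are as in `s₀`. -/
def Emits (M B : ℕ) (p : Prog) (r : ℕ) (s₀ : Store) (l : List Edge) (T : ℕ) : Prop :=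
  (l.length ≤ T ∧ ∀ e ∈ l, e.1 ≤ 1) ∧
    ∀ s es, Frame r s₀ s → s.Bdd B → EdgeInv es s → (∀ e ∈ es, e.1 ≤ 1) →
      es.length + l.length ≤ B →
      Run M p s T fun s' => Frame r s₀ s' ∧ s'.Bdd B ∧ EdgeInv (l ++ es) s'

/-- The program that emits a single edge. -/
def emit (k : ℕ) (u v : Expr) : Prog :=
  .seq (.store 11 (.load 15 (.const 0)) u) <|
  .seq (.store 12 (.load 15 (.const 0)) (.load 13 v)) <|
  .seq (.store 13 v (.op .add (.load 15 (.const 0)) (.const 1))) <|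
  .seq (.store 14 u (.op .add (.const 1) (.op .mul (.const k) (.load 14 u)))) <|
  .store 15 (.const 0) (.op .add (.load 15 (.const 0)) (.const 1))

def forLoop (r : ℕ) (e : Expr) (p : Prog) : Prog :=
  .seq (.assign r (.const 0)) <|
  .loop (.op .lt (.reg r) e) (.seq p (.assign r (.op .add (.reg r) (.const 1))))

/-- The concatenation `l (n - 1) ++ ⋯ ++ l 0`. -/
def revConcat (l : ℕ → List Edge) : ℕ → List Edge
  | 0 => []
  | n + 1 => l n ++ revConcat l n

theorem mem_revConcat {l : ℕ → List Edge} {n : ℕ} {e : Edge} :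
    e ∈ revConcat l n ↔ ∃ i < n, e ∈ l i := by
  induction n with
  | zero => simp [revConcat]
  | succ n ih =>
    simp only [revConcat, List.mem_append, ih, Nat.lt_succ_iff_lt_or_eq]
    constructor
    · rintro (h | ⟨i, hi, h⟩)
      exacts [⟨n, Or.inr rfl, h⟩, ⟨i, Or.inl hi, h⟩]
    · rintro ⟨i, hi | rfl, h⟩
      exacts [Or.inr ⟨i, hi, h⟩, Or.inl h]

theorem length_revConcat (l : ℕ → List Edge) (n : ℕ) :
    (revConcat l n).length = ∑ i ∈ Finset.range n, (l i).length := by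
  induction n with
  | zero => rfl
  | succ n ih => rw [revConcat, List.length_append, ih, Finset.sum_range_succ, add_comm]

section EmitsRules

variable {M B D r : ℕ} {s₀ : Store} {p q : Prog} {l l' : List Edge} {T T' : ℕ}

theorem Emits.mono (h : Emits M B p r s₀ l T) (hT : T ≤ T') : Emits M B p r s₀ l T' :=
  ⟨⟨h.1.1.trans hT, h.1.2⟩, fun s es h₁ h₂ h₃ h₄ h₅ =>
    (h.2 s es h₁ h₂ h₃ h₄ h₅).mono hT fun _ h => h⟩

theorem Emits.seq (hp : Emits M B p r s₀ l T) (hq : Emits M B q r s₀ l' T') :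
    Emits M B (.seq p q) r s₀ (l' ++ l) (T + T') := by
  obtain ⟨⟨hl, hk⟩, hp⟩ := hp
  obtain ⟨⟨hl', hk'⟩, hq⟩ := hq
  refine ⟨⟨by rw [List.length_append]; omega, fun e he => ?_⟩, fun s es h₁ h₂ h₃ h₄ h₅ => ?_⟩
  · rcases List.mem_append.1 he with he | he
    exacts [hk' e he, hk e he]
  · rw [List.length_append] at h₅
    refine Run.seq ((hp s es h₁ h₂ h₃ h₄ (by omega)).mono le_rfl fun s' ⟨h₁, h₂, h₃⟩ => ?_)
    rw [List.append_assoc]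
    refine hq s' _ h₁ h₂ h₃ (fun e he => ?_) (by rw [List.length_append]; omega)
    rcases List.mem_append.1 he with he | he
    exacts [hk e he, h₄ e he]

/-- The cost distinguishes the two outcomes: a failed test must be cheap, so that scanning a sparse
transition table does not pay for the body at every entry. -/
theorem Emits.cond {e : Expr} (hM : Roomy M B D) (he : (e.ok D && e.inFrame r) = true)
    (hp : e.eval s₀ ≠ 0 → Emits M B p r s₀ l T) (hq : e.eval s₀ = 0 → l = []) :
    Emits M B (.cond e p .skip) r s₀ l (e.cost + 2 + if e.eval s₀ = 0 then 0 else T) := by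
  rw [Bool.and_eq_true] at he
  by_cases h : e.eval s₀ = 0
  · rw [hq h]
    refine ⟨⟨by simp, by simp⟩, fun s es h₁ h₂ h₃ h₄ h₅ => ?_⟩
    rw [if_pos h]
    refine (Run.cond (T := 1) (hM.fits h₂ he.1) (fun h' => ?_) fun _ => Run.skip ⟨h₁, h₂, h₃⟩).mono
      (by omega) fun _ h => h
    exact absurd h (by rwa [Expr.eval_congr h₁ he.2] at h')
  · obtain ⟨hl, hp⟩ := hp h
    refine ⟨⟨by rw [if_neg h]; omega, hl.2⟩, fun s es h₁ h₂ h₃ h₄ h₅ => ?_⟩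
    rw [if_neg h]
    refine (Run.cond (T := T) (hM.fits h₂ he.1) (fun _ => hp s es h₁ h₂ h₃ h₄ h₅)
      fun h' => ?_).mono (by omega) fun _ h => h
    exact absurd h' (by rwa [Expr.eval_congr h₁ he.2])

theorem Emits.assign {e : Expr} (hM : Roomy M B D) (he : (e.ok D && e.inFrame r) = true)
    (hB : e.eval s₀ ≤ B) (hp : Emits M B p (r + 1) (s₀.setReg (r + 1) (e.eval s₀)) l T) :
    Emits M B (.seq (.assign (r + 1) e) p) r s₀ l (e.cost + 1 + T) := by
  rw [Bool.and_eq_true] at he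
  refine ⟨⟨by have := hp.1.1; omega, hp.1.2⟩, fun s es h₁ h₂ h₃ h₄ h₅ => ?_⟩
  refine Run.seq (Run.assign (hM.fits h₂ he.1) ?_)
  rw [Expr.eval_congr h₁ he.2]
  refine (hp.2 _ es ((h₁.setReg (Nat.lt_succ_self r) _).enter ?_) (h₂.setReg hB) (h₃.setReg _ _)
    h₄ h₅).mono le_rfl fun s' ⟨h₁, h₂, h₃⟩ => ⟨h₁.exit.1, h₂, h₃⟩
  rw [Store.reg_setReg, if_pos rfl]

theorem Emits.forLoop {e : Expr} {l : ℕ → List Edge} {T : ℕ → ℕ} (hM : Roomy M B D) (hD : 3 ≤ D)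
    (he : ((Expr.op .lt (.reg (r + 1)) e).ok D && e.inFrame r) = true) (hB : e.eval s₀ ≤ B)
    (hp : ∀ i < e.eval s₀, Emits M B p (r + 1) (s₀.setReg (r + 1) i) (l i) (T i)) :
    Emits M B (FairSim.forLoop (r + 1) e p) r s₀ (revConcat l (e.eval s₀))
      (∑ i ∈ Finset.range (e.eval s₀), (T i + e.cost + 7) + e.cost + 5) := by
  rw [Bool.and_eq_true] at he
  set n := e.eval s₀ with hn
  have hkind : ∀ i ≤ n, ∀ x ∈ revConcat l i, x.1 ≤ 1 := fun i hi x hx => by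
    obtain ⟨j, hj, hx⟩ := mem_revConcat.1 hx
    exact (hp j (by omega)).1.2 x hx
  refine ⟨⟨?_, hkind n le_rfl⟩, fun s es h₁ h₂ h₃ h₄ h₅ => ?_⟩
  · rw [length_revConcat]
    have : ∑ i ∈ Finset.range n, (l i).length ≤ ∑ i ∈ Finset.range n, (T i + e.cost + 7) :=
      Finset.sum_le_sum fun i hi => by
        have := (hp i (Finset.mem_range.1 hi)).1.1
        omega
    omega
  · have hfit0 : (Expr.const 0).ok D = true := by
      rw [Expr.ok_iff]
      exact ⟨rfl, by simp only [Expr.cost]; omega⟩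
    have hfit1 : (Expr.op .add (.reg (r + 1)) (.const 1)).ok D = true := by
      exact Expr.ok_iff.2 ⟨rfl, by simp only [Expr.cost]; omega⟩
    refine (Run.seq (T := 2)
      (T' := (∑ i ∈ Finset.range n, (T i + e.cost + 7)) + (1 + e.cost + 1) + 1) (Run.assign
      (hM.fits h₂ hfit0) ?_)).mono (by omega) fun _ h => h
    -- The potential is the total cost of the iterations still to come.
    let I : ℕ → Store → Prop := fun φ s => ∃ i ≤ n, s.reg (r + 1) = i ∧ Frame r s₀ s ∧ s.Bdd B ∧
      EdgeInv (revConcat l i ++ es) s ∧ φ + ∑ j ∈ Finset.range i, (T j + e.cost + 7) =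
        ∑ j ∈ Finset.range n, (T j + e.cost + 7)
    have hlt : ∀ s, Frame r s₀ s → (Expr.op .lt (.reg (r + 1)) e).eval s =
        if s.reg (r + 1) < n then 1 else 0 := fun s hs => by
      simp only [Expr.eval, BinOp.eval, Expr.eval_congr hs he.2, hn]
    refine Run.loop I ?_ ?_ ?_ (φ := ∑ i ∈ Finset.range n, (T i + e.cost + 7)) ?_
    · rintro φ s ⟨i, -, -, -, hb, -⟩
      exact hM.fits hb he.1
    · rintro φ s ⟨i, hi, hr, hf, hb, hes, hφ⟩ hne
      rw [hlt s hf, hr] at hne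
      have hin : i < n := by
        by_contra h
        rw [if_neg h] at hne
        exact hne rfl
      have hlen : (revConcat l (i + 1)).length ≤ (revConcat l n).length := by
        rw [length_revConcat, length_revConcat]
        exact Finset.sum_le_sum_of_subset (Finset.range_mono hin)
      refine ⟨T i + 4, Run.seq ((((hp i hin).2 s _ (hf.enter hr) hb hes ?_ ?_)).mono le_rfl ?_)⟩
      · intro x hx
        rcases List.mem_append.1 hx with hx | hx
        exacts [hkind i hi x hx, h₄ x hx]
      · simp only [revConcat, List.length_append] at hlen ⊢
        omega
      · rintro s' ⟨hf', hb', hes'⟩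
        refine Run.assign (hM.fits hb' hfit1) ⟨∑ j ∈ Finset.range n, (T j + e.cost + 7) -
          ∑ j ∈ Finset.range (i + 1), (T j + e.cost + 7), ⟨i + 1, hin, ?_, ?_, ?_, ?_, ?_⟩, ?_⟩
        · simp [Store.reg_setReg, Expr.eval, BinOp.eval, hf'.exit.2]
        · exact hf'.exit.1.setReg (Nat.lt_succ_self r) _
        · refine hb'.setReg ?_
          simp only [Expr.eval, BinOp.eval, hf'.exit.2]
          omega
        · simp only [revConcat, List.append_assoc]
          exact hes'.setReg _ _
        · refine Nat.sub_add_cancel (Finset.sum_le_sum_of_subset (Finset.range_mono hin))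
        · rw [Finset.sum_range_succ]
          have : ∑ j ∈ Finset.range (i + 1), (T j + e.cost + 7) ≤
            ∑ j ∈ Finset.range n, (T j + e.cost + 7) :=
              Finset.sum_le_sum_of_subset (Finset.range_mono hin)
          rw [Finset.sum_range_succ] at this
          simp only [Expr.cost]
          omega
    · rintro φ s ⟨i, hi, hr, hf, hb, hes, hφ⟩ heq
      rw [hlt s hf, hr] at heq
      have hin : i = n := by
        by_contra h
        rw [if_pos (by omega)] at heq
        exact one_ne_zero heq
      subst hin
      exact ⟨hf, hb, hes⟩
    · refine ⟨0, Nat.zero_le _, ?_, h₁.setReg (Nat.lt_succ_self r) _, h₂.setReg (Nat.zero_le _),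
        h₃.setReg _ _, by simp⟩
      simp [Store.reg_setReg, Expr.eval]

theorem Emits.emit {k : ℕ} {u v : Expr} (hM : Roomy M B D) (hk : k ≤ 1)
    (hu : (u.ok D && u.inFrame r) = true) (hv : (v.ok D && v.inFrame r) = true)
    (hDu : u.cost + 5 ≤ D) (hDv : v.cost + 1 ≤ D) (huB : u.eval s₀ ≤ B) :
    Emits M B (FairSim.emit k u v) r s₀ [(k, u.eval s₀, v.eval s₀)]
      (3 * u.cost + 2 * v.cost + 26) := by
  rw [Bool.and_eq_true] at hu hv
  refine ⟨⟨by simp, by simpa using hk⟩, fun s es h₁ h₂ h₃ h₄ h₅ => ?_⟩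
  set U := u.eval s₀ with hU
  set V := v.eval s₀ with hV
  have hsu : u.small = true := (Bool.and_eq_true _ _ ▸ hu.1 : _ ∧ _).1
  have hsv : v.small = true := (Bool.and_eq_true _ _ ▸ hv.1 : _ ∧ _).1
  have okc : (Expr.const 0).ok D = true := by
      exact Expr.ok_iff.2 ⟨rfl, by simp only [Expr.cost]; omega⟩
  have okl : (Expr.load 15 (.const 0)).ok D = true := by
    exact Expr.ok_iff.2 ⟨rfl, by simp only [Expr.cost]; omega⟩
  have oka : (Expr.op .add (.load 15 (.const 0)) (.const 1)).ok D = true := by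
    exact Expr.ok_iff.2 ⟨rfl, by simp only [Expr.cost]; omega⟩
  have okv : (Expr.load 13 v).ok D = true := by simp [Expr.ok, Expr.small, Expr.cost, hsv, hDv]
  have okn : (Expr.op .add (.const 1) (.op .mul (.const k) (.load 14 u))).ok D = true := by
    refine Expr.ok_iff.2 ⟨?_, by simp only [Expr.cost]; omega⟩
    simp only [Expr.small, hsu, Bool.and_true, Bool.and_eq_true, decide_eq_true_eq]
    omega
  have hlen : es.length + 1 ≤ B := by simpa using h₅
  have hneed : 1 + k * needOf es U ≤ B := by
    have := Nat.mul_le_mul hk (needOf_le_length h₄ U)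
    omega
  set s₁ := s.setArr 11 es.length U with hs₁
  set s₂ := s₁.setArr 12 es.length (s.arr 13 V) with hs₂
  set s₃ := s₂.setArr 13 V (es.length + 1) with hs₃
  set s₄ := s₃.setArr 14 U (1 + k * needOf es U) with hs₄
  set s₅ := s₄.setArr 15 0 (es.length + 1) with hs₅
  have b₁ : s₁.Bdd B := h₂.setArr huB
  have b₂ : s₂.Bdd B := b₁.setArr (h₂.2 _ _)
  have b₃ : s₃.Bdd B := b₂.setArr hlen
  have b₄ : s₄.Bdd B := b₃.setArr hneed
  have b₅ : s₅.Bdd B := b₄.setArr hlen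
  have f₁ : Frame r s₀ s₁ := h₁.setArr (by norm_num) _ _
  have f₂ : Frame r s₀ s₂ := f₁.setArr (by norm_num) _ _
  have f₃ : Frame r s₀ s₃ := f₂.setArr (by norm_num) _ _
  have f₄ : Frame r s₀ s₄ := f₃.setArr (by norm_num) _ _
  have f₅ : Frame r s₀ s₅ := f₄.setArr (by norm_num) _ _
  have c₀ : s.arr 15 0 = es.length := h₃.len
  have c₁ : s₁.arr 15 0 = es.length := c₀
  have c₂ : s₂.arr 15 0 = es.length := c₀
  have c₃ : s₃.arr 15 0 = es.length := c₀
  have c₄ : s₄.arr 15 0 = es.length := c₀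
  have e₅ : EdgeInv ((k, U, V) :: es) s₅ := by
    refine ⟨by simp [hs₅, Store.arr_setArr], fun x => ?_, fun x => ?_⟩
    · have hsrc : ∀ i < es.length, s₅.arr 11 i = s.arr 11 i := fun i hi => by
        simp [hs₅, hs₄, hs₃, hs₂, hs₁, Store.arr_setArr, hi.ne]
      have hnext : ∀ i < es.length, s₅.arr 12 i = s.arr 12 i := fun i hi => by
        simp [hs₅, hs₄, hs₃, hs₂, hs₁, Store.arr_setArr, hi.ne]
      -- The lists as they were before the new edge is put in front of the one of `V`.
      have hold : ∀ x, Chain (s₅.arr 11) (s₅.arr 12) ((k, U, V) :: es).length (s.arr 13 x)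
          (preds es x) := fun x => (h₃.chain x).congr (by simp) hsrc hnext
      by_cases hx : V = x
      · subst hx
        simp only [preds, if_true]
        refine ⟨es.length, by simp, ?_, ?_, ?_⟩
        · simp [hs₅, hs₄, hs₃, Store.arr_setArr]
        · simp [hs₅, hs₄, hs₃, hs₂, hs₁, Store.arr_setArr]
        · have : s₅.arr 12 es.length = s.arr 13 V := by
            simp [hs₅, hs₄, hs₃, hs₂, Store.arr_setArr]
          rw [this]
          exact hold V
      · have : s₅.arr 13 x = s.arr 13 x := by
          simp [hs₅, hs₄, hs₃, hs₂, hs₁, Store.arr_setArr, Ne.symm hx]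
        simp only [preds, if_neg hx, this]
        exact hold x
    · by_cases hx : U = x
      · subst hx
        simp [hs₅, hs₄, Store.arr_setArr, needOf]
      · simp [hs₅, hs₄, hs₃, hs₂, hs₁, Store.arr_setArr, needOf, hx, Ne.symm hx, h₃.need]
  refine (Run.seq (T' := 2 * u.cost + 2 * v.cost + 22)
    (Run.store (hM.fits h₂ okl) (hM.fits h₂ hu.1) ?_)).mono (by simp only [Expr.cost]; omega)
    fun _ h => h
  rw [Expr.eval_congr h₁ hu.2]
  simp only [Expr.eval, c₀]
  refine (Run.seq (T' := 2 * u.cost + v.cost + 18)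
    (Run.store (hM.fits b₁ okl) (hM.fits b₁ okv) ?_)).mono (by simp only [Expr.cost]; omega)
    fun _ h => h
  simp only [Expr.eval, c₁, Expr.eval_congr f₁ hv.2]
  refine (Run.seq (T' := 2 * u.cost + 13)
    (Run.store (hM.fits b₂ hv.1) (hM.fits b₂ oka) ?_)).mono (by simp only [Expr.cost]; omega)
    fun _ h => h
  simp only [Expr.eval, c₂, Expr.eval_congr f₂ hv.2, BinOp.eval]
  refine (Run.seq (T' := 6)
    (Run.store (hM.fits b₃ hu.1) (hM.fits b₃ okn) ?_)).mono (by simp only [Expr.cost]; omega)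
    fun _ h => h
  have hn : s₃.arr 14 U = needOf es U := h₃.need U
  simp only [Expr.eval, Expr.eval_congr f₃ hu.2, BinOp.eval]
  rw [hn]
  refine (Run.store (hM.fits b₄ okc) (hM.fits b₄ oka) ?_).mono (by simp [Expr.cost]) fun _ h => h
  simp only [Expr.eval, BinOp.eval, c₄]
  exact ⟨f₅, b₅, e₅⟩

end EmitsRules

end FairSim

namespace FairSim

/-! ### The lost nodes of a game graph -/

/-- The number of edges from `u` into `Q`. -/
noncomputable def countTo (es : List Edge) (Q : Set ℕ) (u : ℕ) : ℕ :=
  open Classical in es.countP fun e => e.2.1 = u ∧ e.2.2 ∈ Q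

/-- The least set that contains the root `0` and every node that has edges and sufficiently many
edges into the set. -/
def LostNode (es : List Edge) (u : ℕ) : Prop :=
  ∀ Q : Set ℕ, 0 ∈ Q → (∀ u, 0 < needOf es u → needOf es u ≤ countTo es Q u → u ∈ Q) → u ∈ Q

theorem countTo_mono {es : List Edge} {Q Q' : Set ℕ} (h : Q ⊆ Q') (u : ℕ) :
    countTo es Q u ≤ countTo es Q' u := by
  classical
  refine List.countP_mono_left fun e _ he => ?_
  simp only [decide_eq_true_eq] at he ⊢
  exact ⟨he.1, h he.2⟩

theorem LostNode.zero (es : List Edge) : LostNode es 0 := fun _ h _ => h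

theorem LostNode.step {es : List Edge} {u : ℕ} (h : 0 < needOf es u)
    (h' : needOf es u ≤ countTo es {v | LostNode es v} u) : LostNode es u :=
  fun Q h₁ h₂ => h₂ u h (h'.trans (countTo_mono (fun _ (hv : LostNode es _) => hv Q h₁ h₂) u))

/-- Double counting of the edges from `u` into `l`, by their targets; without repetitions in `l`
each edge is counted once. -/
theorem sum_count_preds (es : List Edge) {l : List ℕ} (hl : l.Nodup) (u : ℕ) :
    (l.map fun v => (preds es v).count u).sum = countTo es {v | v ∈ l} u := by
  classical
  unfold countTo
  induction es with
  | nil => simp [preds]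
  | cons e es ih =>
    obtain ⟨k, u', v'⟩ := e
    have h : (l.map fun v => (preds ((k, u', v') :: es) v).count u).sum =
        (l.map fun v => (preds es v).count u).sum +
          (l.map fun v => if v' = v ∧ u' = u then 1 else 0).sum := by
      rw [← List.sum_map_add]
      congr 1
      refine List.map_congr_left fun v _ => ?_
      by_cases hv : v' = v
      · subst hv
        by_cases hu : u' = u <;> simp [preds, hu]
      · simp [preds, hv]
    rw [h, ih, List.countP_cons]
    congr 1
    by_cases hu : u' = u
    · have : (l.map fun v => if v' = v ∧ u' = u then 1 else 0).sum = l.count v' := by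
        clear h ih hl
        induction l with
        | nil => rfl
        | cons a l ih =>
          rw [List.map_cons, List.sum_cons, ih, List.count_cons, add_comm]
          by_cases h : v' = a
          · simp [h, hu]
          · simp [h, Ne.symm h]
      rw [this, hl.count]
      simp [hu]
    · simp [hu]

/-- Every edge has a single target, so treating the incoming edges of distinct nodes costs at most
one unit per edge. This makes the solver linear. -/
theorem sum_length_preds_le (es : List Edge) {l : List ℕ} (hl : l.Nodup) :
    (l.map fun v => (preds es v).length).sum ≤ es.length := by
  induction es with
  | nil => simp [preds]
  | cons e es ih =>
    obtain ⟨k, u', v'⟩ := e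
    have h : (l.map fun v => (preds ((k, u', v') :: es) v).length).sum =
        (l.map fun v => (preds es v).length).sum +
          (l.map fun v => if v' = v then 1 else 0).sum := by
      rw [← List.sum_map_add]
      congr 1
      refine List.map_congr_left fun v _ => ?_
      by_cases hv : v' = v <;> simp [preds, hv]
    have h₂ : (l.map fun v => if v' = v then 1 else 0).sum = l.count v' := by
      clear h ih hl
      induction l with
      | nil => rfl
      | cons a l ih =>
        rw [List.map_cons, List.sum_cons, ih, List.count_cons, add_comm]
        by_cases h : v' = a
        · simp [h]
        · simp [h, Ne.symm h]
    rw [h, h₂, List.length_cons]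
    have := List.nodup_iff_count_le_one.1 hl v'
    omega

/-! ### The program that computes the lost nodes -/

/-- The program that treats the incoming edge `50` of the current node. -/
def solveEdge : Prog :=
  .seq (.assign 52 (.load 11 (.op .sub (.reg 50) (.const 1)))) <|
  .seq (.assign 50 (.load 12 (.op .sub (.reg 50) (.const 1)))) <|
  .seq (.cond (.op .eq (.load 14 (.reg 52)) (.const 1))
    (.seq (.store 16 (.reg 51) (.reg 52)) (.assign 51 (.op .add (.reg 51) (.const 1))))
    .skip) <|
  .store 14 (.reg 52) (.op .sub (.load 14 (.reg 52)) (.const 1))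

/-- The program that takes a node from the stack. -/
def solvePop : Prog :=
  .seq (.assign 51 (.op .sub (.reg 51) (.const 1))) (.assign 50 (.load 13 (.load 16 (.reg 51))))

/-- Registers: `50` is the current link, `51` the number of nodes on the stack in array `16`, and
`52` the source of the current edge. -/
def solve : Prog :=
  .seq (.store 16 (.const 0) (.const 0)) <|
  .seq (.assign 50 (.const 0)) <|
  .seq (.assign 51 (.const 1)) <|
  .loop (.op .add (.reg 50) (.reg 51)) (.cond (.reg 50) solveEdge solvePop)

/-- The stack in array `16` holds `l`, the top being the first element of the list. -/
def StackRep (s : Store) : List ℕ → Prop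
  | [] => True
  | u :: l => s.arr 16 l.length = u ∧ StackRep s l

theorem StackRep.congr {s s' : Store} {l : List ℕ} (h : StackRep s l)
    (hs : ∀ i < l.length, s'.arr 16 i = s.arr 16 i) : StackRep s' l := by
  induction l with
  | nil => trivial
  | cons u l ih =>
    refine ⟨by rw [hs _ (by simp)]; exact h.1, ih h.2 fun i hi => hs i ?_⟩
    rw [List.length_cons]
    omega

/-- The invariant of the solver: `st` is the stack, `rem` holds the sources still to be treated
for the current node, `pr` the sources treated so far, and `done` the nodes taken from the stack. -/
structure SolveInv (B : ℕ) (es : List Edge) (s₀ s : Store) (st rem pr done : List ℕ) : Prop where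
  frame : (∀ r < 50, s.reg r = s₀.reg r) ∧ ∀ a ≤ 10, s.arr a = s₀.arr a
  bdd : s.Bdd B
  src : s.arr 11 = s₀.arr 11
  next : s.arr 12 = s₀.arr 12
  head : s.arr 13 = s₀.arr 13
  link : Chain (s₀.arr 11) (s₀.arr 12) es.length (s.reg 50) rem
  height : s.reg 51 = st.length
  stack : StackRep s st
  need : ∀ u, s.arr 14 u = needOf es u - pr.count u
  nodup : (done ++ st).Nodup
  mem : ∀ u, u ∈ done ++ st ↔ (needOf es u - pr.count u = 0 ∧ (u = 0 ∨ 0 < needOf es u))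
  count : ∀ u, pr.count u + rem.count u = (done.map fun v => (preds es v).count u).sum
  len : pr.length + rem.length = (done.map fun v => (preds es v).length).sum
  height_le : (done ++ st).length ≤ 1 + pr.length
  sound : ∀ u ∈ done ++ st, LostNode es u

theorem SolveInv.length_le {B : ℕ} {es : List Edge} {s₀ s : Store} {st rem pr done : List ℕ}
    (h : SolveInv B es s₀ s st rem pr done) : pr.length + rem.length ≤ es.length := by
  rw [h.len]
  exact sum_length_preds_le es (List.nodup_append.1 h.nodup).1

/-- When stack and current list are empty, all edges into `done` have been treated. So `done` is
closed under the rules that define `LostNode` and contains the least closed set; the other inclusion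
is the invariant `sound`. -/
theorem SolveInv.lost_iff {B : ℕ} {es : List Edge} {s₀ s : Store} {pr done : List ℕ}
    (h : SolveInv B es s₀ s [] [] pr done) (h₀ : needOf es 0 = 0) (u : ℕ) :
    (s.arr 14 u = 0 ∧ (u = 0 ∨ 0 < needOf es u)) ↔ LostNode es u := by
  have hmem := h.mem
  have hnodup := h.nodup
  have hsound := h.sound
  have hcount := h.count
  simp only [List.append_nil, List.count_nil, Nat.add_zero] at hmem hnodup hsound hcount
  rw [h.need, ← hmem]
  refine ⟨hsound u, fun hu => hu {v | v ∈ done} ?_ ?_⟩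
  · exact (hmem 0).2 ⟨by omega, Or.inl rfl⟩
  · intro u hu hu'
    refine (hmem u).2 ⟨?_, Or.inr hu⟩
    rw [hcount u, sum_count_preds es hnodup]
    omega

/-- The source is pushed exactly when its need falls from `1` to `0`. Later truncated subtractions
leave `0`, so no node is pushed twice. -/
theorem SolveInv.edge {M B D : ℕ} (hM : Roomy M B D) (hD : 10 ≤ D) {es : List Edge}
    {s₀ s : Store} {st rem pr done : List ℕ} {u : ℕ} (h : SolveInv B es s₀ s st (u :: rem) pr done)
    (hB : es.length + 2 ≤ B) :
    Run M solveEdge s 36 fun s' => ∃ st', st'.length ≤ st.length + 1 ∧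
      SolveInv B es s₀ s' st' rem (u :: pr) done := by
  obtain ⟨k, hk, hk₁, hk₂, hk₃⟩ := h.link
  have hfit : ∀ {s : Store} {e : Expr}, s.Bdd B → e.small = true → e.cost ≤ 10 → e.Fits M s :=
    fun hs h₁ h₂ => hM.fits hs (Expr.ok_iff.2 ⟨h₁, h₂.trans hD⟩)
  have hlen := h.length_le
  have hhl := h.height_le
  simp only [List.length_append, List.length_cons] at hlen hhl
  have hu : s.arr 11 k = u := by rw [h.src, hk₂]
  have hub : u ≤ B := hu ▸ h.bdd.2 _ _
  set s₁ := s.setReg 52 u with hs₁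
  set s₂ := s₁.setReg 50 (s.arr 12 k) with hs₂
  have b₁ : s₁.Bdd B := h.bdd.setReg hub
  have b₂ : s₂.Bdd B := b₁.setReg (h.bdd.2 _ _)
  have hn : s₂.arr 14 u = needOf es u - pr.count u := h.need u
  have hcnt : ∀ x, (u :: pr).count x + rem.count x =
      (done.map fun v => (preds es v).count x).sum := fun x => by
    rw [← h.count x, List.count_cons, List.count_cons]
    omega
  refine (Run.seq (T' := 30) (Run.assign (hfit h.bdd rfl (by decide)) ?_)).mono (by decide)
    fun _ h => h
  have e₁ : (Expr.load 11 (.op .sub (.reg 50) (.const 1))).eval s = u := by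
    simp [Expr.eval, BinOp.eval, hk₁, hu]
  rw [e₁]
  refine (Run.seq (T' := 24) (Run.assign (hfit b₁ rfl (by decide)) ?_)).mono (by decide)
    fun _ h => h
  have e₂ : (Expr.load 12 (.op .sub (.reg 50) (.const 1))).eval s₁ = s.arr 12 k := by
    simp [Expr.eval, BinOp.eval, hk₁, hs₁, Store.reg_setReg, Store.arr_setReg]
  rw [e₂]
  -- The state after the possible push and before the decrement; both branches of the test meet
  -- here.
  let mid : Store → Prop := fun s' => ∃ st', ((s.arr 14 u = 1 ∧ st' = u :: st) ∨
    (s.arr 14 u ≠ 1 ∧ st' = st)) ∧ (∀ r < 50, s'.reg r = s.reg r) ∧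
    (∀ a, a ≠ 16 → s'.arr a = s.arr a) ∧ s'.Bdd B ∧ s'.reg 50 = s.arr 12 k ∧
    s'.reg 51 = st'.length ∧ s'.reg 52 = u ∧ StackRep s' st'
  have hr : ∀ r < 50, s₂.reg r = s.reg r := fun r hr => by
    rw [hs₂, hs₁, Store.reg_setReg, Store.reg_setReg, if_neg (by omega), if_neg (by omega)]
  refine (Run.seq (T := 17) (T' := 7) (Run.mono (Q := mid) (T := 17) ?_ le_rfl ?_))
  · refine (Run.cond (T := 11) (hfit b₂ rfl (by decide)) (fun hc => ?_) fun hc => ?_).mono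
      (by decide) fun _ h => h
    · have hc : s.arr 14 u = 1 := by
        by_contra h
        simp [Expr.eval, BinOp.eval, hs₂, hs₁, Store.reg_setReg, Store.arr_setReg, h] at hc
      refine (Run.seq (T' := 8) (Run.store (hfit b₂ rfl (by decide)) (hfit b₂ rfl (by decide))
        ?_)).mono (by decide) fun _ h => h
      have e₃ : (Expr.reg 51).eval s₂ = st.length := by
        simp [Expr.eval, hs₂, hs₁, Store.reg_setReg, h.height]
      have e₄ : (Expr.reg 52).eval s₂ = u := by
        simp [Expr.eval, hs₂, hs₁, Store.reg_setReg]
      rw [e₃, e₄]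
      have b₃ : (s₂.setArr 16 st.length u).Bdd B := b₂.setArr hub
      refine (Run.assign (hfit b₃ rfl (by decide)) ?_).mono (by decide) fun _ h => h
      have e₅ : (Expr.op .add (.reg 51) (.const 1)).eval (s₂.setArr 16 st.length u) =
          st.length + 1 := by
        simp [Expr.eval, BinOp.eval, hs₂, hs₁, Store.reg_setReg, Store.reg_setArr, h.height]
      rw [e₅]
      refine ⟨u :: st, Or.inl ⟨hc, rfl⟩, fun r hr' => ?_, fun a ha => ?_, b₃.setReg (by omega),
        ?_, ?_, ?_, ?_, ?_⟩
      · rw [Store.reg_setReg, if_neg (by omega)]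
        exact hr r hr'
      · exact Store.arr_setArr_of_ne _ _ _ ha
      · simp [hs₂, Store.reg_setReg, Store.reg_setArr]
      · simp [Store.reg_setReg]
      · simp [hs₂, hs₁, Store.reg_setReg, Store.reg_setArr]
      · simp [Store.arr_setReg, Store.arr_setArr]
      · refine h.stack.congr fun i hi => ?_
        simp [Store.arr_setReg, Store.arr_setArr, hi.ne, hs₂, hs₁]
    · have hc : s.arr 14 u ≠ 1 := by
        intro h
        simp [Expr.eval, BinOp.eval, hs₂, hs₁, Store.reg_setReg, Store.arr_setReg, h] at hc
      refine (Run.skip ?_).mono (by decide) fun _ h => h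
      refine ⟨st, Or.inr ⟨hc, rfl⟩, hr, fun a _ => rfl, b₂, ?_, ?_, ?_, h.stack.congr fun _ _ => rfl⟩
      · simp [hs₂, Store.reg_setReg]
      · simp [hs₂, hs₁, Store.reg_setReg, h.height]
      · simp [hs₂, hs₁, Store.reg_setReg]
  · rintro s' ⟨st', hst, hr', ha', hb', h50, h51, h52, hrep⟩
    refine (Run.store (hfit hb' rfl (by decide)) (hfit hb' rfl (by decide)) ?_).mono (by decide)
      fun _ h => h
    have e₆ : (Expr.reg 52).eval s' = u := h52
    have e₇ : (Expr.op .sub (.load 14 (.reg 52)) (.const 1)).eval s' = s.arr 14 u - 1 := by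
      simp [Expr.eval, BinOp.eval, h52, ha']
    rw [e₆, e₇]
    have hnu := h.need u
    have hmu := h.mem u
    refine ⟨st', by rcases hst with ⟨_, rfl⟩ | ⟨_, rfl⟩ <;> simp,
      ⟨fun r hr₀ => by rw [Store.reg_setArr, hr' r hr₀, h.frame.1 r hr₀], fun a ha => ?_⟩,
      hb'.setArr ((Nat.sub_le _ _).trans (h.bdd.2 _ _)), ?_, ?_, ?_, ?_, h51, ?_, ?_, ?_, ?_, hcnt,
      ?_, ?_, ?_⟩
    · rw [Store.arr_setArr_of_ne _ _ _ (by omega), ha' a (by omega), h.frame.2 a ha]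
    · rw [Store.arr_setArr_of_ne _ _ _ (by omega), ha' 11 (by omega), h.src]
    · rw [Store.arr_setArr_of_ne _ _ _ (by omega), ha' 12 (by omega), h.next]
    · rw [Store.arr_setArr_of_ne _ _ _ (by omega), ha' 13 (by omega), h.head]
    · rw [Store.reg_setArr, h50, h.next]
      exact hk₃
    · exact hrep.congr fun i _ => by rw [Store.arr_setArr_of_ne _ _ _ (by omega)]
    · intro x
      rw [Store.arr_setArr]
      by_cases hx : x = u
      · subst hx
        rw [if_pos ⟨rfl, rfl⟩, hnu, List.count_cons_self]
        omega
      · rw [if_neg (by simp [hx]), ha' 14 (by omega), h.need, List.count_cons_of_ne (Ne.symm hx)]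
    · rcases hst with ⟨h1, rfl⟩ | ⟨_, rfl⟩
      · rw [List.nodup_middle, List.nodup_cons]
        refine ⟨fun hm => ?_, h.nodup⟩
        have := (hmu.1 hm).1
        omega
      · exact h.nodup
    · intro x
      have hmx := h.mem x
      by_cases hx : x = u
      · subst hx
        rw [List.count_cons_self]
        rcases hst with ⟨h1, rfl⟩ | ⟨h1, rfl⟩
        · simp only [List.mem_append, List.mem_cons, true_or, or_true, true_iff]
          omega
        · rw [hmx]
          omega
      · rw [List.count_cons_of_ne (Ne.symm hx), ← hmx]
        rcases hst with ⟨h1, rfl⟩ | ⟨h1, rfl⟩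
        · simp [hx]
        · rfl
    · have := h.len
      simp only [List.length_cons] at this ⊢
      omega
    · rcases hst with ⟨_, rfl⟩ | ⟨_, rfl⟩ <;>
        simp only [List.length_append, List.length_cons] <;> omega
    · intro x hx
      rcases hst with ⟨h1, rfl⟩ | ⟨h1, rfl⟩
      · rw [List.mem_append, List.mem_cons] at hx
        rcases hx with hx | rfl | hx
        · exact h.sound x (List.mem_append_left _ hx)
        -- The treated edges from `x` now number `needOf es x`, and all of them lead into `done`,
        -- whose nodes are lost.
        · have hc := hcnt x
          rw [List.count_cons_self, sum_count_preds es (List.nodup_append.1 h.nodup).1] at hc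
          have hle : countTo es {v | v ∈ done} x ≤ countTo es {v | LostNode es v} x :=
            countTo_mono (fun v hv => h.sound v (List.mem_append_left _ hv)) x
          exact LostNode.step (by omega) (by omega)
        · exact h.sound x (List.mem_append_right _ hx)
      · exact h.sound x hx

theorem SolveInv.pop {M B D : ℕ} (hM : Roomy M B D) (hD : 10 ≤ D) {es : List Edge}
    {s₀ s : Store} {st pr done : List ℕ} {v : ℕ} (h : SolveInv B es s₀ s (v :: st) [] pr done)
    (hch : ∀ v, Chain (s₀.arr 11) (s₀.arr 12) es.length (s₀.arr 13 v) (preds es v)) :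
    Run M solvePop s 36 fun s' => SolveInv B es s₀ s' st (preds es v) pr (v :: done) := by
  have hfit : ∀ {s : Store} {e : Expr}, s.Bdd B → e.small = true → e.cost ≤ 10 → e.Fits M s :=
    fun hs h₁ h₂ => hM.fits hs (Expr.ok_iff.2 ⟨h₁, h₂.trans hD⟩)
  have hsp : s.reg 51 = st.length + 1 := by rw [h.height, List.length_cons]
  refine (Run.seq (T' := 30) (Run.assign (hfit h.bdd rfl (by decide)) ?_)).mono (by decide)
    fun _ h => h
  have e₁ : (Expr.op .sub (.reg 51) (.const 1)).eval s = st.length := by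
    simp [Expr.eval, BinOp.eval, hsp]
  rw [e₁]
  set s₁ := s.setReg 51 st.length with hs₁
  have b₁ : s₁.Bdd B := h.bdd.setReg (by have := h.bdd.1 51; omega)
  refine (Run.assign (hfit b₁ rfl (by decide)) ?_).mono (by decide) fun _ h => h
  have e₂ : (Expr.load 13 (.load 16 (.reg 51))).eval s₁ = s₀.arr 13 v := by
    simp [Expr.eval, hs₁, Store.reg_setReg, Store.arr_setReg, h.stack.1, h.head]
  rw [e₂]
  have hperm : (v :: done ++ st).Perm (done ++ v :: st) := List.perm_middle.symm
  refine ⟨⟨fun r hr => ?_, h.frame.2⟩, b₁.setReg (h.head ▸ h.bdd.2 _ _), h.src, h.next, h.head, ?_,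
    ?_, h.stack.2.congr fun _ _ => rfl, h.need, hperm.nodup_iff.2 h.nodup, fun u => ?_, fun u => ?_,
    ?_, ?_, fun u hu => h.sound u (hperm.mem_iff.1 hu)⟩
  · rw [Store.reg_setReg, if_neg (by omega), hs₁, Store.reg_setReg, if_neg (by omega),
      h.frame.1 r hr]
  · rw [Store.reg_setReg, if_pos rfl]
    exact hch v
  · simp [hs₁, Store.reg_setReg]
  · rw [hperm.mem_iff, h.mem]
  · have := h.count u
    rw [List.map_cons, List.sum_cons, ← this, List.count_nil]
    omega
  · have := h.len
    rw [List.map_cons, List.sum_cons, ← this, List.length_nil]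
    omega
  · rw [hperm.length_eq]
    exact h.height_le

/-- The solver computes the lost nodes in time linear in the number of edges. -/
theorem run_solve {M B D : ℕ} (hM : Roomy M B D) (hD : 10 ≤ D) {es : List Edge} {s : Store}
    (hs : s.Bdd B) (hes : EdgeInv es s) (h₀ : needOf es 0 = 0) (hB : es.length + 2 ≤ B) :
    Run M solve s (100 * es.length + 100) fun s' =>
      ((∀ r < 50, s'.reg r = s.reg r) ∧ ∀ a ≤ 10, s'.arr a = s.arr a) ∧ s'.Bdd B ∧
        ∀ u, (s'.arr 14 u = 0 ∧ (u = 0 ∨ 0 < needOf es u)) ↔ LostNode es u := by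
  have hfit : ∀ {s : Store} {e : Expr}, s.Bdd B → e.small = true → e.cost ≤ 10 → e.Fits M s :=
    fun hs h₁ h₂ => hM.fits hs (Expr.ok_iff.2 ⟨h₁, h₂.trans hD⟩)
  set s₁ := s.setArr 16 0 0 with hs₁
  have b₁ : s₁.Bdd B := hs.setArr (Nat.zero_le _)
  set s₂ := s₁.setReg 50 0 with hs₂
  have b₂ : s₂.Bdd B := b₁.setReg (Nat.zero_le _)
  set s₃ := s₂.setReg 51 1 with hs₃
  have b₃ : s₃.Bdd B := b₂.setReg (by omega)
  refine (Run.seq (T' := 100 * es.length + 90) (Run.store (hfit hs rfl (by decide))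
    (hfit hs rfl (by decide)) ?_)).mono (by simp only [Expr.cost]; omega) fun _ h => h
  refine (Run.seq (T' := 100 * es.length + 80) (Run.assign (hfit b₁ rfl (by decide)) ?_)).mono
    (by simp only [Expr.cost]; omega) fun _ h => h
  refine (Run.seq (T' := 100 * es.length + 70) (Run.assign (hfit b₂ rfl (by decide)) ?_)).mono
    (by simp only [Expr.cost]; omega) fun _ h => h
  -- Each untreated edge holds `100` credits and each node on the stack `50`. An edge spends `100`,
  -- of which up to `50` pass to the node it pushes; a pop spends `50`. Both cover an iteration,
  -- whose body and test cost `44`.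
  let I : ℕ → Store → Prop := fun φ s' => ∃ st rem pr done, SolveInv B es s s' st rem pr done ∧
    φ + 100 * pr.length = 100 * es.length + 50 * st.length
  refine (Run.loop I ?_ ?_ ?_ (φ := 100 * es.length + 50) ?_).mono
    (by simp only [Expr.cost]; omega) fun _ h => h
  · rintro φ s' ⟨st, rem, pr, done, h, -⟩
    exact hfit h.bdd rfl (by decide)
  · rintro φ s' ⟨st, rem, pr, done, h, hφ⟩ hne
    refine ⟨40, (Run.cond (T := 36) (hfit h.bdd rfl (by decide)) (fun hc => ?_)
      fun hc => ?_).mono (by decide) fun _ h => h⟩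
    · have hlink := h.link
      cases rem with
      | nil => exact absurd hlink hc
      | cons u rem =>
        refine (h.edge hM hD hB).mono le_rfl fun s'' ⟨st', hst', h'⟩ =>
          ⟨100 * es.length + 50 * st'.length - 100 * (u :: pr).length, ⟨st', _, _, _, h', ?_⟩, ?_⟩
        · have := h'.length_le
          omega
        · have := h'.length_le
          simp only [List.length_cons, Expr.cost] at this ⊢
          omega
    · have hc : s'.reg 50 = 0 := hc
      have hlink := h.link
      have hrem : rem = [] := by
        cases rem with
        | nil => rfl
        | cons u rem =>
          obtain ⟨k, -, hk, -⟩ := hlink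
          omega
      subst hrem
      cases st with
      | nil =>
        have h51 : s'.reg 51 = 0 := h.height
        simp [Expr.eval, BinOp.eval, hc, h51] at hne
      | cons v st =>
        refine (h.pop hM hD hes.chain).mono le_rfl fun s'' h' =>
          ⟨100 * es.length + 50 * st.length - 100 * pr.length, ⟨st, _, _, _, h', ?_⟩, ?_⟩
        · have := h.length_le
          omega
        · have := h.length_le
          simp only [List.length_cons, Expr.cost] at hφ ⊢
          omega
  · rintro φ s' ⟨st, rem, pr, done, h, -⟩ heq
    simp only [Expr.eval, BinOp.eval, Nat.add_eq_zero_iff] at heq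
    have hst : st = [] := List.eq_nil_of_length_eq_zero (by rw [← h.height, heq.2])
    have hlink := h.link
    have hrem : rem = [] := by
      cases rem with
      | nil => rfl
      | cons u rem =>
        obtain ⟨k, -, hk, -⟩ := hlink
        omega
    subst hst hrem
    exact ⟨h.frame, h.bdd, h.lost_iff h₀⟩
  · refine ⟨[0], [], [], [], ⟨⟨fun r hr => ?_, fun a ha => ?_⟩, b₃, rfl, rfl, rfl, rfl, rfl, ?_, ?_,
      by simp, fun u => ?_, by simp, rfl, le_rfl, fun u hu => ?_⟩, by simp⟩
    · show s₃.reg r = _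
      rw [hs₃, hs₂, Store.reg_setReg, Store.reg_setReg, if_neg (by omega), if_neg (by omega)]
      rfl
    · exact Store.arr_setArr_of_ne _ _ _ (by omega)
    · exact ⟨by simp [hs₂, hs₁, Store.arr_setReg, Store.arr_setArr], trivial⟩
    · exact hes.need
    · simp only [List.nil_append, List.mem_singleton, List.count_nil, Nat.sub_zero]
      constructor
      · rintro rfl
        exact ⟨h₀, Or.inl rfl⟩
      · rintro ⟨h, h' | h'⟩
        · exact h'
        · omega
    · rw [List.nil_append, List.mem_singleton] at hu
      exact hu ▸ LostNode.zero es

end FairSim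

namespace FairSim

/-! ### Sets of emitted edges -/

/-- The program emits edges that form the set `E`. -/
def EmitsSet (M B : ℕ) (p : Prog) (r : ℕ) (s₀ : Store) (E : Edge → Prop) (T : ℕ) : Prop :=
  ∃ l, Emits M B p r s₀ l T ∧ ∀ e, e ∈ l ↔ E e

section EmitsSetRules

variable {M B D r : ℕ} {s₀ : Store} {p q : Prog} {E E' : Edge → Prop} {T T' : ℕ}

theorem EmitsSet.mono (h : EmitsSet M B p r s₀ E T) (hT : T ≤ T') : EmitsSet M B p r s₀ E T' := by
  obtain ⟨l, h, hl⟩ := h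
  exact ⟨l, h.mono hT, hl⟩

theorem EmitsSet.seq (hp : EmitsSet M B p r s₀ E T) (hq : EmitsSet M B q r s₀ E' T') :
    EmitsSet M B (.seq p q) r s₀ (fun e => E e ∨ E' e) (T + T') := by
  obtain ⟨l, hp, hl⟩ := hp
  obtain ⟨l', hq, hl'⟩ := hq
  refine ⟨l' ++ l, hp.seq hq, fun e => ?_⟩
  rw [List.mem_append, hl, hl', or_comm]

theorem EmitsSet.cond {e : Expr} {x : ℕ} (hM : Roomy M B D)
    (he : (e.ok D && e.inFrame r) = true) (hx : e.eval s₀ = x)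
    (hp : x ≠ 0 → EmitsSet M B p r s₀ E T) :
    EmitsSet M B (.cond e p .skip) r s₀ (fun y => x ≠ 0 ∧ E y)
      (e.cost + 2 + if x = 0 then 0 else T) := by
  subst hx
  by_cases h : e.eval s₀ = 0
  · refine ⟨[], Emits.cond hM he (fun h' => absurd h h') fun _ => rfl, fun y => ?_⟩
    simp [h]
  · obtain ⟨l, hp, hl⟩ := hp h
    refine ⟨l, Emits.cond hM he (fun _ => hp) fun h' => absurd h' h, fun y => ?_⟩
    simp [h, hl]

theorem EmitsSet.assign {e : Expr} {x : ℕ} (hM : Roomy M B D)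
    (he : (e.ok D && e.inFrame r) = true) (hx : e.eval s₀ = x) (hB : x ≤ B)
    (hp : EmitsSet M B p (r + 1) (s₀.setReg (r + 1) x) E T) :
    EmitsSet M B (.seq (.assign (r + 1) e) p) r s₀ E (e.cost + 1 + T) := by
  subst hx
  obtain ⟨l, hp, hl⟩ := hp
  exact ⟨l, hp.assign hM he hB, hl⟩

theorem EmitsSet.forLoop {e : Expr} {n : ℕ} {E : ℕ → Edge → Prop} {T : ℕ → ℕ}
    (hM : Roomy M B D) (hD : 3 ≤ D)
    (he : ((Expr.op .lt (.reg (r + 1)) e).ok D && e.inFrame r) = true) (hn : e.eval s₀ = n)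
    (hB : n ≤ B)
    (hp : ∀ i < n, EmitsSet M B p (r + 1) (s₀.setReg (r + 1) i) (E i) (T i)) :
    EmitsSet M B (FairSim.forLoop (r + 1) e p) r s₀ (fun y => ∃ i < n, E i y)
      (∑ i ∈ Finset.range n, (T i + e.cost + 7) + e.cost + 5) := by
  subst hn
  have h : ∀ i, ∃ l, i < e.eval s₀ → Emits M B p (r + 1) (s₀.setReg (r + 1) i) l (T i) ∧
      ∀ e, e ∈ l ↔ E i e := fun i => by
    by_cases hi : i < e.eval s₀
    · obtain ⟨l, hl⟩ := hp i hi
      exact ⟨l, fun _ => hl⟩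
    · exact ⟨[], fun h => absurd h hi⟩
  choose l hl using h
  refine ⟨_, Emits.forLoop hM hD he hB fun i hi => (hl i hi).1, fun y => ?_⟩
  rw [mem_revConcat]
  exact exists_congr fun i => and_congr_right fun hi => (hl i hi).2 y

/-- A loop all of whose iterations take time at most `c * τ`. -/
theorem EmitsSet.forLoop_le {e : Expr} {n c τ : ℕ} {E : ℕ → Edge → Prop}
    (hM : Roomy M B D) (hD : 3 ≤ D)
    (he : ((Expr.op .lt (.reg (r + 1)) e).ok D && e.inFrame r) = true) (hn : e.eval s₀ = n)
    (hB : n ≤ B) (hn₁ : 1 ≤ n) (hτ : 1 ≤ τ) (hc : e.cost ≤ 1)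
    (hp : ∀ i < n, EmitsSet M B p (r + 1) (s₀.setReg (r + 1) i) (E i) (c * τ)) :
    EmitsSet M B (FairSim.forLoop (r + 1) e p) r s₀ (fun y => ∃ i < n, E i y)
      ((c + 14) * (n * τ)) := by
  refine (EmitsSet.forLoop hM hD he hn hB hp).mono ?_
  rw [Finset.sum_const, Finset.card_range, smul_eq_mul]
  have h₁ : n * (c * τ + e.cost + 7) ≤ n * (c * τ + 8) := Nat.mul_le_mul_left _ (by omega)
  have h₂ : n * 1 ≤ n * τ := Nat.mul_le_mul_left _ hτ
  have h₃ : n * (c * τ + 8) = c * (n * τ) + 8 * n := by ring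
  have h₄ : (c + 14) * (n * τ) = c * (n * τ) + 14 * (n * τ) := by ring
  omega

theorem EmitsSet.emit {k U V : ℕ} {u v : Expr} (hM : Roomy M B D) (hk : k ≤ 1)
    (hu : (u.ok D && u.inFrame r) = true) (hv : (v.ok D && v.inFrame r) = true)
    (hDu : u.cost + 5 ≤ D) (hDv : v.cost + 1 ≤ D) (hU : u.eval s₀ = U) (hV : v.eval s₀ = V)
    (huB : U ≤ B) :
    EmitsSet M B (FairSim.emit k u v) r s₀ (fun y => y = (k, U, V))
      (3 * u.cost + 2 * v.cost + 26) := by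
  subst hU hV
  exact ⟨_, Emits.emit hM hk hu hv hDu hDv huB, fun e => by simp⟩

end EmitsSetRules

/-! ### Lost nodes in terms of the set of edges -/

/-- The nodes from which the spoiler can reach the root. -/
inductive Lost (E : Edge → Prop) : ℕ → Prop
  | zero : Lost E 0
  | spoiler {u v : ℕ} (h : E (0, u, v)) (hv : Lost E v) : Lost E u
  | duplicator {u v₀ : ℕ} (h : E (1, u, v₀)) (hv : ∀ v, E (1, u, v) → Lost E v) : Lost E u

theorem needOf_eq_zero {es : List Edge} {u : ℕ} (h : ∀ k v, (k, u, v) ∉ es) :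
    needOf es u = 0 := by
  induction es with
  | nil => rfl
  | cons e es ih =>
    obtain ⟨k, u', v'⟩ := e
    have hu : u' ≠ u := fun hu => h k v' (by simp [hu])
    rw [needOf, if_neg hu]
    exact ih fun k v hk => h k v (List.mem_cons_of_mem _ hk)

theorem needOf_pos {es : List Edge} {k u v : ℕ} (h : (k, u, v) ∈ es) : 0 < needOf es u := by
  induction es with
  | nil => simp at h
  | cons e es ih =>
    obtain ⟨k', u', v'⟩ := e
    rw [needOf]
    split_ifs with hu
    · omega
    · refine ih ((List.mem_cons.1 h).resolve_left fun he => hu ?_)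
      simp only [Prod.mk.injEq] at he
      exact he.2.1.symm

theorem needOf_spoiler {es : List Edge} {u v : ℕ} (h : (0, u, v) ∈ es)
    (h₁ : ∀ k v, (k, u, v) ∈ es → k = 0) : needOf es u = 1 := by
  induction es generalizing v with
  | nil => simp at h
  | cons e es ih =>
    obtain ⟨k', u', v'⟩ := e
    rw [needOf]
    split_ifs with hu
    · subst hu
      rw [h₁ k' v' List.mem_cons_self, Nat.zero_mul]
    · refine ih ((List.mem_cons.1 h).resolve_left fun he => hu ?_)
        fun k v hk => h₁ k v (List.mem_cons_of_mem _ hk)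
      simp only [Prod.mk.injEq] at he
      exact he.2.1.symm

theorem needOf_duplicator {es : List Edge} {u : ℕ} (h₁ : ∀ k v, (k, u, v) ∈ es → k = 1) :
    needOf es u = es.countP fun e => e.2.1 = u := by
  induction es with
  | nil => rfl
  | cons e es ih =>
    obtain ⟨k', u', v'⟩ := e
    have ih := ih fun k v hk => h₁ k v (List.mem_cons_of_mem _ hk)
    rw [needOf, List.countP_cons]
    by_cases hu : u' = u
    · subst hu
      rw [h₁ k' v' List.mem_cons_self, if_pos rfl, ih]
      simp [add_comm]
    · simp [hu, ih]

theorem countTo_le (es : List Edge) (Q : Set ℕ) (u : ℕ) :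
    countTo es Q u ≤ es.countP fun e => e.2.1 = u :=
  List.countP_mono_left fun e _ he => by
    simp only [decide_eq_true_eq] at he ⊢
    exact he.1

theorem countTo_lt {es : List Edge} {Q : Set ℕ} {k u v : ℕ} (h : (k, u, v) ∈ es) (hv : v ∉ Q) :
    countTo es Q u < es.countP fun e => e.2.1 = u := by
  classical
  induction es with
  | nil => simp at h
  | cons e es ih =>
    have hle := countTo_le es Q u
    unfold countTo at hle ih ⊢
    rw [List.countP_cons, List.countP_cons]
    rcases List.mem_cons.1 h with rfl | h
    · rw [if_neg (by simp [hv]), if_pos (by simp)]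
      omega
    · have ih := ih h
      by_cases h₁ : e.2.1 = u
      · rw [if_pos (c := decide (e.2.1 = u) = true) (by simpa using h₁)]
        split_ifs <;> omega
      · rw [if_neg (by simp [h₁]), if_neg (by simp [h₁])]
        omega

/-- By `hcons` every node has edges of one kind only. A spoiler node needs one lost successor, a
duplicator node all of its list entries. Repeated entries raise the need and the count alike, so
only the set of edges matters. -/
theorem lostNode_iff {es : List Edge} {E : Edge → Prop} (hE : ∀ e, e ∈ es ↔ E e)
    (hk : ∀ e ∈ es, e.1 ≤ 1) (hcons : ∀ u v v', E (0, u, v) → ¬ E (1, u, v')) (u : ℕ) :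
    LostNode es u ↔ Lost E u := by
  classical
  have hkind₀ : ∀ {u v}, E (0, u, v) → ∀ k v', (k, u, v') ∈ es → k = 0 := by
    intro u v h k v' hkv
    by_contra hne
    have h₁ : k ≤ 1 := hk _ hkv
    obtain rfl : k = 1 := by omega
    exact hcons u v v' h ((hE _).1 hkv)
  have hkind₁ : ∀ {u v}, E (1, u, v) → ∀ k v', (k, u, v') ∈ es → k = 1 := by
    intro u v h k v' hkv
    by_contra hne
    have h₁ : k ≤ 1 := hk _ hkv
    obtain rfl : k = 0 := by omega
    exact hcons u v' v ((hE _).1 hkv) h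
  constructor
  · intro h
    refine h {u | Lost E u} Lost.zero fun u hu hu' => ?_
    have hex : ∃ k v, (k, u, v) ∈ es := by
      by_contra! hne
      rw [needOf_eq_zero hne] at hu
      exact lt_irrefl 0 hu
    obtain ⟨k, v, hkv⟩ := hex
    have hk₁ : k ≤ 1 := hk _ hkv
    have hkv' := (hE _).1 hkv
    obtain rfl | rfl : k = 0 ∨ k = 1 := by omega
    · rw [needOf_spoiler hkv (hkind₀ hkv')] at hu'
      obtain ⟨⟨k, u', v'⟩, he, hp⟩ := List.countP_pos_iff.1 (Nat.lt_of_lt_of_le one_pos hu')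
      simp only [decide_eq_true_eq] at hp
      obtain ⟨rfl, hv'⟩ := hp
      obtain rfl := hkind₀ hkv' k v' he
      exact Lost.spoiler ((hE _).1 he) hv'
    · rw [needOf_duplicator (hkind₁ hkv')] at hu'
      refine Lost.duplicator hkv' fun v' hv' => ?_
      by_contra hne
      have hlt := countTo_lt (Q := {u | Lost E u}) ((hE _).2 hv') hne
      omega
  · intro h
    induction h with
    | zero => exact LostNode.zero es
    | @spoiler u v h _ ih =>
      have hmem := (hE _).2 h
      refine LostNode.step (needOf_pos hmem) ?_
      rw [needOf_spoiler hmem (hkind₀ h)]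
      refine List.countP_pos_iff.2 ⟨_, hmem, ?_⟩
      simpa using ih
    | @duplicator u v₀ h _ ih =>
      have hmem := (hE _).2 h
      refine LostNode.step (needOf_pos hmem) ?_
      rw [needOf_duplicator (hkind₁ h)]
      refine List.countP_mono_left fun e he hu => ?_
      obtain ⟨k, u', v'⟩ := e
      simp only [decide_eq_true_eq] at hu ⊢
      subst hu
      obtain rfl := hkind₁ h k v' he
      exact ⟨rfl, ih v' ((hE _).1 he)⟩

/-! ### Names of nodes -/

/-- An injective pairing. -/
def qpair (a b : ℕ) : ℕ := (a + b) * (a + b) + a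

/-- The value lies between the squares of `a + b` and `a + b + 1`, so it determines the sum and then
`a`. -/
theorem qpair_inj {a b c d : ℕ} : qpair a b = qpair c d ↔ a = c ∧ b = d := by
  refine ⟨fun h => ?_, fun ⟨h₁, h₂⟩ => by rw [h₁, h₂]⟩
  unfold qpair at h
  have hs : a + b = c + d := by
    rcases lt_trichotomy (a + b) (c + d) with hlt | heq | hlt
    · nlinarith
    · exact heq
    · nlinarith
  rw [hs] at h
  omega

/-- Nested pairings raise the exponent through `1, 4, 10, 22, 46, 94, 190`. The last value, reached
by `answeredId`, fixes the bound `Y ^ 190` used for all stores. -/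
theorem qpair_le {a b Y k : ℕ} (hY : 3 ≤ Y) (ha : a ≤ Y) (hk : 1 ≤ k) (hb : b ≤ Y ^ k) :
    qpair a b ≤ Y ^ (2 * k + 2) := by
  have h₁ : Y ≤ Y ^ k := Nat.le_self_pow (by omega) Y
  have h₂ : (a + b) * (a + b) ≤ (2 * Y ^ k) * (2 * Y ^ k) :=
    Nat.mul_le_mul (by omega) (by omega)
  have h₃ : Y ^ (2 * k + 2) = (Y ^ k * Y ^ k) * (Y * Y) := by ring
  have h₄ : 3 * 3 ≤ Y * Y := Nat.mul_le_mul hY hY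
  have h₅ : Y ^ k ≤ Y ^ k * Y ^ k := Nat.le_mul_self _
  have h₆ : (Y ^ k * Y ^ k) * 9 ≤ (Y ^ k * Y ^ k) * (Y * Y) := Nat.mul_le_mul_left _ h₄
  have h₇ : (2 * Y ^ k) * (2 * Y ^ k) = 4 * (Y ^ k * Y ^ k) := by ring
  unfold qpair
  omega

def qpairE (a b : Expr) : Expr := .op .add (.op .mul (.op .add a b) (.op .add a b)) a

/-- The position with the pair `(w, w')`, the flag `f` and the counter `c`. -/
def pairId (w w' f c : ℕ) : ℕ := qpair 1 (qpair w (qpair w' (qpair f c)))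

def pairE (w w' f c : Expr) : Expr := qpairE (.const 1) (qpairE w (qpairE w' (qpairE f c)))

theorem eval_pairE (w w' f c : Expr) (s : Store) :
    (pairE w w' f c).eval s = pairId (w.eval s) (w'.eval s) (f.eval s) (c.eval s) := rfl

theorem pairId_inj {w w' f c v v' g d : ℕ} :
    pairId w w' f c = pairId v v' g d ↔ w = v ∧ w' = v' ∧ f = g ∧ c = d := by
  simp [pairId, qpair_inj]

theorem pairId_le {Y w w' f c : ℕ} (hY : 3 ≤ Y) (hw : w ≤ Y) (hw' : w' ≤ Y) (hf : f ≤ Y)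
    (hc : c ≤ Y) : pairId w w' f c ≤ Y ^ 46 :=
  qpair_le hY (by omega) (by norm_num) <| qpair_le hY hw (by norm_num) <|
    qpair_le hY hw' (by norm_num) <| qpair_le (k := 1) hY hf le_rfl (by simpa using hc)

end FairSim

namespace FairSim

/-! ### The common part of both programs -/

theorem Run.forLoop {M B D r n T : ℕ} {e : Expr} {p : Prog} {s : Store} (hM : Roomy M B D)
    (hD : 3 ≤ D) (he : (Expr.op .lt (.reg r) e).ok D = true) (I : ℕ → Store → Prop)
    (hI : ∀ i s, I i s → s.Bdd B ∧ s.reg r = i ∧ e.eval s = n)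
    (hstep : ∀ i < n, ∀ s, I i s →
      Run M p s T fun s' => s'.Bdd B ∧ s'.reg r = i ∧ I (i + 1) (s'.setReg r (i + 1)))
    (hs : s.Bdd B) (h₀ : I 0 (s.setReg r 0)) :
    Run M (forLoop r e p) s (n * (T + e.cost + 7) + e.cost + 5) (I n) := by
  have fit₀ : ∀ {s : Store}, s.Bdd B → (Expr.const 0).Fits M s := fun hs =>
    hM.fits hs (Expr.ok_iff.2 ⟨rfl, by simp only [Expr.cost]; omega⟩)
  have fit₁ : ∀ {s : Store}, s.Bdd B → (Expr.op .add (.reg r) (.const 1)).Fits M s := fun hs =>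
    hM.fits hs (Expr.ok_iff.2 ⟨rfl, by simp only [Expr.cost]; omega⟩)
  have hlt : ∀ i s, I i s → (Expr.op .lt (.reg r) e).eval s = if i < n then 1 else 0 := by
    intro i s h
    simp only [Expr.eval, BinOp.eval, (hI i s h).2.1, (hI i s h).2.2]
  refine (Run.seq (T := 2) (T' := n * (T + e.cost + 7) + (1 + e.cost + 1) + 1)
    (Run.assign (fit₀ hs) ?_)).mono (by omega) fun _ h => h
  refine Run.loop (fun φ s => ∃ i ≤ n, I i s ∧ φ + i * (T + e.cost + 7) = n * (T + e.cost + 7))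
    ?_ ?_ ?_ (φ := n * (T + e.cost + 7)) ⟨0, Nat.zero_le _, h₀, by simp⟩
  · rintro φ s ⟨i, -, h, -⟩
    exact hM.fits (hI i s h).1 he
  · rintro φ s ⟨i, hi, h, hφ⟩ hne
    rw [hlt i s h] at hne
    have hin : i < n := by
      by_contra h
      rw [if_neg h] at hne
      exact hne rfl
    refine ⟨T + 4, Run.seq ((hstep i hin s h).mono le_rfl fun s' ⟨hb, hr, hs'⟩ =>
      Run.assign (fit₁ hb) ⟨n * (T + e.cost + 7) - (i + 1) * (T + e.cost + 7), ⟨i + 1, hin, ?_,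
        ?_⟩, ?_⟩)⟩
    · simpa only [Expr.eval, BinOp.eval, hr] using hs'
    · exact Nat.sub_add_cancel (Nat.mul_le_mul_right _ hin)
    · have : (i + 1) * (T + e.cost + 7) ≤ n * (T + e.cost + 7) := Nat.mul_le_mul_right _ hin
      have h₁ : (i + 1) * (T + e.cost + 7) = i * (T + e.cost + 7) + (T + e.cost + 7) := by ring
      simp only [Expr.cost]
      omega
  · rintro φ s ⟨i, hi, h, -⟩ heq
    rw [hlt i s h] at heq
    have hin : i = n := by
      by_contra h
      rw [if_pos (by omega)] at heq
      exact one_ne_zero heq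
    exact hin ▸ h

theorem add_mul_inj {n i j i' j' : ℕ} (hj : j < n) (hj' : j' < n) :
    i * n + j = i' * n + j' ↔ i = i' ∧ j = j' := by
  refine ⟨fun h => ?_, fun ⟨h₁, h₂⟩ => by rw [h₁, h₂]⟩
  have h₁ : i = i' := by
    rcases lt_trichotomy i i' with hlt | heq | hlt
    · have := Nat.mul_le_mul_right n hlt
      rw [Nat.succ_mul] at this
      omega
    · exact heq
    · have := Nat.mul_le_mul_right n hlt
      rw [Nat.succ_mul] at this
      omega
  subst h₁
  exact ⟨rfl, by omega⟩

/-- The program that writes the table of the relation. The registers `rn` and `rn'` hold the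
numbers of states, and the arrays `aL` and `aL'` the labels. -/
def output (rn rn' aL aL' : ℕ) : Prog :=
  forLoop 10 (.reg rn) <| forLoop 11 (.reg rn') <|
    .store 0 (.op .add (.op .mul (.reg 10) (.reg rn')) (.reg 11))
      (.op .mul (.op .eq (.load aL (.reg 10)) (.load aL' (.reg 11)))
        (.op .lt (.const 0) (.load 14 (pairE (.reg 10) (.reg 11) (.const 0) (.const 0)))))

theorem run_output {M B D : ℕ} (hM : Roomy M B D) (hD : 200 ≤ D) {rn rn' aL aL' n n' : ℕ}
    (hrn : rn < 10) (hrn' : rn' < 10) (haL : aL ≠ 0) (haL' : aL' ≠ 0) {s : Store} (hs : s.Bdd B)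
    (hn : s.reg rn = n) (hn' : s.reg rn' = n') (hB : n ≤ B) (hB' : n' ≤ B) (hB₁ : 1 ≤ B) :
    Run M (output rn rn' aL aL') s (n * (n' * 200 + 20) + 20) fun s' =>
      ∀ w < n, ∀ w' < n', s'.arr 0 (w * n' + w') =
        (if s.arr aL w = s.arr aL' w' then 1 else 0) *
          (if 0 < s.arr 14 (pairId w w' 0 0) then 1 else 0) := by
  let val : ℕ → ℕ → ℕ := fun w w' => (if s.arr aL w = s.arr aL' w' then 1 else 0) *
          (if 0 < s.arr 14 (pairId w w' 0 0) then 1 else 0)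
  have hval : ∀ w w', val w w' ≤ B := fun w w' => by
    simp only [val]
    split_ifs <;> omega
  let keep : Store → Prop := fun t => t.Bdd B ∧ (∀ r < 10, t.reg r = s.reg r) ∧
    ∀ a, a ≠ 0 → t.arr a = s.arr a
  have hfit : ∀ {s : Store} {e : Expr}, s.Bdd B → e.small = true → e.cost ≤ 200 → e.Fits M s :=
    fun hs h₁ h₂ => hM.fits hs (Expr.ok_iff.2 ⟨h₁, h₂.trans hD⟩)
  have hok : ∀ r r', (Expr.op .lt (.reg r) (.reg r')).ok D = true := fun r r' =>
    Expr.ok_iff.2 ⟨rfl, by simp only [Expr.cost]; omega⟩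
  have hcost : ((Expr.op .mul (.reg 10) (.reg rn')).op .add (.reg 11)).cost +
      ((Expr.op .eq (.load aL (.reg 10)) (.load aL' (.reg 11))).op .mul
        (.op .lt (.const 0) (.load 14 (pairE (.reg 10) (.reg 11) (.const 0) (.const 0))))).cost + 1
      ≤ 150 := by
    simp [Expr.cost, pairE, qpairE]
  refine (Run.forLoop (n := n) (T := n' * 200 + 8) hM (by omega) (hok _ _) (fun i t => keep t ∧
    t.reg 10 = i ∧ ∀ w < i, ∀ w' < n', t.arr 0 (w * n' + w') = val w w') ?_ ?_ hs ?_).mono ?_ ?_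
  · rintro i t ⟨hk, hi, -⟩
    exact ⟨hk.1, hi, (hk.2.1 rn hrn).trans hn⟩
  · rintro i hi t ⟨hk, hti, hout⟩
    -- The invariant covers the pairs that precede `(i, j)` lexicographically.
    refine (Run.forLoop (n := n') (T := 150) hM (by omega) (hok _ _) (fun j t => keep t ∧
      t.reg 10 = i ∧ t.reg 11 = j ∧ ∀ w w', w' < n' → (w < i ∨ (w = i ∧ w' < j)) →
        t.arr 0 (w * n' + w') = val w w') ?_ ?_ hk.1 ?_).mono ?_ ?_
    · rintro j t ⟨hk, -, hj, -⟩
      exact ⟨hk.1, hj, (hk.2.1 rn' hrn').trans hn'⟩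
    · rintro j hj t ⟨hk, hti, htj, hout⟩
      refine (Run.store (hfit hk.1 rfl ?_) (hfit hk.1 rfl ?_) ?_).mono hcost fun _ h => h
      · omega
      · omega
      have e₁ : ((Expr.op .mul (.reg 10) (.reg rn')).op .add (.reg 11)).eval t = i * n' + j := by
        simp only [Expr.eval, BinOp.eval, hti, htj, hk.2.1 rn' hrn', hn']
      have e₂ : ((Expr.op .eq (.load aL (.reg 10)) (.load aL' (.reg 11))).op .mul
          (.op .lt (.const 0) (.load 14
            (pairE (.reg 10) (.reg 11) (.const 0) (.const 0))))).eval t = val i j := by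
        simp only [Expr.eval, BinOp.eval, eval_pairE, hti, htj, hk.2.2 aL haL, hk.2.2 aL' haL',
          hk.2.2 14 (by norm_num), val]
      rw [e₁, e₂]
      refine ⟨hk.1.setArr (hval _ _), htj, ⟨(hk.1.setArr (hval _ _)).setReg (by omega), ?_, ?_⟩,
        ?_, ?_, ?_⟩
      · intro r hr
        rw [Store.reg_setReg, if_neg (by omega), Store.reg_setArr, hk.2.1 r hr]
      · intro a ha
        rw [Store.arr_setReg, Store.arr_setArr_of_ne _ _ _ ha, hk.2.2 a ha]
      · rw [Store.reg_setReg, if_neg (by omega), Store.reg_setArr, hti]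
      · rw [Store.reg_setReg, if_pos rfl]
      · intro w w' hw' hw
        rw [Store.arr_setReg, Store.arr_setArr]
        split_ifs with h
        · obtain ⟨rfl, rfl⟩ := (add_mul_inj hw' hj).1 h.2
          rfl
        · refine hout w w' hw' ?_
          rcases hw with hw | ⟨rfl, hw⟩
          · exact Or.inl hw
          · refine Or.inr ⟨rfl, (Nat.lt_succ_iff_lt_or_eq.1 hw).resolve_right ?_⟩
            rintro rfl
            exact h ⟨rfl, rfl⟩
    · refine ⟨⟨hk.1.setReg (Nat.zero_le _), fun r hr => ?_, hk.2.2⟩, ?_, ?_, ?_⟩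
      · rw [Store.reg_setReg, if_neg (by omega), hk.2.1 r hr]
      · rw [Store.reg_setReg, if_neg (by omega), hti]
      · rw [Store.reg_setReg, if_pos rfl]
      · rintro w w' hw' (hw | ⟨-, hw⟩)
        · exact hout w hw w' hw'
        · omega
    · have : n' * (150 + (Expr.reg rn').cost + 7) ≤ n' * 200 :=
        Nat.mul_le_mul_left _ (by simp [Expr.cost])
      simp only [Expr.cost] at this ⊢
      omega
    · rintro t ⟨hk, hti, -, hout⟩
      refine ⟨hk.1, hti, ⟨hk.1.setReg (by omega), fun r hr => ?_, hk.2.2⟩, ?_, ?_⟩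
      · rw [Store.reg_setReg, if_neg (by omega), hk.2.1 r hr]
      · rw [Store.reg_setReg, if_pos rfl]
      · intro w hw w' hw'
        exact hout w w' hw' (by omega)
  · refine ⟨⟨hs.setReg (Nat.zero_le _), fun r hr => ?_, fun _ _ => rfl⟩, ?_, ?_⟩
    · rw [Store.reg_setReg, if_neg (by omega)]
    · rw [Store.reg_setReg, if_pos rfl]
    · intro w hw
      omega
  · have : n * (n' * 200 + 8 + (Expr.reg rn).cost + 7) ≤ n * (n' * 200 + 20) :=
      Nat.mul_le_mul_left _ (by simp [Expr.cost])
    simp only [Expr.cost] at this ⊢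
    omega
  · rintro t ⟨-, -, h⟩
    exact h

/-- The number of levels is computed in register `9`; then the program `p` emits the edges of the
game graph. -/
def decideBy (rn rn' aL aL' : ℕ) (p : Prog) : Prog :=
  .seq (.assign 9 (.op .add (.op .mul (.op .mul (.const 2) (.reg rn)) (.reg rn')) (.const 1))) <|
  .seq p <| .seq solve <| output rn rn' aL aL'

/-- An emitter outputs at most one edge per step, so `T` bounds the number of edges as well, and the
solver adds `100 * T`. By `hout` each pair has an outgoing edge, hence a positive need at first; a
final need of `0` then means that it is lost. -/
theorem run_decideBy {M B D : ℕ} (hM : Roomy M B D) (hD : 200 ≤ D) {rn rn' aL aL' n n' : ℕ}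
    (hrn : rn < 9) (hrn' : rn' < 9) (haL : aL ≠ 0) (haL' : aL' ≠ 0) (haL₁ : aL ≤ 10)
    (haL'₁ : aL' ≤ 10) {s : Store} (hs : s.Bdd B) (h0 : ∀ a, 10 < a → s.arr a = fun _ => 0)
    (hn : s.reg rn = n) (hn' : s.reg rn' = n') (hB : 2 * n * n' + 1 ≤ B)
    {p : Prog} {E : Edge → Prop} {T : ℕ}
    (hp : EmitsSet M B p 9 (s.setReg 9 (2 * n * n' + 1)) E T) (hT : T + 2 ≤ B)
    (hcons : ∀ u v v', E (0, u, v) → ¬ E (1, u, v')) (hroot : ∀ k v, ¬ E (k, 0, v))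
    (hout : ∀ w < n, ∀ w' < n', ∃ k v, E (k, pairId w w' 0 0, v)) :
    Run M (decideBy rn rn' aL aL' p) s (101 * T + (n * (n' * 200 + 20) + 200)) fun s' =>
      ∀ w < n, ∀ w' < n', (s'.arr 0 (w * n' + w') = 0 ∨ s'.arr 0 (w * n' + w') = 1) ∧
        (s'.arr 0 (w * n' + w') = 1 ↔ s.arr aL w = s.arr aL' w' ∧ ¬ Lost E (pairId w w' 0 0)) := by
  have hfit : ∀ {s : Store} {e : Expr}, s.Bdd B → e.small = true → e.cost ≤ 200 → e.Fits M s :=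
    fun hs h₁ h₂ => hM.fits hs (Expr.ok_iff.2 ⟨h₁, h₂.trans hD⟩)
  obtain ⟨l, ⟨⟨hlen, hk⟩, hp⟩, hl⟩ := hp
  refine (Run.seq (T' := 101 * T + (n * (n' * 200 + 20) + 150))
    (Run.assign (hfit hs rfl ?_) ?_)).mono ?_ fun _ h => h
  · simp [Expr.cost]
  swap
  · simp only [Expr.cost]
    omega
  have e₁ : ((Expr.op .mul (.op .mul (.const 2) (.reg rn)) (.reg rn')).op .add
      (.const 1)).eval s = 2 * n * n' + 1 := by
    simp only [Expr.eval, BinOp.eval, hn, hn']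
  rw [e₁]
  set s₁ := s.setReg 9 (2 * n * n' + 1) with hs₁
  have b₁ : s₁.Bdd B := hs.setReg hB
  have inv₁ : EdgeInv [] s₁ := by
    refine ⟨?_, fun v => ?_, fun u => ?_⟩
    · rw [hs₁, Store.arr_setReg, h0 15 (by norm_num)]
      rfl
    · show s.arr 13 v = 0
      rw [h0 13 (by norm_num)]
    · show s.arr 14 u = 0
      rw [h0 14 (by norm_num)]
  refine (Run.seq (T := T) (T' := 100 * T + (n * (n' * 200 + 20) + 150))
    ((hp s₁ [] (Frame.refl _ _) b₁ inv₁ (by simp) (by simp; omega)).mono le_rfl ?_)).mono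
    (by omega) fun _ h => h
  rintro s₂ ⟨f₂, b₂, inv₂⟩
  rw [List.append_nil] at inv₂
  have hneed0 : needOf l 0 = 0 := needOf_eq_zero fun k v h => hroot k v ((hl _).1 h)
  refine (Run.seq (T' := n * (n' * 200 + 20) + 20)
    ((run_solve hM (by omega) b₂ inv₂ hneed0 (by omega)).mono le_rfl ?_)).mono (by omega)
    fun _ h => h
  rintro s₃ ⟨⟨r₃, a₃⟩, b₃, hlost⟩
  have hreg : ∀ r < 9, s₃.reg r = s.reg r := fun r hr => by
    rw [r₃ r (by omega), f₂.1 r (by omega), hs₁, Store.reg_setReg, if_neg (by omega)]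
  have harr : ∀ a ≤ 10, s₃.arr a = s.arr a := fun a ha => by
    rw [a₃ a ha, f₂.2 a ha]
    rfl
  have hnB : n ≤ B := hn ▸ hs.1 rn
  have hnB' : n' ≤ B := hn' ▸ hs.1 rn'
  refine (run_output hM hD (by omega) (by omega) haL haL' b₃ ((hreg rn hrn).trans hn)
    ((hreg rn' hrn').trans hn') hnB hnB' (by omega)).mono le_rfl fun s₄ h₄ w hw w' hw' => ?_
  obtain ⟨k, v, hE⟩ := hout w hw w' hw'
  have hpos := needOf_pos ((hl _).2 hE)
  have hlost' := (hlost (pairId w w' 0 0)).trans (lostNode_iff hl hk hcons _)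
  have hlost'' : s₃.arr 14 (pairId w w' 0 0) = 0 ↔ Lost E (pairId w w' 0 0) := by
    rw [← hlost']
    exact ⟨fun h => ⟨h, Or.inr hpos⟩, fun h => h.1⟩
  rw [h₄ w hw w' hw', harr aL haL₁, harr aL' haL'₁, ← hlost'']
  by_cases h₁ : s.arr aL w = s.arr aL' w' <;>
    by_cases h₂ : s₃.arr 14 (pairId w w' 0 0) = 0 <;> simp [h₁, h₂, Nat.pos_iff_ne_zero]

/-! ### Updating flag and counter -/

/-- The flag after entering a pair of states with labels `l` and `l'`. -/
def flagNum (f l l' : ℕ) : ℕ := 1 - (1 - f) * if l = l' then 1 else 0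

/-- The counter after entering a pair of states, where `x` and `x'` tell whether they are Büchi
states, and `f` is the new flag. -/
def countNum (f x x' c : ℕ) : ℕ := (1 - (1 - f) * x') * (c + x)

theorem bit_eq_zero {P : Prop} : bit P = 0 ↔ ¬ P := by
  unfold bit
  split_ifs with h <;> simp [h]

theorem bit_le_one (P : Prop) : bit P ≤ 1 := by
  unfold bit
  split_ifs <;> omega

section Update

variable {s : ℕ} {W A₁ A₂ W' A₁' A₂' : Type*} {K : FairATS (Fin s) W A₁ A₂}
  {K' : FairATS (Fin s) W' A₁' A₂'}

theorem flagNum_eq (f : Bool) (v : W) (v' : W') :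
    flagNum f.toNat (K.L v) (K'.L v') = (mismatch K K' f v v').toNat := by
  unfold flagNum mismatch
  by_cases h : K.L v = K'.L v'
  · cases f <;> simp [h]
  · have h' : (K.L v : ℕ) ≠ K'.L v' := fun h' => h (Fin.ext h')
    cases f <;> simp [h, h']

theorem countNum_eq (f : Bool) (v : W) (v' : W') (c : ℕ) :
    countNum f.toNat (bit (v ∈ K.F)) (bit (v' ∈ K'.F)) c =
      bump (goodPos W K'.F) (badPos W' K.F) c (v, v', f) := by
  unfold countNum bump goodPos badPos bit
  by_cases h₁ : v ∈ K.F <;> by_cases h₂ : v' ∈ K'.F <;> cases f <;> simp [h₁, h₂]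

end Update

theorem bump_le {X : Type*} (good bad : Set X) (c : ℕ) (y : X) : bump good bad c y ≤ c + 1 := by
  unfold bump
  split_ifs <;> omega

/-- The program that computes the new flag in register `r + 1` and the new counter in register
`r + 3`. -/
def update (r rf rc rv rv' aL aF aL' aF' : ℕ) (p : Prog) : Prog :=
  .seq (.assign (r + 1) (.op .sub (.const 1) (.op .mul (.op .sub (.const 1) (.reg rf))
    (.op .eq (.load aL (.reg rv)) (.load aL' (.reg rv')))))) <|
  .seq (.assign (r + 1 + 1) (.op .mul (.op .sub (.const 1) (.reg (r + 1)))
    (.load aF' (.reg rv')))) <|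
  .seq (.assign (r + 1 + 1 + 1) (.op .mul (.op .sub (.const 1) (.reg (r + 1 + 1)))
    (.op .add (.reg rc) (.load aF (.reg rv))))) p

/-- Flag and counter are computed by arithmetic on truth values, without branching. Register `r + 2`
tells whether the new position is good. -/
theorem EmitsSet.update {M B D r rf rc rv rv' aL aF aL' aF' : ℕ} {s₀ : Store} {p : Prog}
    {E : Edge → Prop} {T f l l' x x' c : ℕ} (hM : Roomy M B D) (hD : 20 ≤ D)
    (hr : rf ≤ r ∧ rc ≤ r ∧ rv ≤ r ∧ rv' ≤ r) (ha : aL ≤ 10 ∧ aF ≤ 10 ∧ aL' ≤ 10 ∧ aF' ≤ 10)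
    (hf : s₀.reg rf = f) (hc : s₀.reg rc = c) (hl : s₀.arr aL (s₀.reg rv) = l)
    (hx : s₀.arr aF (s₀.reg rv) = x) (hl' : s₀.arr aL' (s₀.reg rv') = l')
    (hx' : s₀.arr aF' (s₀.reg rv') = x') (hx₁' : x' ≤ 1) (hB : c + x ≤ B) (hB₁ : 1 ≤ B)
    (hp : EmitsSet M B p (r + 3) (((s₀.setReg (r + 1) (flagNum f l l')).setReg (r + 2)
      ((1 - flagNum f l l') * x')).setReg (r + 3) (countNum (flagNum f l l') x x' c)) E T) :
    EmitsSet M B (FairSim.update r rf rc rv rv' aL aF aL' aF' p) r s₀ E (T + 40) := by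
  refine (EmitsSet.assign (x := flagNum f l l') hM ?_ ?_ ?_ (EmitsSet.assign
    (x := (1 - flagNum f l l') * x') hM ?_ ?_ ?_ (EmitsSet.assign
    (x := countNum (flagNum f l l') x x' c) hM ?_ ?_ ?_ hp))).mono ?_
  · rw [Bool.and_eq_true, Expr.ok_iff]
    refine ⟨⟨rfl, by simp only [Expr.cost]; omega⟩, ?_⟩
    simp only [Expr.inFrame, Bool.and_eq_true, decide_eq_true_eq, true_and]
    omega
  · simp only [Expr.eval, BinOp.eval, hf, hl, hl', flagNum]
  · unfold flagNum
    omega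
  · rw [Bool.and_eq_true, Expr.ok_iff]
    refine ⟨⟨rfl, by simp only [Expr.cost]; omega⟩, ?_⟩
    simp only [Expr.inFrame, Bool.and_eq_true, decide_eq_true_eq, true_and]
    omega
  · simp only [Expr.eval, BinOp.eval, Store.reg_setReg, Store.arr_setReg, if_pos]
    rw [if_neg (by omega), hx']
  · have : (1 - flagNum f l l') * x' ≤ 1 * 1 := Nat.mul_le_mul (by omega) hx₁'
    omega
  · rw [Bool.and_eq_true, Expr.ok_iff]
    refine ⟨⟨rfl, by simp only [Expr.cost]; omega⟩, ?_⟩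
    simp only [Expr.inFrame, Bool.and_eq_true, decide_eq_true_eq, true_and]
    omega
  · simp only [Expr.eval, BinOp.eval, Store.reg_setReg, Store.arr_setReg, if_pos]
    rw [if_neg (by omega), if_neg (by omega), if_neg (by omega), if_neg (by omega), hc, hx]
    rfl
  · have : countNum (flagNum f l l') x x' c ≤ 1 * (c + x) := Nat.mul_le_mul_right _ (by omega)
    omega
  · simp only [Expr.cost]
    omega

end FairSim

namespace FairSim

/-! ### Tables -/

theorem table_apply {n : ℕ} (f : Fin n → ℕ) (i : Fin n) : table f i = f i := by
  simp [table]

theorem table₂_apply {m n : ℕ} (f : Fin m → Fin n → ℕ) (i : Fin m) (j : Fin n) :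
    table₂ f (i * n + j) = f i j := by
  have hlt : (i : ℕ) * n + j < m * n := by
    have h := Nat.mul_le_mul_right n i.2
    rw [Nat.succ_mul] at h
    have := j.2
    omega
  have hn : 0 < n := j.pos
  have h₁ : (⟨(i : ℕ) * n + j, hlt⟩ : Fin (m * n)).divNat = i := by
    ext
    simp only [Fin.coe_divNat]
    rw [mul_comm, Nat.mul_add_div hn, Nat.div_eq_of_lt j.2, add_zero]
  have h₂ : (⟨(i : ℕ) * n + j, hlt⟩ : Fin (m * n)).modNat = j := by
    ext
    simp only [Fin.coe_modNat]
    rw [mul_comm, Nat.mul_add_mod, Nat.mod_eq_of_lt j.2]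
  unfold table₂ table
  rw [dif_pos hlt]
  simp only [h₁, h₂]

theorem table₃_apply {m n k : ℕ} (f : Fin m → Fin n → Fin k → ℕ) (i : Fin m) (j : Fin n)
    (l : Fin k) : table₃ f ((i * n + j) * k + l) = f i j l := by
  have hlt : (i : ℕ) * n + j < m * n := by
    have h := Nat.mul_le_mul_right n i.2
    rw [Nat.succ_mul] at h
    have := j.2
    omega
  have hn : 0 < n := j.pos
  have h₁ : (⟨(i : ℕ) * n + j, hlt⟩ : Fin (m * n)).divNat = i := by
    ext
    simp only [Fin.coe_divNat]
    rw [mul_comm, Nat.mul_add_div hn, Nat.div_eq_of_lt j.2, add_zero]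
  have h₂ : (⟨(i : ℕ) * n + j, hlt⟩ : Fin (m * n)).modNat = j := by
    ext
    simp only [Fin.coe_modNat]
    rw [mul_comm, Nat.mul_add_mod, Nat.mod_eq_of_lt j.2]
  have := table₂_apply (fun (q : Fin (m * n)) l => f q.divNat q.modNat l)
    ⟨(i : ℕ) * n + j, hlt⟩ l
  rw [h₁, h₂] at this
  exact this

theorem table_le {n B : ℕ} {f : Fin n → ℕ} (h : ∀ i, f i ≤ B) (j : ℕ) : table f j ≤ B := by
  unfold table
  split_ifs
  exacts [h _, Nat.zero_le _]

/-! ### The game graph of two alternating transition systems -/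

/-- Agent 1 has chosen `a` in `K`. -/
def choseId (w w' a f c : ℕ) : ℕ := qpair 2 (qpair w (qpair w' (qpair a (qpair f c))))

/-- Agent 1 has chosen `a` in `K` and `a'` in `K'`. -/
def answeredId (w w' a a' f c : ℕ) : ℕ :=
  qpair 3 (qpair w (qpair w' (qpair a (qpair a' (qpair f c)))))

/-- Agent 1 has chosen `a` in `K`, and `K'` is about to enter `v'`. -/
def movedId (w a v' f c : ℕ) : ℕ := qpair 4 (qpair w (qpair a (qpair v' (qpair f c))))

section ATSGraph

variable {s n k₁ k₂ n' k₁' k₂' : ℕ} (K : FairATS (Fin s) (Fin n) (Fin k₁) (Fin k₂))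
  (K' : FairATS (Fin s) (Fin n') (Fin k₁') (Fin k₂'))

/-- The edges of the game graph; the counter is less than `N + 1` except at lost positions. -/
inductive ATSEdge (N : ℕ) : Edge → Prop
  | chose (w : Fin n) (w' : Fin n') (a : Fin k₁) (f : Bool) (c : ℕ) (hc : c < N + 1)
      (ha : a ∈ K.P₁ w) : ATSEdge N (0, pairId w w' f.toNat c, choseId w w' a f.toNat c)
  | answered (w : Fin n) (w' : Fin n') (a : Fin k₁) (a' : Fin k₁') (f : Bool) (c : ℕ)
      (hc : c < N + 1) (ha : a ∈ K.P₁ w) (ha' : a' ∈ K'.P₁ w') :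
      ATSEdge N (1, choseId w w' a f.toNat c, answeredId w w' a a' f.toNat c)
  | moved (w : Fin n) (w' : Fin n') (a : Fin k₁) (a' : Fin k₁') (b' : Fin k₂') (f : Bool) (c : ℕ)
      (hc : c < N + 1) (ha : a ∈ K.P₁ w) (ha' : a' ∈ K'.P₁ w') (hb' : b' ∈ K'.P₂ w') :
      ATSEdge N (0, answeredId w w' a a' f.toNat c, movedId w a (K'.δ w' a' b') f.toNat c)
  | entered (w : Fin n) (a : Fin k₁) (b : Fin k₂) (v' : Fin n') (f : Bool) (c : ℕ)
      (hc : c < N + 1) (hb : b ∈ K.P₂ w) :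
      ATSEdge N (1, movedId w a v' f.toNat c,
        pairId (K.δ w a b) v' (mismatch K K' f (K.δ w a b) v').toNat
          (bump (goodPos (Fin n) K'.F) (badPos (Fin n') K.F) c
            (K.δ w a b, v', mismatch K K' f (K.δ w a b) v')))
  | dead (w : Fin n) (w' : Fin n') (f : Bool) : ATSEdge N (0, pairId w w' f.toNat (N + 1), 0)

variable {K K'} {N : ℕ}

theorem toNat_inj {f g : Bool} : f.toNat = g.toNat ↔ f = g := by
  cases f <;> cases g <;> simp

theorem ATSEdge.inv_duplicator {u v : ℕ} (h : ATSEdge K K' N (1, u, v)) :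
    (∃ (w : Fin n) (w' : Fin n') (a : Fin k₁) (a' : Fin k₁') (f : Bool) (c : ℕ),
      a' ∈ K'.P₁ w' ∧ u = choseId w w' a f.toNat c ∧ v = answeredId w w' a a' f.toNat c) ∨
    ∃ (w : Fin n) (a : Fin k₁) (b : Fin k₂) (v' : Fin n') (f : Bool) (c : ℕ),
      b ∈ K.P₂ w ∧ u = movedId w a v' f.toNat c ∧
        v = pairId (K.δ w a b) v' (mismatch K K' f (K.δ w a b) v').toNat
          (bump (goodPos (Fin n) K'.F) (badPos (Fin n') K.F) c
            (K.δ w a b, v', mismatch K K' f (K.δ w a b) v')) := by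
  cases h with
  | answered w w' a a' f c hc ha ha' => exact Or.inl ⟨w, w', a, a', f, c, ha', rfl, rfl⟩
  | entered w a b v' f c hc hb => exact Or.inr ⟨w, a, b, v', f, c, hb, rfl, rfl⟩

theorem ATSEdge.inv_spoiler {u v : ℕ} (h : ATSEdge K K' N (0, u, v)) :
    (∃ w w' f c, u = pairId w w' f c) ∨ ∃ w w' a a' f c, u = answeredId w w' a a' f c := by
  cases h with
  | chose => exact Or.inl ⟨_, _, _, _, rfl⟩
  | moved => exact Or.inr ⟨_, _, _, _, _, _, rfl⟩
  | dead => exact Or.inl ⟨_, _, _, _, rfl⟩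

theorem ATSEdge.not_duplicator {u v v' : ℕ} (h : ATSEdge K K' N (0, u, v)) :
    ¬ ATSEdge K K' N (1, u, v') := by
  intro h'
  rcases h'.inv_duplicator with ⟨_, _, _, _, _, _, -, rfl, -⟩ | ⟨_, _, _, _, _, _, -, rfl, -⟩ <;>
    rcases h.inv_spoiler with ⟨_, _, _, _, h⟩ | ⟨_, _, _, _, _, _, h⟩ <;>
    simp [choseId, movedId, pairId, answeredId, qpair_inj] at h

theorem ATSEdge.ne_zero {k v : ℕ} : ¬ ATSEdge K K' N (k, 0, v) := by
  intro h
  generalize hu : (0 : ℕ) = u at h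
  cases h <;> revert hu <;> simp [choseId, movedId, pairId, answeredId, qpair]

/-- One induction treats all four kinds of nodes. Each carries the part of the quantifier block of
`forcePre` that is still to be played; distinct tags exclude the mixed cases. -/
theorem losing_of_lost {u : ℕ} (h : Lost (ATSEdge K K' N) u) :
    (∀ (w : Fin n) (w' : Fin n') (f : Bool) (c : ℕ), u = pairId w w' f.toNat c →
      losing K K' N (w, w', f) c) ∧
    (∀ (w : Fin n) (w' : Fin n') (a : Fin k₁) (f : Bool) (c : ℕ), u = choseId w w' a f.toNat c →
      ∀ a' ∈ K'.P₁ w', ∃ b' ∈ K'.P₂ w', ∀ b ∈ K.P₂ w, losing K K' N (K.δ w a b, K'.δ w' a' b',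
        mismatch K K' f (K.δ w a b) (K'.δ w' a' b')) (bump (goodPos (Fin n) K'.F)
          (badPos (Fin n') K.F) c (K.δ w a b, K'.δ w' a' b',
            mismatch K K' f (K.δ w a b) (K'.δ w' a' b')))) ∧
    (∀ (w : Fin n) (w' : Fin n') (a : Fin k₁) (a' : Fin k₁') (f : Bool) (c : ℕ),
      u = answeredId w w' a a' f.toNat c →
      ∃ b' ∈ K'.P₂ w', ∀ b ∈ K.P₂ w, losing K K' N (K.δ w a b, K'.δ w' a' b',
        mismatch K K' f (K.δ w a b) (K'.δ w' a' b')) (bump (goodPos (Fin n) K'.F)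
          (badPos (Fin n') K.F) c (K.δ w a b, K'.δ w' a' b',
            mismatch K K' f (K.δ w a b) (K'.δ w' a' b')))) ∧
    (∀ (w : Fin n) (a : Fin k₁) (v' : Fin n') (f : Bool) (c : ℕ), u = movedId w a v' f.toNat c →
      ∀ b ∈ K.P₂ w, losing K K' N (K.δ w a b, v', mismatch K K' f (K.δ w a b) v')
        (bump (goodPos (Fin n) K'.F) (badPos (Fin n') K.F) c
          (K.δ w a b, v', mismatch K K' f (K.δ w a b) v'))) := by
  induction h with
  | zero =>
    refine ⟨?_, ?_, ?_, ?_⟩ <;> intros <;>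
      simp_all [choseId, movedId, pairId, answeredId, qpair]
  | @spoiler u v h _ ih =>
    cases h with
    | chose w w' a f c hc ha =>
      refine ⟨fun v v' g d h => ?_, ?_, ?_, ?_⟩
      · simp only [pairId_inj, Fin.val_inj, toNat_inj] at h
        obtain ⟨rfl, rfl, rfl, rfl⟩ := h
        exact Lose.of_pre (forcePre_mono K K') ⟨a, ha, ih.2.1 w w' a f c rfl⟩
      all_goals first
        | (intro _ _ _ _ _ h; exact absurd (qpair_inj.1 h).1 (by decide))
        | (intro _ _ _ _ _ _ h; exact absurd (qpair_inj.1 h).1 (by decide))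
    | moved w w' a a' b' f c hc ha ha' hb' =>
      refine ⟨?_, ?_, fun v v' d d' g e h => ?_, ?_⟩
      rotate_left 2
      · simp only [answeredId, qpair_inj, Fin.val_inj, toNat_inj, true_and] at h
        obtain ⟨rfl, rfl, rfl, rfl, rfl, rfl⟩ := h
        exact ⟨b', hb', ih.2.2.2 w a _ f c rfl⟩
      all_goals first
        | (intro _ _ _ _ h; exact absurd (qpair_inj.1 h).1 (by decide))
        | (intro _ _ _ _ _ h; exact absurd (qpair_inj.1 h).1 (by decide))
    | dead w w' f =>
      refine ⟨fun v v' g d h => ?_, ?_, ?_, ?_⟩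
      · simp only [pairId_inj] at h
        exact Lose.of_lt (by omega)
      all_goals first
        | (intro _ _ _ _ _ h; exact absurd (qpair_inj.1 h).1 (by decide))
        | (intro _ _ _ _ _ _ h; exact absurd (qpair_inj.1 h).1 (by decide))
  | @duplicator u v₀ h _ ih =>
    cases h with
    | answered w w' a a₀' f c hc ha ha₀' =>
      refine ⟨?_, fun v v' d g e h a' ha' => ?_, ?_, ?_⟩
      rotate_left
      · simp only [choseId, qpair_inj, Fin.val_inj, toNat_inj, true_and] at h
        obtain ⟨rfl, rfl, rfl, rfl, rfl⟩ := h
        exact (ih _ (ATSEdge.answered w w' a a' f c hc ha ha')).2.2.1 w w' a a' f c rfl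
      all_goals first
        | (intro _ _ _ _ h; exact absurd (qpair_inj.1 h).1 (by decide))
        | (intro _ _ _ _ _ h; exact absurd (qpair_inj.1 h).1 (by decide))
        | (intro _ _ _ _ _ _ h; exact absurd (qpair_inj.1 h).1 (by decide))
    | entered w a b₀ v' f c hc hb₀ =>
      refine ⟨?_, ?_, ?_, fun v d u' g e h b hb => ?_⟩
      rotate_left 3
      · simp only [movedId, qpair_inj, Fin.val_inj, toNat_inj, true_and] at h
        obtain ⟨rfl, rfl, rfl, rfl, rfl⟩ := h
        exact (ih _ (ATSEdge.entered w a b v' f c hc hb)).1 _ _ _ _ rfl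
      all_goals first
        | (intro _ _ _ _ h; exact absurd (qpair_inj.1 h).1 (by decide))
        | (intro _ _ _ _ _ h; exact absurd (qpair_inj.1 h).1 (by decide))
        | (intro _ _ _ _ _ _ h; exact absurd (qpair_inj.1 h).1 (by decide))

/-- A step raises the counter by at most one, so the game reaches level `N + 1`, where the `dead`
edges apply, before it could leave the graph. Nonempty action sets give every duplicator node an
edge, which `Lost.duplicator` asks for. -/
theorem lost_of_losing {x : Fin n × Fin n' × Bool} {c : ℕ} (h : losing K K' N x c)
    (hc : c ≤ N + 1) : Lost (ATSEdge K K' N) (pairId x.1 x.2.1 x.2.2.toNat c) := by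
  have hdead : ∀ (x : Fin n × Fin n' × Bool) c, c ≤ N + 1 → N < c →
      Lost (ATSEdge K K' N) (pairId x.1 x.2.1 x.2.2.toNat c) := by
    intro x c hc hN
    obtain rfl : c = N + 1 := by omega
    exact Lost.spoiler (ATSEdge.dead x.1 x.2.1 x.2.2) Lost.zero
  refine h (fun x c => c ≤ N + 1 →
    Lost (ATSEdge K K' N) (pairId x.1 x.2.1 x.2.2.toNat c)) ?_ ?_ hc
  · exact fun x c hN hc => hdead x c hc hN
  · rintro ⟨w, w', f⟩ c ⟨a, ha, hx⟩ hc
    rcases Nat.lt_or_ge N c with hN | hN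
    · exact hdead _ c hc hN
    · have hc' : c < N + 1 := by omega
      refine Lost.spoiler (ATSEdge.chose w w' a f c hc' ha) ?_
      obtain ⟨a₀', ha₀'⟩ := K'.P₁_nonempty w'
      refine Lost.duplicator (ATSEdge.answered w w' a a₀' f c hc' ha ha₀') fun v hv => ?_
      rcases hv.inv_duplicator with ⟨v, v', d, a', g, e, ha', h, rfl⟩ | ⟨_, _, _, _, _, _, _, h, _⟩
      · simp only [choseId, qpair_inj, Fin.val_inj, toNat_inj, true_and] at h
        obtain ⟨rfl, rfl, rfl, rfl, rfl⟩ := h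
        obtain ⟨b', hb', hx⟩ := hx a' ha'
        refine Lost.spoiler (ATSEdge.moved w w' a a' b' f c hc' ha ha' hb') ?_
        obtain ⟨b₀, hb₀⟩ := K.P₂_nonempty w
        refine Lost.duplicator (ATSEdge.entered w a b₀ _ f c hc' hb₀) fun v hv => ?_
        rcases hv.inv_duplicator with ⟨_, _, _, _, _, _, _, h, _⟩ | ⟨v, d, b, u', g, e, hb, h, rfl⟩
        · simp [choseId, movedId, qpair_inj] at h
        · simp only [movedId, qpair_inj, Fin.val_inj, toNat_inj, true_and] at h
          obtain ⟨rfl, rfl, rfl, rfl, rfl⟩ := h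
          exact hx b hb ((bump_le _ _ _ _).trans (by omega))
      · simp [choseId, movedId, qpair_inj] at h

theorem lost_iff_losing (w : Fin n) (w' : Fin n') :
    Lost (ATSEdge K K' N) (pairId w w' 0 0) ↔ losing K K' N (w, w', false) 0 :=
  ⟨fun h => (losing_of_lost h).1 w w' false 0 rfl, fun h => lost_of_losing h (Nat.zero_le _)⟩

end ATSGraph

end FairSim

namespace FairSim

/-! ### Emission rules with time bounds of the form `c * τ` -/

section BoundedRules

variable {M B D r c c' τ : ℕ} {s₀ : Store} {p q : Prog} {E E' : Edge → Prop}

theorem EmitsSet.congr {T : ℕ} (h : EmitsSet M B p r s₀ E T) (hE : ∀ e, E e ↔ E' e) :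
    EmitsSet M B p r s₀ E' T := by
  obtain ⟨l, h, hl⟩ := h
  exact ⟨l, h, fun e => (hl e).trans (hE e)⟩

theorem EmitsSet.const_mul {T : ℕ} (h : EmitsSet M B p r s₀ E T) (hT : T ≤ c) (hτ : 1 ≤ τ) :
    EmitsSet M B p r s₀ E (c * τ) :=
  h.mono (hT.trans (Nat.le_mul_of_pos_right _ hτ))

theorem EmitsSet.seq_le (hp : EmitsSet M B p r s₀ E (c * τ))
    (hq : EmitsSet M B q r s₀ E' (c' * τ)) :
    EmitsSet M B (.seq p q) r s₀ (fun e => E e ∨ E' e) ((c + c') * τ) := by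
  rw [add_mul]
  exact hp.seq hq

theorem EmitsSet.cond_le {e : Expr} {P : Prop} (hM : Roomy M B D)
    (he : (e.ok D && e.inFrame r) = true) (hP : e.eval s₀ = bit P) (hc : e.cost ≤ 20)
    (hτ : 1 ≤ τ) (hp : P → EmitsSet M B p r s₀ E (c * τ)) :
    EmitsSet M B (.cond e p .skip) r s₀ (fun y => P ∧ E y) ((c + 22) * τ) := by
  have hP₀ : bit P ≠ 0 ↔ P := by rw [Ne, bit_eq_zero, not_not]
  refine ((EmitsSet.cond hM he hP fun h => hp (hP₀.1 h)).mono ?_).congr fun e => ?_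
  · rw [add_mul]
    split_ifs <;> omega
  · rw [hP₀]

/-- A loop multiplies `τ` by its range and adds `14` to the constant: up to `8` per iteration and
`6` once, as both factors are at least `1`. Nested loops thus keep a bound in product form. -/
theorem EmitsSet.forLoop_fin {e : Expr} {n : ℕ} {E : Fin n → Edge → Prop}
    (hM : Roomy M B D) (hD : 3 ≤ D)
    (he : ((Expr.op .lt (.reg (r + 1)) e).ok D && e.inFrame r) = true) (hn : e.eval s₀ = n)
    (hB : n ≤ B) (hn₁ : 1 ≤ n) (hτ : 1 ≤ τ) (hc : e.cost ≤ 1)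
    (hp : ∀ i : Fin n, EmitsSet M B p (r + 1) (s₀.setReg (r + 1) i) (E i) (c * τ)) :
    EmitsSet M B (FairSim.forLoop (r + 1) e p) r s₀ (fun y => ∃ i, E i y)
      ((c + 14) * (n * τ)) := by
  refine (EmitsSet.forLoop_le (E := fun i y => ∃ h : i < n, E ⟨i, h⟩ y) hM hD he hn hB hn₁ hτ hc
    fun i hi => (hp ⟨i, hi⟩).congr fun e => ⟨fun h => ⟨hi, h⟩, fun ⟨_, h⟩ => h⟩).congr fun e => ?_
  constructor
  · rintro ⟨i, hi, _, h⟩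
    exact ⟨⟨i, hi⟩, h⟩
  · rintro ⟨i, h⟩
    exact ⟨i, i.2, i.2, h⟩

theorem EmitsSet.forLoop_bool {E : Bool → Edge → Prop} (hM : Roomy M B D) (hD : 3 ≤ D)
    (hB : 2 ≤ B) (hτ : 1 ≤ τ)
    (hp : ∀ f : Bool, EmitsSet M B p (r + 1) (s₀.setReg (r + 1) f.toNat) (E f) (c * τ)) :
    EmitsSet M B (FairSim.forLoop (r + 1) (.const 2) p) r s₀ (fun y => ∃ f, E f y)
      ((c + 14) * (2 * τ)) := by
  refine (EmitsSet.forLoop_fin (n := 2) (E := fun i => E (i == 1)) hM hD ?_ rfl hB (by norm_num)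
    hτ le_rfl fun i => ?_).congr fun e => ?_
  · rw [Bool.and_eq_true, Expr.ok_iff]
    exact ⟨⟨rfl, by simp only [Expr.cost]; omega⟩, rfl⟩
  · fin_cases i
    exacts [hp false, hp true]
  · constructor
    · rintro ⟨i, h⟩
      exact ⟨_, h⟩
    · rintro ⟨f, h⟩
      cases f
      exacts [⟨0, h⟩, ⟨1, h⟩]

end BoundedRules

/-- The program that makes the pairs whose counter has reached register `9` lost. -/
def emitDead (rn rn' : ℕ) : Prog :=
  forLoop 10 (.const 2) <| forLoop 11 (.reg rn) <| forLoop 12 (.reg rn') <|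
    emit 0 (pairE (.reg 11) (.reg 12) (.reg 10) (.reg 9)) (.const 0)

theorem emitsSet_emitDead {M B Y n n' m rn rn' : ℕ} {s₀ : Store} (hM : Roomy M B 2000)
    (hrn : rn < 9) (hrn' : rn' < 9) (hn : s₀.reg rn = n) (hn' : s₀.reg rn' = n')
    (hm : s₀.reg 9 = m) (hY : 3 ≤ Y) (hnY : n ≤ Y) (hnY' : n' ≤ Y) (hmY : m ≤ Y)
    (hYB : Y ^ 190 ≤ B) (hn₁ : 1 ≤ n) (hn₁' : 1 ≤ n') :
    EmitsSet M B (emitDead rn rn') 9 s₀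
      (fun e => ∃ (f : Bool) (w : Fin n) (w' : Fin n'), e = (0, pairId w w' f.toNat m, 0))
      (500 * (2 * (n * (n' * 1)))) := by
  have hYB' : Y ≤ B := (Nat.le_self_pow (by norm_num) Y).trans hYB
  have hpos : 1 ≤ n * (n' * 1) := Nat.mul_pos hn₁ (by omega)
  refine (EmitsSet.forLoop_bool (c := 458 + 14 + 14) hM (by norm_num) (by omega) hpos
    fun f => ?_)
  refine EmitsSet.forLoop_fin hM (by norm_num) ?_ ?_ (by omega) hn₁ (by omega) le_rfl fun w => ?_
  · simp [Expr.ok, Expr.small, Expr.cost, Expr.inFrame]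
    omega
  · simp only [Expr.eval, Store.reg_setReg]
    rw [if_neg (by omega), hn]
  refine EmitsSet.forLoop_fin hM (by norm_num) ?_ ?_ (by omega) hn₁' le_rfl le_rfl fun w' => ?_
  · simp [Expr.ok, Expr.small, Expr.cost, Expr.inFrame]
    omega
  · simp only [Expr.eval, Store.reg_setReg]
    rw [if_neg (by omega), if_neg (by omega), hn']
  refine (EmitsSet.emit hM (by norm_num) rfl rfl (by decide) (by decide) ?_ ?_ ?_).const_mul
    (by decide) le_rfl
  · simp [eval_pairE, Expr.eval, Store.reg_setReg, hm]
  · rfl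
  · refine (pairId_le hY (by omega) (by omega) ?_ hmY).trans
      ((Nat.pow_le_pow_right (by omega) (by norm_num)).trans hYB)
    have := f.toNat_le
    omega

/-! ### The program for alternating transition systems -/

def choseE (w w' a f c : Expr) : Expr :=
  qpairE (.const 2) (qpairE w (qpairE w' (qpairE a (qpairE f c))))

/-- The tags `3` and `4` are written as sums because `Expr.small` admits only constants up to `2`.
-/
def answeredE (w w' a a' f c : Expr) : Expr :=
  qpairE (.op .add (.const 2) (.const 1))
    (qpairE w (qpairE w' (qpairE a (qpairE a' (qpairE f c)))))

def movedE (w a v' f c : Expr) : Expr :=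
  qpairE (.op .add (.const 2) (.const 2)) (qpairE w (qpairE a (qpairE v' (qpairE f c))))

theorem eval_choseE (w w' a f c : Expr) (s : Store) : (choseE w w' a f c).eval s =
    choseId (w.eval s) (w'.eval s) (a.eval s) (f.eval s) (c.eval s) := rfl

theorem eval_answeredE (w w' a a' f c : Expr) (s : Store) : (answeredE w w' a a' f c).eval s =
    answeredId (w.eval s) (w'.eval s) (a.eval s) (a'.eval s) (f.eval s) (c.eval s) := rfl

theorem eval_movedE (w a v' f c : Expr) (s : Store) : (movedE w a v' f c).eval s =
    movedId (w.eval s) (a.eval s) (v'.eval s) (f.eval s) (c.eval s) := rfl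

theorem choseId_le {Y w w' a f c : ℕ} (hY : 3 ≤ Y) (hw : w ≤ Y) (hw' : w' ≤ Y) (ha : a ≤ Y)
    (hf : f ≤ Y) (hc : c ≤ Y) : choseId w w' a f c ≤ Y ^ 94 :=
  qpair_le hY (by omega) (by norm_num) <| qpair_le hY hw (by norm_num) <|
    qpair_le hY hw' (by norm_num) <| qpair_le hY ha (by norm_num) <|
      qpair_le (k := 1) hY hf le_rfl (by simpa using hc)

theorem answeredId_le {Y w w' a a' f c : ℕ} (hY : 3 ≤ Y) (hw : w ≤ Y) (hw' : w' ≤ Y) (ha : a ≤ Y)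
    (ha' : a' ≤ Y) (hf : f ≤ Y) (hc : c ≤ Y) : answeredId w w' a a' f c ≤ Y ^ 190 :=
  qpair_le hY (by omega) (by norm_num) <| qpair_le hY hw (by norm_num) <|
    qpair_le hY hw' (by norm_num) <| qpair_le hY ha (by norm_num) <|
      qpair_le hY ha' (by norm_num) <| qpair_le (k := 1) hY hf le_rfl (by simpa using hc)

theorem movedId_le {Y w a v' f c : ℕ} (hY : 4 ≤ Y) (hw : w ≤ Y) (ha : a ≤ Y) (hv' : v' ≤ Y)
    (hf : f ≤ Y) (hc : c ≤ Y) : movedId w a v' f c ≤ Y ^ 94 :=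
  qpair_le (by omega) (by omega) (by norm_num) <| qpair_le (by omega) hw (by norm_num) <|
    qpair_le (by omega) ha (by norm_num) <| qpair_le (by omega) hv' (by norm_num) <|
      qpair_le (k := 1) (by omega) hf le_rfl (by simpa using hc)

/-- Registers: `10` flag, `11` counter, `12` state of `K`, `13` state of `K'`, `14` action of
Agent 1 in `K`, `15` and `16` actions of Agents 1 and 2 in `K'`. -/
def emitChoices : Prog :=
  forLoop 13 (.reg 5) <| forLoop 14 (.reg 2) <|
    .cond (.load 1 (.op .add (.op .mul (.reg 12) (.reg 2)) (.reg 14)))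
      (.seq (emit 0 (pairE (.reg 12) (.reg 13) (.reg 10) (.reg 11))
          (choseE (.reg 12) (.reg 13) (.reg 14) (.reg 10) (.reg 11))) <|
        forLoop 15 (.reg 6) <|
          .cond (.load 6 (.op .add (.op .mul (.reg 13) (.reg 6)) (.reg 15)))
            (.seq (emit 1 (choseE (.reg 12) (.reg 13) (.reg 14) (.reg 10) (.reg 11))
                (answeredE (.reg 12) (.reg 13) (.reg 14) (.reg 15) (.reg 10) (.reg 11))) <|
              forLoop 16 (.reg 7) <|
                .cond (.load 7 (.op .add (.op .mul (.reg 13) (.reg 7)) (.reg 16)))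
                  (emit 0 (answeredE (.reg 12) (.reg 13) (.reg 14) (.reg 15) (.reg 10) (.reg 11))
                    (movedE (.reg 12) (.reg 14) (.load 9 (.op .add (.op .mul (.op .add
                      (.op .mul (.reg 13) (.reg 6)) (.reg 15)) (.reg 7)) (.reg 16)))
                      (.reg 10) (.reg 11))) .skip) .skip) .skip

/-- Registers: `10` flag, `11` counter, `12` state of `K`, `13` and `14` actions of Agents 1 and 2
in `K`, `15` new state of `K`, `16` new state of `K'`, `17` new flag, `19` new counter. -/
def emitEntries : Prog :=
  forLoop 13 (.reg 2) <| forLoop 14 (.reg 3) <|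
    .cond (.load 2 (.op .add (.op .mul (.reg 12) (.reg 3)) (.reg 14)))
      (.seq (.assign 15 (.load 4 (.op .add (.op .mul (.op .add (.op .mul (.reg 12) (.reg 2))
          (.reg 13)) (.reg 3)) (.reg 14)))) <|
        forLoop 16 (.reg 5) <| update 16 10 11 15 16 3 5 8 10 <|
          emit 1 (movedE (.reg 12) (.reg 13) (.reg 16) (.reg 10) (.reg 11))
            (pairE (.reg 15) (.reg 16) (.reg 17) (.reg 19))) .skip

def emitATS : Prog :=
  .seq (forLoop 10 (.const 2) <| forLoop 11 (.reg 9) <| forLoop 12 (.reg 1) <|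
    .seq emitChoices emitEntries) (emitDead 1 5)

section

variable {s n k₁ k₂ n' k₁' k₂' : ℕ} {K : FairATS (Fin s) (Fin n) (Fin k₁) (Fin k₂)}
  {K' : FairATS (Fin s) (Fin n') (Fin k₁') (Fin k₂')} {M B Y N : ℕ} {s₀ : Store}

/-- The store holds the two systems, and register `9` holds the number of levels. -/
structure HoldsATS (K : FairATS (Fin s) (Fin n) (Fin k₁) (Fin k₂))
    (K' : FairATS (Fin s) (Fin n') (Fin k₁') (Fin k₂')) (N : ℕ) (s₀ : Store) : Prop where
  reg : s₀.reg 1 = n ∧ s₀.reg 2 = k₁ ∧ s₀.reg 3 = k₂ ∧ s₀.reg 5 = n' ∧ s₀.reg 6 = k₁' ∧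
    s₀.reg 7 = k₂' ∧ s₀.reg 9 = N + 1
  P₁ : ∀ (w : Fin n) (a : Fin k₁), s₀.arr 1 (w * k₁ + a) = bit (a ∈ K.P₁ w)
  P₂ : ∀ (w : Fin n) (b : Fin k₂), s₀.arr 2 (w * k₂ + b) = bit (b ∈ K.P₂ w)
  L : ∀ w : Fin n, s₀.arr 3 w = K.L w
  δ : ∀ (w : Fin n) (a : Fin k₁) (b : Fin k₂), s₀.arr 4 ((w * k₁ + a) * k₂ + b) = K.δ w a b
  F : ∀ w : Fin n, s₀.arr 5 w = bit (w ∈ K.F)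
  P₁' : ∀ (w : Fin n') (a : Fin k₁'), s₀.arr 6 (w * k₁' + a) = bit (a ∈ K'.P₁ w)
  P₂' : ∀ (w : Fin n') (b : Fin k₂'), s₀.arr 7 (w * k₂' + b) = bit (b ∈ K'.P₂ w)
  L' : ∀ w : Fin n', s₀.arr 8 w = K'.L w
  δ' : ∀ (w : Fin n') (a : Fin k₁') (b : Fin k₂'),
    s₀.arr 9 ((w * k₁' + a) * k₂' + b) = K'.δ w a b
  F' : ∀ w : Fin n', s₀.arr 10 w = bit (w ∈ K'.F)

/-- All sizes are positive and at most `Y`, and words are long enough. -/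
structure FitsATS (n k₁ k₂ n' k₁' k₂' N M B Y : ℕ) : Prop where
  roomy : Roomy M B 2000
  four_le : 4 ≤ Y
  pow_le : Y ^ 190 ≤ B
  le : n ≤ Y ∧ k₁ ≤ Y ∧ k₂ ≤ Y ∧ n' ≤ Y ∧ k₁' ≤ Y ∧ k₂' ≤ Y ∧ N + 1 ≤ Y
  pos : 1 ≤ n ∧ 1 ≤ k₁ ∧ 1 ≤ k₂ ∧ 1 ≤ n' ∧ 1 ≤ k₁' ∧ 1 ≤ k₂'

theorem FitsATS.le_bound (h : FitsATS n k₁ k₂ n' k₁' k₂' N M B Y) : Y ≤ B :=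
  (Nat.le_self_pow (by norm_num) Y).trans h.pow_le

/-- Edges are emitted at the depth at which their data are known, so only the last kind pays for the
range of `b'`. The constants fall inwards to leave room for `14` per loop and `22` per test. -/
theorem emitsSet_emitChoices (h : HoldsATS K K' N s₀)
    (hf : FitsATS n k₁ k₂ n' k₁' k₂' N M B Y) (f : Bool) (c : Fin (N + 1)) (w : Fin n) :
    EmitsSet M B emitChoices 12 (((s₀.setReg 10 f.toNat).setReg 11 c).setReg 12 w)
      (fun e => ∃ (w' : Fin n') (a : Fin k₁), a ∈ K.P₁ w ∧
        (e = (0, pairId w w' f.toNat c, choseId w w' a f.toNat c) ∨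
        ∃ a' : Fin k₁', a' ∈ K'.P₁ w' ∧
          (e = (1, choseId w w' a f.toNat c, answeredId w w' a a' f.toNat c) ∨
          ∃ b' : Fin k₂', b' ∈ K'.P₂ w' ∧
            e = (0, answeredId w w' a a' f.toNat c, movedId w a (K'.δ w' a' b') f.toNat c))))
      (6000 * (n' * (k₁ * (k₁' * (k₂' * 1))))) := by
  obtain ⟨r₁, r₂, r₃, r₅, r₆, r₇, r₉⟩ := h.reg
  have hM := hf.roomy
  have hYB := hf.le_bound
  obtain ⟨l₁, l₂, l₃, l₄, l₅, l₆, l₇⟩ := hf.le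
  obtain ⟨p₁, p₂, p₃, p₄, p₅, p₆⟩ := hf.pos
  have hpow : ∀ {x i : ℕ}, x ≤ Y ^ i → i ≤ 190 → x ≤ B := fun hx hi =>
    hx.trans ((Nat.pow_le_pow_right (by have := hf.four_le; omega) hi).trans hf.pow_le)
  have hfY : f.toNat ≤ Y := by have := hf.four_le; have := f.toNat_le; omega
  have hY := hf.four_le
  have t₁ : 1 ≤ k₂' * 1 := by omega
  have t₂ : 1 ≤ k₁' * (k₂' * 1) := Nat.mul_pos p₅ t₁
  have t₃ : 1 ≤ k₁ * (k₁' * (k₂' * 1)) := Nat.mul_pos p₂ t₂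
  refine (EmitsSet.forLoop_fin (c := 5950) hM (by norm_num) rfl ?_ (by omega) p₄ t₃ le_rfl
    fun w' => ?_).mono (Nat.mul_le_mul_right _ (by norm_num))
  · simp [Expr.eval, Store.reg_setReg, r₅]
  refine (EmitsSet.forLoop_fin (c := 5900) hM (by norm_num) rfl ?_ (by omega) p₂ t₂ le_rfl
    fun a => ?_).mono (Nat.mul_le_mul_right _ (by norm_num))
  · simp [Expr.eval, Store.reg_setReg, r₂]
  refine (EmitsSet.cond_le (c := 1000 + 4800) hM rfl ?_ (by decide) t₂ fun ha => ?_).mono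
    (Nat.mul_le_mul_right _ (by norm_num))
  · simp [Expr.eval, BinOp.eval, Store.reg_setReg, Store.arr_setReg, r₂, h.P₁]
  refine EmitsSet.seq_le ((EmitsSet.emit hM (by norm_num) rfl rfl (by decide) (by decide) ?_ ?_
    ?_).const_mul (by decide) t₂) ?_
  · simp [eval_pairE, Expr.eval, Store.reg_setReg]
  · simp [eval_choseE, Expr.eval, Store.reg_setReg]
  · exact hpow (pairId_le (by omega) (by omega) (by omega) hfY (by omega)) (by norm_num)
  refine (EmitsSet.forLoop_fin (c := 4750) hM (by norm_num) rfl ?_ (by omega) p₅ t₁ le_rfl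
    fun a' => ?_).mono (Nat.mul_le_mul_right _ (by norm_num))
  · simp [Expr.eval, Store.reg_setReg, r₆]
  refine (EmitsSet.cond_le (c := 2000 + 2700) hM rfl ?_ (by decide) t₁ fun ha' => ?_).mono
    (Nat.mul_le_mul_right _ (by norm_num))
  · simp [Expr.eval, BinOp.eval, Store.reg_setReg, Store.arr_setReg, r₆, h.P₁']
  refine EmitsSet.seq_le ((EmitsSet.emit hM (by norm_num) rfl rfl (by decide) (by decide) ?_ ?_
    ?_).const_mul (by decide) t₁) ?_
  · simp [eval_choseE, Expr.eval, Store.reg_setReg]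
  · simp [eval_answeredE, Expr.eval, Store.reg_setReg]
  · exact hpow (choseId_le (by omega) (by omega) (by omega) (by omega) hfY (by omega))
      (by norm_num)
  refine (EmitsSet.forLoop_fin (c := 2650) hM (by norm_num) rfl ?_ (by omega) p₆ le_rfl le_rfl
    fun b' => ?_).mono (Nat.mul_le_mul_right _ (by norm_num))
  · simp [Expr.eval, Store.reg_setReg, r₇]
  refine (EmitsSet.cond_le (c := 2600) hM rfl ?_ (by decide) le_rfl fun hb' => ?_).mono
    (Nat.mul_le_mul_right _ (by norm_num))
  · simp [Expr.eval, BinOp.eval, Store.reg_setReg, Store.arr_setReg, r₇, h.P₂']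
  refine (EmitsSet.emit hM (by norm_num) rfl rfl (by decide) (by decide) ?_ ?_
    ?_).const_mul (by decide) le_rfl
  · simp [eval_answeredE, Expr.eval, Store.reg_setReg]
  · simp [eval_movedE, Expr.eval, BinOp.eval, Store.reg_setReg, Store.arr_setReg, r₆, r₇, h.δ']
  · exact hpow (answeredId_le (by omega) (by omega) (by omega) (by omega) (by omega) hfY
      (by omega)) le_rfl

/-- The loop over `v'` runs over all states of `K'` independently of how they were reached, which
keeps `a'` and `b'` out of this part. -/
theorem emitsSet_emitEntries (h : HoldsATS K K' N s₀)
    (hf : FitsATS n k₁ k₂ n' k₁' k₂' N M B Y) (f : Bool) (c : Fin (N + 1)) (w : Fin n) :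
    EmitsSet M B emitEntries 12 (((s₀.setReg 10 f.toNat).setReg 11 c).setReg 12 w)
      (fun e => ∃ (a : Fin k₁) (b : Fin k₂), b ∈ K.P₂ w ∧ ∃ v' : Fin n',
        e = (1, movedId w a v' f.toNat c,
          pairId (K.δ w a b) v' (mismatch K K' f (K.δ w a b) v').toNat
            (bump (goodPos (Fin n) K'.F) (badPos (Fin n') K.F) c
              (K.δ w a b, v', mismatch K K' f (K.δ w a b) v'))))
      (6000 * (k₁ * (k₂ * (n' * 1)))) := by
  obtain ⟨r₁, r₂, r₃, r₅, r₆, r₇, r₉⟩ := h.reg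
  have hM := hf.roomy
  have hYB := hf.le_bound
  obtain ⟨l₁, l₂, l₃, l₄, l₅, l₆, l₇⟩ := hf.le
  obtain ⟨p₁, p₂, p₃, p₄, p₅, p₆⟩ := hf.pos
  have hY := hf.four_le
  have hpow : ∀ {x i : ℕ}, x ≤ Y ^ i → i ≤ 190 → x ≤ B := fun hx hi =>
    hx.trans ((Nat.pow_le_pow_right (by omega) hi).trans hf.pow_le)
  have hfY : f.toNat ≤ Y := by have := f.toNat_le; omega
  have t₁ : 1 ≤ n' * 1 := by omega
  have t₂ : 1 ≤ k₂ * (n' * 1) := Nat.mul_pos p₃ t₁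
  refine (EmitsSet.forLoop_fin (c := 5950) hM (by norm_num) rfl ?_ (by omega) p₂ t₂ le_rfl
    fun a => ?_).mono (Nat.mul_le_mul_right _ (by norm_num))
  · simp [Expr.eval, Store.reg_setReg, r₂]
  refine (EmitsSet.forLoop_fin (c := 5900) hM (by norm_num) rfl ?_ (by omega) p₃ t₁ le_rfl
    fun b => ?_).mono (Nat.mul_le_mul_right _ (by norm_num))
  · simp [Expr.eval, Store.reg_setReg, r₃]
  refine (EmitsSet.cond_le (c := 5800) hM rfl ?_ (by decide) t₁ fun hb => ?_).mono
    (Nat.mul_le_mul_right _ (by norm_num))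
  · simp [Expr.eval, BinOp.eval, Store.reg_setReg, Store.arr_setReg, r₃, h.P₂]
  refine (EmitsSet.assign (x := K.δ w a b) (T := 5000 * (n' * 1)) hM rfl ?_ (by omega) ?_).mono ?_
  · simp [Expr.eval, BinOp.eval, Store.reg_setReg, Store.arr_setReg, r₂, r₃, h.δ]
  swap
  · simp only [Expr.cost]
    omega
  refine (EmitsSet.forLoop_fin (c := 4000) hM (by norm_num) rfl ?_ (by omega) p₄ le_rfl le_rfl
    fun v' => ?_).mono (Nat.mul_le_mul_right _ (by norm_num))
  · simp [Expr.eval, Store.reg_setReg, r₅]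
  refine (EmitsSet.update (T := 3000) (f := f.toNat) (l := K.L (K.δ w a b)) (l' := K'.L v')
    (x := bit (K.δ w a b ∈ K.F)) (x' := bit (v' ∈ K'.F)) (c := c) hM (by norm_num) (by omega)
    (by omega) ?_ ?_ ?_ ?_ ?_ ?_ (bit_le_one _) ?_ (by omega) ?_).mono (by norm_num)
  · simp [Store.reg_setReg]
  · simp [Store.reg_setReg]
  · simp [Store.reg_setReg, Store.arr_setReg, h.L]
  · simp [Store.reg_setReg, Store.arr_setReg, h.F]
  · simp [Store.reg_setReg, Store.arr_setReg, h.L']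
  · simp [Store.reg_setReg, Store.arr_setReg, h.F']
  · have := bit_le_one (K.δ w a b ∈ K.F)
    omega
  rw [flagNum_eq, countNum_eq]
  refine (EmitsSet.emit hM le_rfl rfl rfl (by decide) (by decide) ?_ ?_ ?_).mono (by decide)
  · simp [eval_movedE, Expr.eval, Store.reg_setReg]
  · simp [eval_pairE, Expr.eval, Store.reg_setReg]
  · exact hpow (movedId_le hY (by omega) (by omega) (by omega) hfY (by omega)) (by norm_num)

theorem emitsSet_emitATS (h : HoldsATS K K' N s₀) (hf : FitsATS n k₁ k₂ n' k₁' k₂' N M B Y) :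
    EmitsSet M B emitATS 9 s₀ (ATSEdge K K' N)
      (20000 * ((N + 1) * (n * (n' * k₁ * (k₁' * k₂' + k₂))))) := by
  obtain ⟨r₁, r₂, r₃, r₅, r₆, r₇, r₉⟩ := h.reg
  have hM := hf.roomy
  have hYB := hf.le_bound
  obtain ⟨l₁, l₂, l₃, l₄, l₅, l₆, l₇⟩ := hf.le
  obtain ⟨p₁, p₂, p₃, p₄, p₅, p₆⟩ := hf.pos
  have hY := hf.four_le
  set τ := n' * k₁ * (k₁' * k₂' + k₂) with hτ
  -- The two emitters run one after the other for each flag, counter and state of `K`, so their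
  -- costs add.
  have e₁ : n' * (k₁ * (k₁' * (k₂' * 1))) + k₁ * (k₂ * (n' * 1)) = τ := by rw [hτ]; ring
  have h₁ : n' ≤ τ := by
    rw [hτ, mul_assoc]
    refine Nat.le_mul_of_pos_right _ (Nat.mul_pos p₂ (by omega))
  have h₂ : n * n' ≤ (N + 1) * (n * τ) :=
    (Nat.mul_le_mul_left n h₁).trans (Nat.le_mul_of_pos_left _ (by omega))
  have h₃ : 1 ≤ n * τ := Nat.mul_pos p₁ (by omega)
  have hmain : EmitsSet M B (forLoop 10 (.const 2) <| forLoop 11 (.reg 9) <|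
      forLoop 12 (.reg 1) <| .seq emitChoices emitEntries) 9 s₀ (fun e => ∃ (f : Bool)
      (c : Fin (N + 1)) (w : Fin n), (∃ (w' : Fin n') (a : Fin k₁), a ∈ K.P₁ w ∧
        (e = (0, pairId w w' f.toNat c, choseId w w' a f.toNat c) ∨
        ∃ a' : Fin k₁', a' ∈ K'.P₁ w' ∧
          (e = (1, choseId w w' a f.toNat c, answeredId w w' a a' f.toNat c) ∨
          ∃ b' : Fin k₂', b' ∈ K'.P₂ w' ∧
            e = (0, answeredId w w' a a' f.toNat c, movedId w a (K'.δ w' a' b') f.toNat c)))) ∨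
      ∃ (a : Fin k₁) (b : Fin k₂), b ∈ K.P₂ w ∧ ∃ v' : Fin n',
        e = (1, movedId w a v' f.toNat c,
          pairId (K.δ w a b) v' (mismatch K K' f (K.δ w a b) v').toNat
            (bump (goodPos (Fin n) K'.F) (badPos (Fin n') K.F) c
              (K.δ w a b, v', mismatch K K' f (K.δ w a b) v'))))
      ((6000 + 14 + 14 + 14) * (2 * ((N + 1) * (n * τ)))) := by
    refine EmitsSet.forLoop_bool hM (by norm_num) (by omega) (Nat.mul_pos (by omega) h₃)
      fun f => ?_
    refine EmitsSet.forLoop_fin hM (by norm_num) rfl ?_ (by omega) (by omega) h₃ le_rfl fun c => ?_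
    · simp [Expr.eval, Store.reg_setReg, r₉]
    refine EmitsSet.forLoop_fin hM (by norm_num) rfl ?_ (by omega) p₁ (by omega) le_rfl fun w => ?_
    · simp [Expr.eval, Store.reg_setReg, r₁]
    refine ((emitsSet_emitChoices h hf f c w).seq (emitsSet_emitEntries h hf f c w)).mono ?_
    rw [← mul_add, e₁]
  refine ((hmain.seq (emitsSet_emitDead hM (by norm_num) (by norm_num) r₁ r₅ r₉ (by omega) l₁ l₄
    l₇ hf.pow_le p₁ p₄)).mono ?_).congr fun e => ?_
  · rw [mul_one]
    omega
  · constructor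
    · rintro (⟨f, c, w, ⟨w', a, ha, rfl | ⟨a', ha', rfl | ⟨b', hb', rfl⟩⟩⟩ | ⟨a, b, hb, v', rfl⟩⟩ |
        ⟨f, w, w', rfl⟩)
      · exact .chose w w' a f c c.2 ha
      · exact .answered w w' a a' f c c.2 ha ha'
      · exact .moved w w' a a' b' f c c.2 ha ha' hb'
      · exact .entered w a b v' f c c.2 hb
      · exact .dead w w' f
    · rintro (⟨w, w', a, f, c, hc, ha⟩ | ⟨w, w', a, a', f, c, hc, ha, ha'⟩ |
        ⟨w, w', a, a', b', f, c, hc, ha, ha', hb'⟩ | ⟨w, a, b, v', f, c, hc, hb⟩ | ⟨w, w', f⟩)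
      · exact Or.inl ⟨f, ⟨c, hc⟩, w, Or.inl ⟨w', a, ha, Or.inl rfl⟩⟩
      · exact Or.inl ⟨f, ⟨c, hc⟩, w, Or.inl ⟨w', a, ha, Or.inr ⟨a', ha', Or.inl rfl⟩⟩⟩
      · exact Or.inl ⟨f, ⟨c, hc⟩, w, Or.inl ⟨w', a, ha, Or.inr ⟨a', ha', Or.inr ⟨b', hb', rfl⟩⟩⟩⟩
      · exact Or.inl ⟨f, ⟨c, hc⟩, w, Or.inr ⟨a, b, hb, v', rfl⟩⟩
      · exact Or.inr ⟨f, w, w', rfl⟩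

end

end FairSim

/-! ### Input stores, word length and running time for alternating transition systems -/

namespace FairSim

theorem getD_induction {α : Type*} {P : α → Prop} {l : List α} {d : α} (hl : ∀ x ∈ l, P x)
    (hd : P d) (i : ℕ) : P (l.getD i d) := by
  rcases Nat.lt_or_ge i l.length with h | h
  · rw [List.getD_eq_getElem _ _ h]
    exact hl _ (List.getElem_mem h)
  · rw [List.getD_eq_default _ _ h]
    exact hd

/-- Stored values are at most `Z ^ k`, and expressions have at most `D` nodes, so words below a
fixed power of `Z` suffice; the factor `c` makes the inequality strict. -/
theorem roomy_pow {c Z k D : ℕ} (hc : c = k * D) (h₁ : 2 ≤ c) (hk : 1 ≤ k) (hZ : 2 ≤ Z) :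
    Roomy (c * Z ^ c) (Z ^ k) D := by
  refine ⟨hZ.trans (Nat.le_self_pow (by omega) Z), ?_⟩
  rw [← pow_mul, ← hc]
  have : 0 < Z ^ c := Nat.pow_pos (by omega)
  nlinarith

theorem levels_le {Z n n' : ℕ} (hZ : 3 ≤ Z) (hn : n ≤ Z) (hn' : n' ≤ Z) :
    2 * n * n' + 1 ≤ Z ^ 3 := by
  have h₁ : n * n' ≤ Z * Z := Nat.mul_le_mul hn hn'
  have h₂ : 3 * (Z * Z) ≤ Z * (Z * Z) := Nat.mul_le_mul_right _ hZ
  have h₃ : 3 * 3 ≤ Z * Z := Nat.mul_le_mul hZ hZ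
  have h₄ : Z ^ 3 = Z * (Z * Z) := by ring
  have h₅ : 2 * n * n' = 2 * (n * n') := by ring
  omega

theorem table₂_le {m n B : ℕ} {f : Fin m → Fin n → ℕ} (h : ∀ i j, f i j ≤ B) (j : ℕ) :
    table₂ f j ≤ B :=
  table_le (fun _ => h _ _) j

theorem table₃_le {m n k B : ℕ} {f : Fin m → Fin n → Fin k → ℕ} (h : ∀ i j l, f i j l ≤ B)
    (j : ℕ) : table₃ f j ≤ B :=
  table₂_le (fun _ _ => h _ _ _) j

section

variable {s n k₁ k₂ n' k₁' k₂' : ℕ} (K : FairATS (Fin s) (Fin n) (Fin k₁) (Fin k₂))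
  (K' : FairATS (Fin s) (Fin n') (Fin k₁') (Fin k₂'))

theorem atsInput_bdd {B : ℕ} (hs : s ≤ B) (hn : n ≤ B) (h₁ : k₁ ≤ B) (h₂ : k₂ ≤ B) (hn' : n' ≤ B)
    (h₁' : k₁' ≤ B) (h₂' : k₂' ≤ B) (hB : 1 ≤ B) : (atsInput K K').Bdd B := by
  have hbit : ∀ P : Prop, bit P ≤ B := fun P => (bit_le_one P).trans hB
  constructor
  · refine getD_induction (P := fun x => x ≤ B) ?_ (Nat.zero_le _)
    simp only [List.mem_cons, List.not_mem_nil, or_false, forall_eq_or_imp, forall_eq]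
    have := K.init.2
    have := K'.init.2
    refine ⟨hs, hn, h₁, h₂, by omega, hn', h₁', h₂', by omega⟩
  · refine getD_induction (P := fun f : ℕ → ℕ => ∀ i, f i ≤ B) ?_ fun _ => Nat.zero_le _
    simp only [List.mem_cons, List.not_mem_nil, or_false, forall_eq_or_imp, forall_eq]
    refine ⟨fun _ => Nat.zero_le _, table₂_le fun _ _ => hbit _,
      table₂_le fun _ _ => hbit _, table_le fun w => ?_, table₃_le fun _ _ _ => ?_,
      table_le fun _ => hbit _, table₂_le fun _ _ => hbit _, table₂_le fun _ _ => hbit _,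
      table_le fun w => ?_, table₃_le fun _ _ _ => ?_, table_le fun _ => hbit _⟩
    · exact (K.L w).2.le.trans hs
    · exact (K.δ _ _ _).2.le.trans hn
    · exact (K'.L w).2.le.trans hs
    · exact (K'.δ _ _ _).2.le.trans hn'

theorem holdsATS_atsInput (N : ℕ) : HoldsATS K K' N ((atsInput K K').setReg 9 (N + 1)) where
  reg := ⟨rfl, rfl, rfl, rfl, rfl, rfl, rfl⟩
  P₁ := table₂_apply fun w a => bit (a ∈ K.P₁ w)
  P₂ := table₂_apply fun w b => bit (b ∈ K.P₂ w)
  L := table_apply fun w => (K.L w : ℕ)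
  δ := table₃_apply fun w a b => (K.δ w a b : ℕ)
  F := table_apply fun w => bit (w ∈ K.F)
  P₁' := table₂_apply fun w a => bit (a ∈ K'.P₁ w)
  P₂' := table₂_apply fun w b => bit (b ∈ K'.P₂ w)
  L' := table_apply fun w => (K'.L w : ℕ)
  δ' := table₃_apply fun w a b => (K'.δ w a b : ℕ)
  F' := table_apply fun w => bit (w ∈ K'.F)

/-- `Y = Z ^ 3` bounds all sizes and the number of levels, and `Y ^ 190 = Z ^ 570` bounds node
names; expressions have at most `2000` nodes. This gives the value of `c`. -/
theorem computes_strongFairAlt {c : ℕ} (hc : c = 570 * 2000) :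
    (decideBy 1 5 3 8 emitATS).Computes (c * (s + n + k₁ + k₂ + n' + k₁' + k₂') ^ c)
      (atsInput K K') (strongFairAlt K K')
      (7000000 * (n ^ 2 * n' ^ 2 * k₁ ^ 2 * k₁' * (k₁' * k₂' + k₂))) := by
  have p₁ : 1 ≤ n := K.init.pos
  have p₂ : 1 ≤ k₁ := (K.P₁_nonempty K.init).choose.pos
  have p₃ : 1 ≤ k₂ := (K.P₂_nonempty K.init).choose.pos
  have p₄ : 1 ≤ n' := K'.init.pos
  have p₅ : 1 ≤ k₁' := (K'.P₁_nonempty K'.init).choose.pos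
  have p₆ : 1 ≤ k₂' := (K'.P₂_nonempty K'.init).choose.pos
  have p₇ : 1 ≤ s := (K.L K.init).pos
  obtain ⟨Z, hZ⟩ : ∃ Z, Z = s + n + k₁ + k₂ + n' + k₁' + k₂' := ⟨_, rfl⟩
  rw [← hZ]
  have hM : Roomy (c * Z ^ c) (Z ^ 570) 2000 := roomy_pow hc (by omega) (by norm_num) (by omega)
  obtain ⟨Y, hY⟩ : ∃ Y, Y = Z ^ 3 := ⟨_, rfl⟩
  have hYB : Y ^ 190 = Z ^ 570 := by rw [hY, ← pow_mul]
  rw [← hYB] at hM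
  have hZY : Z ≤ Y := hY ▸ Nat.le_self_pow (by norm_num) Z
  have hNY : 2 * n * n' + 1 ≤ Y := hY ▸ levels_le (by omega) (by omega) (by omega)
  -- The seven sizes are all positive, so `7 ≤ Z`. This makes `Y ^ 2` large enough to absorb the
  -- constant of the time bound.
  have hYlarge : 343 ≤ Y := by
    rw [hY]
    exact (by norm_num : 343 = 7 ^ 3) ▸ Nat.pow_le_pow_left (by omega : 7 ≤ Z) 3
  have hf : FitsATS n k₁ k₂ n' k₁' k₂' (2 * n * n') (c * Z ^ c) (Y ^ 190) Y :=
    ⟨hM, by omega, le_rfl, by omega, by omega⟩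
  have hle := hf.le_bound
  have hT : 20000 * ((2 * n * n' + 1) * (n * (n' * k₁ * (k₁' * k₂' + k₂)))) + 2 ≤ Y ^ 190 := by
    have h₁ : k₁' * k₂' + k₂ ≤ Y * Y + Y * Y :=
      Nat.add_le_add (Nat.mul_le_mul (by omega) (by omega))
        ((by omega : k₂ ≤ Y).trans (Nat.le_mul_self Y))
    have h₂ : (2 * n * n' + 1) * (n * (n' * k₁ * (k₁' * k₂' + k₂))) ≤
        Y * (Y * (Y * Y * (Y * Y + Y * Y))) :=
      Nat.mul_le_mul hNY (Nat.mul_le_mul (by omega)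
        (Nat.mul_le_mul (Nat.mul_le_mul (by omega) (by omega)) h₁))
    have h₃ : Y * (Y * (Y * Y * (Y * Y + Y * Y))) = 2 * Y ^ 6 := by ring
    have h₄ : 343 ^ 2 * Y ^ 6 ≤ Y ^ 8 := by
      have := Nat.mul_le_mul_right (Y ^ 6) (Nat.pow_le_pow_left hYlarge 2)
      calc _ ≤ Y ^ 2 * Y ^ 6 := this
        _ = Y ^ 8 := by ring
    have h₅ : Y ^ 8 ≤ Y ^ 190 := Nat.pow_le_pow_right (by omega) (by norm_num)
    have h₆ : 1 ≤ Y ^ 6 := Nat.one_le_pow _ _ (by omega)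
    omega
  have hcard : Nat.card (Fin n × Fin n' × Bool) ≤ 2 * n * n' := by
    simp only [Nat.card_eq_fintype_card, Fintype.card_prod, Fintype.card_fin, Fintype.card_bool]
    apply le_of_eq
    ring
  obtain ⟨t, s', hexec, ht, hres⟩ := run_decideBy hM (by norm_num) (rn := 1) (rn' := 5) (aL := 3)
    (aL' := 8) (n := n) (n' := n') (by norm_num) (by norm_num) (by norm_num) (by norm_num)
    (by norm_num) (by norm_num)
    (atsInput_bdd K K' (by omega) (by omega) (by omega) (by omega) (by omega) (by omega) (by omega)
      (by omega)) (fun a ha => List.getD_eq_default _ _ ha) rfl rfl (by omega)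
    (emitsSet_emitATS (holdsATS_atsInput K K' (2 * n * n')) hf) hT
    (fun u v v' h => h.not_duplicator) (fun k v h => h.ne_zero) (fun w hw w' hw' => by
      obtain ⟨a, ha⟩ := K.P₁_nonempty ⟨w, hw⟩
      exact ⟨_, _, ATSEdge.chose ⟨w, hw⟩ ⟨w', hw'⟩ a false 0 (by omega) ha⟩)
  refine ⟨t, s', hexec, ht.trans ?_, fun w w' => ?_⟩
  · have h₁ : 1 ≤ k₁' * k₂' + k₂ := by omega
    obtain ⟨q, hq⟩ : ∃ q, q = k₁' * k₂' + k₂ := ⟨_, rfl⟩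
    rw [← hq] at h₁ ⊢
    have h₂ : (2 * n * n' + 1) ≤ 3 * (n * n') := by
      have : 1 ≤ n * n' := Nat.mul_pos p₁ p₄
      have : 2 * n * n' = 2 * (n * n') := by ring
      omega
    have h₃ : (2 * n * n' + 1) * (n * (n' * k₁ * q)) ≤ 3 * (n ^ 2 * n' ^ 2 * k₁ * q) := by
      calc _ ≤ 3 * (n * n') * (n * (n' * k₁ * q)) := Nat.mul_le_mul_right _ h₂
        _ = _ := by ring
    -- The program stays below the claimed bound by a factor of `k₁ * k₁'`.
    have h₄ : n ^ 2 * n' ^ 2 * k₁ * q ≤ n ^ 2 * n' ^ 2 * k₁ ^ 2 * k₁' * q := by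
      have : n ^ 2 * n' ^ 2 * k₁ ^ 2 * k₁' * q = n ^ 2 * n' ^ 2 * k₁ * q * (k₁ * k₁') := by ring
      rw [this]
      exact Nat.le_mul_of_pos_right _ (Nat.mul_pos p₂ p₅)
    have h₅ : n * n' ≤ n ^ 2 * n' ^ 2 * k₁ * q := by
      have : n ^ 2 * n' ^ 2 * k₁ * q = n * n' * (n * n' * (k₁ * q)) := by ring
      rw [this]
      exact Nat.le_mul_of_pos_right _ (Nat.mul_pos (Nat.mul_pos p₁ p₄) (Nat.mul_pos p₂ h₁))
    have h₆ : n ≤ n * n' := Nat.le_mul_of_pos_right _ p₄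
    have h₇ : n * (n' * 200 + 20) = 200 * (n * n') + 20 * n := by ring
    omega
  · obtain ⟨h₀₁, hiff⟩ := hres w w.2 w' w'.2
    have hL : (atsInput K K').arr 3 w = K.L w :=
      table_apply (fun w => (K.L w : ℕ)) w
    have hL' : (atsInput K K').arr 8 w' = K'.L w' :=
      table_apply (fun w => (K'.L w : ℕ)) w'
    rw [hL, hL', lost_iff_losing, Fin.val_inj] at hiff
    rw [strongFairAlt_eq_safePair hcard]
    unfold bit
    split_ifs with h
    · exact hiff.2 h
    · exact h₀₁.resolve_right fun h' => h (hiff.1 h')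

end

end FairSim

namespace FairSim

/-! ### The game graph of two transition systems -/

/-- `K` has entered `v`, and `K'` has to answer. -/
def enteredId (v w' f c : ℕ) : ℕ := qpair 2 (qpair v (qpair w' (qpair f c)))

def enteredE (v w' f c : Expr) : Expr :=
  qpairE (.const 2) (qpairE v (qpairE w' (qpairE f c)))

theorem eval_enteredE (v w' f c : Expr) (s : Store) : (enteredE v w' f c).eval s =
    enteredId (v.eval s) (w'.eval s) (f.eval s) (c.eval s) := rfl

theorem enteredId_le {Y v w' f c : ℕ} (hY : 3 ≤ Y) (hv : v ≤ Y) (hw' : w' ≤ Y) (hf : f ≤ Y)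
    (hc : c ≤ Y) : enteredId v w' f c ≤ Y ^ 46 :=
  qpair_le hY (by omega) (by norm_num) <| qpair_le hY hv (by norm_num) <|
    qpair_le hY hw' (by norm_num) <| qpair_le (k := 1) hY hf le_rfl (by simpa using hc)

section TSGraph

variable {s n n' : ℕ} (K : FairTS (Fin s) (Fin n)) (K' : FairTS (Fin s) (Fin n'))

/-- The edges of the game graph; the counter is less than `N + 1` except at lost positions. -/
inductive TSEdge (N : ℕ) : Edge → Prop
  | entered (w v : Fin n) (w' : Fin n') (f : Bool) (c : ℕ) (hc : c < N + 1) (hv : K.R w v) :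
      TSEdge N (0, pairId w w' f.toNat c, enteredId v w' f.toNat c)
  | answered (v : Fin n) (w' v' : Fin n') (f : Bool) (c : ℕ) (hc : c < N + 1)
      (hv' : K'.R w' v') :
      TSEdge N (1, enteredId v w' f.toNat c,
        pairId v v' (mismatch K.toFairATS K'.toFairATS f v v').toNat
          (bump (goodPos (Fin n) K'.F) (badPos (Fin n') K.F) c
            (v, v', mismatch K.toFairATS K'.toFairATS f v v')))
  | dead (w : Fin n) (w' : Fin n') (f : Bool) : TSEdge N (0, pairId w w' f.toNat (N + 1), 0)

variable {K K'} {N : ℕ}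

theorem TSEdge.inv_duplicator {u v : ℕ} (h : TSEdge K K' N (1, u, v)) :
    ∃ (w : Fin n) (w' v' : Fin n') (f : Bool) (c : ℕ), K'.R w' v' ∧
      u = enteredId w w' f.toNat c ∧
      v = pairId w v' (mismatch K.toFairATS K'.toFairATS f w v').toNat
          (bump (goodPos (Fin n) K'.F) (badPos (Fin n') K.F) c
            (w, v', mismatch K.toFairATS K'.toFairATS f w v')) := by
  cases h with
  | answered v w' v' f c hc hv' => exact ⟨v, w', v', f, c, hv', rfl, rfl⟩

theorem TSEdge.inv_spoiler {u v : ℕ} (h : TSEdge K K' N (0, u, v)) :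
    ∃ w w' f c, u = pairId w w' f c := by
  cases h with
  | entered => exact ⟨_, _, _, _, rfl⟩
  | dead => exact ⟨_, _, _, _, rfl⟩

theorem TSEdge.not_duplicator {u v v' : ℕ} (h : TSEdge K K' N (0, u, v)) :
    ¬ TSEdge K K' N (1, u, v') := by
  intro h'
  obtain ⟨_, _, _, _, _, -, rfl, -⟩ := h'.inv_duplicator
  obtain ⟨_, _, _, _, h⟩ := h.inv_spoiler
  simp [enteredId, pairId, qpair_inj] at h

theorem TSEdge.ne_zero {k v : ℕ} : ¬ TSEdge K K' N (k, 0, v) := by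
  intro h
  generalize hu : (0 : ℕ) = u at h
  cases h <;> revert hu <;> simp [enteredId, pairId, qpair]

/-- Two kinds of nodes suffice, as Agent 2 has a single action. The intermediate node forgets the
old state `w` of `K`, so the duplicator's edges number `n * |R'|` per flag and level. -/
theorem losing_of_lost_ts {u : ℕ} (h : Lost (TSEdge K K' N) u) :
    (∀ (w : Fin n) (w' : Fin n') (f : Bool) (c : ℕ), u = pairId w w' f.toNat c →
      losing K.toFairATS K'.toFairATS N (w, w', f) c) ∧
    (∀ (v : Fin n) (w' : Fin n') (f : Bool) (c : ℕ), u = enteredId v w' f.toNat c →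
      ∀ v', K'.R w' v' → losing K.toFairATS K'.toFairATS N
        (v, v', mismatch K.toFairATS K'.toFairATS f v v')
        (bump (goodPos (Fin n) K'.F) (badPos (Fin n') K.F) c
          (v, v', mismatch K.toFairATS K'.toFairATS f v v'))) := by
  induction h with
  | zero => constructor <;> intros <;> simp_all [enteredId, pairId, qpair]
  | @spoiler u v h _ ih =>
    cases h with
    | entered w v w' f c hc hv =>
      refine ⟨fun v v' g d h => ?_, fun _ _ _ _ h => absurd (qpair_inj.1 h).1 (by decide)⟩
      simp only [pairId_inj, Fin.val_inj, toNat_inj] at h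
      obtain ⟨rfl, rfl, rfl, rfl⟩ := h
      exact Lose.of_pre (forcePre_mono _ _) ⟨_, hv, fun v' hv' =>
        ⟨(), trivial, fun _ _ => ih.2 _ w' f c rfl v' hv'⟩⟩
    | dead w w' f =>
      refine ⟨fun v v' g d h => ?_, fun _ _ _ _ h => absurd (qpair_inj.1 h).1 (by decide)⟩
      simp only [pairId_inj] at h
      exact Lose.of_lt (by omega)
  | @duplicator u v₀ h _ ih =>
    cases h with
    | answered v w' v₀' f c hc hv₀' =>
      refine ⟨fun _ _ _ _ h => absurd (qpair_inj.1 h).1 (by decide), fun u u' g d h v' hv' => ?_⟩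
      simp only [enteredId, qpair_inj, Fin.val_inj, toNat_inj, true_and] at h
      obtain ⟨rfl, rfl, rfl, rfl⟩ := h
      exact (ih _ (TSEdge.answered v w' v' f c hc hv')).1 _ _ _ _ rfl

theorem lost_of_losing_ts {x : Fin n × Fin n' × Bool} {c : ℕ}
    (h : losing K.toFairATS K'.toFairATS N x c) (hc : c ≤ N + 1) :
    Lost (TSEdge K K' N) (pairId x.1 x.2.1 x.2.2.toNat c) := by
  have hdead : ∀ (x : Fin n × Fin n' × Bool) c, c ≤ N + 1 → N < c →
      Lost (TSEdge K K' N) (pairId x.1 x.2.1 x.2.2.toNat c) := by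
    intro x c hc hN
    obtain rfl : c = N + 1 := by omega
    exact Lost.spoiler (TSEdge.dead x.1 x.2.1 x.2.2) Lost.zero
  refine h (fun x c => c ≤ N + 1 →
    Lost (TSEdge K K' N) (pairId x.1 x.2.1 x.2.2.toNat c)) ?_ ?_ hc
  · exact fun x c hN hc => hdead x c hc hN
  · rintro ⟨w, w', f⟩ c ⟨v, hv, hx⟩ hc
    rcases Nat.lt_or_ge N c with hN | hN
    · exact hdead _ c hc hN
    · have hc' : c < N + 1 := by omega
      refine Lost.spoiler (TSEdge.entered w v w' f c hc' hv) ?_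
      obtain ⟨v₀', hv₀'⟩ := K'.total w'
      refine Lost.duplicator (TSEdge.answered v w' v₀' f c hc' hv₀') fun u hu => ?_
      obtain ⟨u, u', v', g, e, hv', h, rfl⟩ := hu.inv_duplicator
      simp only [enteredId, qpair_inj, Fin.val_inj, toNat_inj, true_and] at h
      obtain ⟨rfl, rfl, rfl, rfl⟩ := h
      obtain ⟨b', -, hx⟩ := hx v' hv'
      exact hx () trivial ((bump_le _ _ _ _).trans (by omega))

theorem lost_iff_losing_ts (w : Fin n) (w' : Fin n') :
    Lost (TSEdge K K' N) (pairId w w' 0 0) ↔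
      losing K.toFairATS K'.toFairATS N (w, w', false) 0 :=
  ⟨fun h => (losing_of_lost_ts h).1 w w' false 0 rfl,
    fun h => lost_of_losing_ts h (Nat.zero_le _)⟩

end TSGraph

/-! ### Loops over the transitions of a transition system -/

/-- A bound on the maximal cost of an iteration would only give `n * n` in place of the number of
transitions, so the costs are summed. -/
theorem EmitsSet.forLoop_sum {M B D r n : ℕ} {s₀ : Store} {p : Prog} {e : Expr}
    {E : Fin n → Edge → Prop} {T : Fin n → ℕ} (hM : Roomy M B D) (hD : 3 ≤ D)
    (he : ((Expr.op .lt (.reg (r + 1)) e).ok D && e.inFrame r) = true) (hn : e.eval s₀ = n)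
    (hB : n ≤ B)
    (hp : ∀ i : Fin n, EmitsSet M B p (r + 1) (s₀.setReg (r + 1) i) (E i) (T i)) :
    EmitsSet M B (FairSim.forLoop (r + 1) e p) r s₀ (fun y => ∃ i, E i y)
      (∑ i, (T i + e.cost + 7) + e.cost + 5) := by
  refine ((EmitsSet.forLoop (E := fun i y => ∃ h : i < n, E ⟨i, h⟩ y)
    (T := fun i => if h : i < n then T ⟨i, h⟩ else 0) hM hD he hn hB fun i hi => ?_).mono ?_).congr
    fun e => ?_
  · rw [dif_pos hi]
    exact (hp ⟨i, hi⟩).congr fun e => ⟨fun h => ⟨hi, h⟩, fun ⟨_, h⟩ => h⟩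
  · rw [Finset.sum_range]
    simp
  · constructor
    · rintro ⟨i, hi, _, h⟩
      exact ⟨⟨i, hi⟩, h⟩
    · rintro ⟨i, h⟩
      exact ⟨i, i.2, i.2, h⟩

theorem sum_bit_eq_numTrans {Obs : Type*} {n : ℕ} (K : TS Obs (Fin n)) :
    ∑ w, ∑ v, bit (K.R w v) = K.numTrans := by
  classical
  rw [TS.numTrans, Set.ncard_eq_toFinset_card', Set.toFinset_ofPred, Finset.card_filter,
    Fintype.sum_prod_type]
  simp only [bit]

theorem le_numTrans {Obs : Type*} {n : ℕ} (K : TS Obs (Fin n)) : n ≤ K.numTrans := by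
  rw [← sum_bit_eq_numTrans]
  calc n = ∑ _w : Fin n, 1 := by simp
    _ ≤ _ := Finset.sum_le_sum fun w _ => by
      obtain ⟨v, hv⟩ := K.total w
      refine le_trans ?_ (Finset.single_le_sum (fun _ _ => Nat.zero_le _) (Finset.mem_univ v))
      simp [bit, hv]

theorem numTrans_le {Obs : Type*} {n : ℕ} (K : TS Obs (Fin n)) : K.numTrans ≤ n * n := by
  rw [← sum_bit_eq_numTrans]
  calc _ ≤ ∑ _w : Fin n, ∑ _v : Fin n, 1 :=
        Finset.sum_le_sum fun _ _ => Finset.sum_le_sum fun _ _ => bit_le_one _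
    _ = n * n := by simp

/-- The program that runs `p` for every transition, whose source is in register `10` and whose
target is in register `11`. -/
def forTrans (rn a : ℕ) (p : Prog) : Prog :=
  forLoop 10 (.reg rn) <| forLoop 11 (.reg rn) <|
    .cond (.load a (.op .add (.op .mul (.reg 10) (.reg rn)) (.reg 11))) p .skip

/-- The body runs only where the table holds `1`, which sums to `K.numTrans` runs. The scan of all
`n * n` entries is absorbed because `n ≤ K.numTrans` by totality and `n ≤ τ`. -/
theorem EmitsSet.forTrans {M B n rn a c τ : ℕ} {s₀ : Store} {p : Prog} {Obs : Type*}
    (K : TS Obs (Fin n)) {E : Fin n → Fin n → Edge → Prop} (hM : Roomy M B 2000) (hrn : rn < 9)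
    (ha : a ≤ 10) (hn : s₀.reg rn = n) (hB : n ≤ B) (hn₁ : 1 ≤ n) (hτ : n ≤ τ)
    (hR : ∀ w v : Fin n, s₀.arr a (w * n + v) = bit (K.R w v))
    (hp : ∀ w v : Fin n, K.R w v →
      EmitsSet M B p 11 ((s₀.setReg 10 w).setReg 11 v) (E w v) (c * τ)) :
    EmitsSet M B (FairSim.forTrans rn a p) 9 s₀ (fun y => ∃ w v, K.R w v ∧ E w v y)
      ((c + 40) * (K.numTrans * τ)) := by
  have hcost : (Expr.load a (.op .add (.op .mul (.reg 10) (.reg rn)) (.reg 11))).cost = 6 := rfl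
  refine (EmitsSet.forLoop_sum (n := n) (T := fun w => ∑ v, (8 + bit (K.R w v) * (c * τ) + 8) + 6)
    hM (by norm_num) ?_ ?_ hB fun w => (EmitsSet.forLoop_sum (n := n)
      (T := fun v => 8 + bit (K.R w v) * (c * τ)) hM (by norm_num) ?_ ?_ hB fun v =>
      ((EmitsSet.cond hM (x := bit (K.R w v)) ?_ ?_ fun h => hp w v ?_).mono ?_).congr
        fun e => ?_).mono ?_).mono ?_
  · simp [Expr.ok, Expr.small, Expr.cost, Expr.inFrame]
    omega
  · exact hn
  · simp [Expr.ok, Expr.small, Expr.cost, Expr.inFrame]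
    omega
  · simp only [Expr.eval, Store.reg_setReg]
    rw [if_neg (by omega), hn]
  · simp [Expr.ok, Expr.small, Expr.cost, Expr.inFrame]
    omega
  · simp only [Expr.eval, BinOp.eval, Store.reg_setReg, Store.arr_setReg, if_pos]
    rw [if_neg (by omega), if_neg (by omega), if_neg (by omega), hn, hR]
  · rwa [Ne, bit_eq_zero, not_not] at h
  · rw [hcost]
    have := bit_le_one (K.R w v)
    split_ifs with h
    · omega
    · obtain h : bit (K.R w v) = 1 := by omega
      rw [h]
      omega
  · rw [Ne, bit_eq_zero, not_not]
  · simp only [Expr.cost]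
    apply le_of_eq
    simp only [add_assoc]
  · have h₁ : ∑ w : Fin n, (∑ v, (8 + bit (K.R w v) * (c * τ) + 8) + 6 + (Expr.reg rn).cost + 7) =
        16 * (n * n) + 14 * n + K.numTrans * (c * τ) := by
      rw [← sum_bit_eq_numTrans, Finset.sum_mul]
      simp only [Finset.sum_add_distrib, Finset.sum_mul, Finset.sum_const, Finset.card_univ,
        Fintype.card_fin, smul_eq_mul, Expr.cost]
      ring
    rw [h₁]
    have h₂ : n * n ≤ K.numTrans * τ := Nat.mul_le_mul (le_numTrans K) hτ
    have h₃ : n ≤ n * n := Nat.le_mul_self n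
    have h₄ : (c + 40) * (K.numTrans * τ) = K.numTrans * (c * τ) + 40 * (K.numTrans * τ) := by ring
    simp only [Expr.cost]
    omega

end FairSim

namespace FairSim

/-! ### The program for transition systems -/

/-- Registers: `10` and `11` a transition, `12` flag, `13` counter, `14` state of the other system,
`15` new flag, `17` new counter. -/
def emitTS : Prog :=
  .seq (forTrans 1 1 <| forLoop 12 (.const 2) <| forLoop 13 (.reg 9) <| forLoop 14 (.reg 3) <|
    emit 0 (pairE (.reg 10) (.reg 14) (.reg 12) (.reg 13))
      (enteredE (.reg 11) (.reg 14) (.reg 12) (.reg 13))) <|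
  .seq (forTrans 3 4 <| forLoop 12 (.const 2) <| forLoop 13 (.reg 9) <| forLoop 14 (.reg 1) <|
    update 14 12 13 14 11 2 3 5 6 <|
      emit 1 (enteredE (.reg 14) (.reg 10) (.reg 12) (.reg 13))
        (pairE (.reg 14) (.reg 11) (.reg 15) (.reg 17))) <|
  emitDead 1 3

section

variable {s n n' : ℕ} {K : FairTS (Fin s) (Fin n)} {K' : FairTS (Fin s) (Fin n')}
  {M B Y N : ℕ} {s₀ : Store}

/-- The store holds the two systems, and register `9` holds the number of levels. -/
structure HoldsTS (K : FairTS (Fin s) (Fin n)) (K' : FairTS (Fin s) (Fin n')) (N : ℕ)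
    (s₀ : Store) : Prop where
  reg : s₀.reg 1 = n ∧ s₀.reg 3 = n' ∧ s₀.reg 9 = N + 1
  R : ∀ w v : Fin n, s₀.arr 1 (w * n + v) = bit (K.R w v)
  L : ∀ w : Fin n, s₀.arr 2 w = K.L w
  F : ∀ w : Fin n, s₀.arr 3 w = bit (w ∈ K.F)
  R' : ∀ w v : Fin n', s₀.arr 4 (w * n' + v) = bit (K'.R w v)
  L' : ∀ w : Fin n', s₀.arr 5 w = K'.L w
  F' : ∀ w : Fin n', s₀.arr 6 w = bit (w ∈ K'.F)

/-- All sizes are positive and at most `Y`, and words are long enough. -/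
structure FitsTS (n n' N M B Y : ℕ) : Prop where
  roomy : Roomy M B 2000
  three_le : 3 ≤ Y
  pow_le : Y ^ 190 ≤ B
  le : n ≤ Y ∧ n' ≤ Y ∧ N + 1 ≤ Y
  pos : 1 ≤ n ∧ 1 ≤ n'
  level : n ≤ N + 1 ∧ n' ≤ N + 1

/-- Each transition of one system is combined with all flags, counters and states of the other one.
`FitsTS.level` ensures that this inner work outweighs the scan of a row of the transition table. -/
theorem emitsSet_emitTS (h : HoldsTS K K' N s₀) (hf : FitsTS n n' N M B Y) :
    EmitsSet M B emitTS 9 s₀ (TSEdge K K' N)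
      (10000 * ((N + 1) * (n * K'.numTrans + n' * K.numTrans))) := by
  obtain ⟨r₁, r₃, r₉⟩ := h.reg
  have hM := hf.roomy
  obtain ⟨l₁, l₂, l₃⟩ := hf.le
  obtain ⟨p₁, p₂⟩ := hf.pos
  obtain ⟨m₁, m₂⟩ := hf.level
  have hY := hf.three_le
  have hYB : Y ≤ B := (Nat.le_self_pow (by norm_num) Y).trans hf.pow_le
  have hpow : ∀ {x : ℕ}, x ≤ Y ^ 46 → x ≤ B := fun hx =>
    hx.trans ((Nat.pow_le_pow_right (by omega) (by norm_num)).trans hf.pow_le)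
  have hfY : ∀ f : Bool, f.toNat ≤ Y := fun f => by have := f.toNat_le; omega
  have t₁ : 1 ≤ n' * 1 := by omega
  have t₂ : 1 ≤ n * 1 := by omega
  have t₃ : N + 1 ≤ (N + 1) * (n' * 1) := Nat.le_mul_of_pos_right _ t₁
  have t₄ : N + 1 ≤ (N + 1) * (n * 1) := Nat.le_mul_of_pos_right _ t₂
  have hspoiler : EmitsSet M B (forTrans 1 1 <| forLoop 12 (.const 2) <| forLoop 13 (.reg 9) <|
      forLoop 14 (.reg 3) <| emit 0 (pairE (.reg 10) (.reg 14) (.reg 12) (.reg 13))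
      (enteredE (.reg 11) (.reg 14) (.reg 12) (.reg 13))) 9 s₀
      (fun e => ∃ w v, K.R w v ∧ ∃ (f : Bool) (c : Fin (N + 1)) (w' : Fin n'),
        e = (0, pairId w w' f.toNat c, enteredId v w' f.toNat c))
      ((650 + 14 + 14 + 14 + 40) * (K.numTrans * (2 * ((N + 1) * (n' * 1))))) := by
    refine EmitsSet.forTrans K.toTS hM (by norm_num) (by norm_num) r₁ (by omega) p₁ (by omega) h.R
      fun w v _ => EmitsSet.forLoop_bool hM (by norm_num) (by omega) (by omega) fun f =>
      EmitsSet.forLoop_fin hM (by norm_num) rfl ?_ (by omega) (by omega) t₁ le_rfl fun c =>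
      EmitsSet.forLoop_fin hM (by norm_num) rfl ?_ (by omega) p₂ le_rfl le_rfl fun w' =>
      (EmitsSet.emit hM (by norm_num) rfl rfl (by decide) (by decide) ?_ ?_ ?_).const_mul
        (by decide) le_rfl
    · simp [Expr.eval, Store.reg_setReg, r₉]
    · simp [Expr.eval, Store.reg_setReg, r₃]
    · simp [eval_pairE, Expr.eval, Store.reg_setReg]
    · simp [eval_enteredE, Expr.eval, Store.reg_setReg]
    · exact hpow (pairId_le hY (by omega) (by omega) (hfY f) (by omega))
  have hduplicator : EmitsSet M B (forTrans 3 4 <| forLoop 12 (.const 2) <|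
      forLoop 13 (.reg 9) <| forLoop 14 (.reg 1) <| update 14 12 13 14 11 2 3 5 6 <|
      emit 1 (enteredE (.reg 14) (.reg 10) (.reg 12) (.reg 13))
        (pairE (.reg 14) (.reg 11) (.reg 15) (.reg 17))) 9 s₀
      (fun e => ∃ w' v', K'.R w' v' ∧ ∃ (f : Bool) (c : Fin (N + 1)) (v : Fin n),
        e = (1, enteredId v w' f.toNat c,
          pairId v v' (mismatch K.toFairATS K'.toFairATS f v v').toNat
            (bump (goodPos (Fin n) K'.F) (badPos (Fin n') K.F) c
              (v, v', mismatch K.toFairATS K'.toFairATS f v v'))))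
      ((690 + 14 + 14 + 14 + 40) * (K'.numTrans * (2 * ((N + 1) * (n * 1))))) := by
    refine EmitsSet.forTrans K'.toTS hM (by norm_num) (by norm_num) r₃ (by omega) p₂ (by omega)
      h.R' fun w' v' _ => EmitsSet.forLoop_bool hM (by norm_num) (by omega) (by omega) fun f =>
      EmitsSet.forLoop_fin hM (by norm_num) rfl ?_ (by omega) (by omega) t₂ le_rfl fun c =>
      EmitsSet.forLoop_fin hM (by norm_num) rfl ?_ (by omega) p₁ le_rfl le_rfl fun v =>
      (EmitsSet.update (T := 650) (f := f.toNat) (l := K.L v) (l' := K'.L v')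
        (x := bit (v ∈ K.F)) (x' := bit (v' ∈ K'.F)) (c := c) hM (by norm_num) (by omega)
        (by omega) ?_ ?_ ?_ ?_ ?_ ?_ (bit_le_one _) ?_ (by omega) ?_).mono (by norm_num)
    · simp [Expr.eval, Store.reg_setReg, r₉]
    · simp [Expr.eval, Store.reg_setReg, r₁]
    · simp [Store.reg_setReg]
    · simp [Store.reg_setReg]
    · simp [Store.reg_setReg, Store.arr_setReg, h.L]
    · simp [Store.reg_setReg, Store.arr_setReg, h.F]
    · simp [Store.reg_setReg, Store.arr_setReg, h.L']
    · simp [Store.reg_setReg, Store.arr_setReg, h.F']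
    · have := bit_le_one (v ∈ K.F)
      omega
    have hflag := flagNum_eq (K := K.toFairATS) (K' := K'.toFairATS) f v v'
    have hcount := countNum_eq (K := K.toFairATS) (K' := K'.toFairATS)
      (mismatch K.toFairATS K'.toFairATS f v v') v v' c
    simp only [FairTS.toFairATS] at hflag hcount ⊢
    rw [hflag, hcount]
    refine (EmitsSet.emit hM le_rfl rfl rfl (by decide) (by decide) ?_ ?_ ?_).mono (by decide)
    · simp [eval_enteredE, Expr.eval, Store.reg_setReg]
    · simp [eval_pairE, Expr.eval, Store.reg_setReg]
    · exact hpow (enteredId_le hY (by omega) (by omega) (hfY f) (by omega))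
  refine ((hspoiler.seq (hduplicator.seq (emitsSet_emitDead hM (by norm_num) (by norm_num) r₁ r₃
    r₉ hY l₁ l₂ l₃ hf.pow_le p₁ p₂))).mono ?_).congr fun e => ?_
  · have e₁ : K.numTrans * (2 * ((N + 1) * (n' * 1))) = 2 * ((N + 1) * (n' * K.numTrans)) := by
      ring
    have e₂ : K'.numTrans * (2 * ((N + 1) * (n * 1))) = 2 * ((N + 1) * (n * K'.numTrans)) := by
      ring
    have e₃ : n * n' ≤ (N + 1) * (n * K'.numTrans) :=
      (Nat.mul_le_mul_left n (le_numTrans K'.toTS)).trans (Nat.le_mul_of_pos_left _ (by omega))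
    rw [e₁, e₂, mul_one, mul_add (N + 1)]
    omega
  · constructor
    · rintro (⟨w, v, hv, f, c, w', rfl⟩ | ⟨w', v', hv', f, c, v, rfl⟩ | ⟨f, w, w', rfl⟩)
      · exact .entered w v w' f c c.2 hv
      · exact .answered v w' v' f c c.2 hv'
      · exact .dead w w' f
    · rintro (⟨w, v, w', f, c, hc, hv⟩ | ⟨v, w', v', f, c, hc, hv'⟩ | ⟨w, w', f⟩)
      · exact Or.inl ⟨w, v, hv, f, ⟨c, hc⟩, w', rfl⟩
      · exact Or.inr (Or.inl ⟨w', v', hv', f, ⟨c, hc⟩, v, rfl⟩)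
      · exact Or.inr (Or.inr ⟨f, w, w', rfl⟩)

end

/-! ### Input stores, word length and running time for transition systems -/

section

variable {s n n' : ℕ} (K : FairTS (Fin s) (Fin n)) (K' : FairTS (Fin s) (Fin n'))

theorem tsInput_bdd {B : ℕ} (hs : s ≤ B) (hn : n ≤ B) (hn' : n' ≤ B) (hB : 1 ≤ B) :
    (tsInput K K').Bdd B := by
  have hbit : ∀ P : Prop, bit P ≤ B := fun P => (bit_le_one P).trans hB
  constructor
  · refine getD_induction (P := fun x => x ≤ B) ?_ (Nat.zero_le _)
    simp only [List.mem_cons, List.not_mem_nil, or_false, forall_eq_or_imp, forall_eq]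
    have := K.init.2
    have := K'.init.2
    exact ⟨hs, hn, by omega, hn', by omega⟩
  · refine getD_induction (P := fun f : ℕ → ℕ => ∀ i, f i ≤ B) ?_ fun _ => Nat.zero_le _
    simp only [List.mem_cons, List.not_mem_nil, or_false, forall_eq_or_imp, forall_eq]
    refine ⟨fun _ => Nat.zero_le _, table₂_le fun _ _ => hbit _, table_le fun w => ?_,
      table_le fun _ => hbit _, table₂_le fun _ _ => hbit _, table_le fun w => ?_,
      table_le fun _ => hbit _⟩
    · exact (K.L w).2.le.trans hs
    · exact (K'.L w).2.le.trans hs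

theorem holdsTS_tsInput (N : ℕ) : HoldsTS K K' N ((tsInput K K').setReg 9 (N + 1)) where
  reg := ⟨rfl, rfl, rfl⟩
  R := table₂_apply fun w v => bit (K.R w v)
  L := table_apply fun w => (K.L w : ℕ)
  F := table_apply fun w => bit (w ∈ K.F)
  R' := table₂_apply fun w v => bit (K'.R w v)
  L' := table_apply fun w => (K'.L w : ℕ)
  F' := table_apply fun w => bit (w ∈ K'.F)

theorem Prog.Computes.mono {p : Prog} {M T T' : ℕ} {s₀ : Store} {S : Fin n → Fin n' → Prop}
    (h : p.Computes M s₀ S T) (hT : T ≤ T') : p.Computes M s₀ S T' := by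
  obtain ⟨t, s, h, ht, hs⟩ := h
  exact ⟨t, s, h, ht.trans hT, hs⟩

theorem computes_fairSim {c : ℕ} (hc : c = 570 * 2000) :
    (decideBy 1 3 2 5 emitTS).Computes (c * (s + n + n') ^ c) (tsInput K K') (fairSim K K')
      (4000000 * (n * n' * (n * K'.numTrans + n' * K.numTrans))) := by
  have p₁ : 1 ≤ n := K.init.pos
  have p₂ : 1 ≤ n' := K'.init.pos
  have p₃ : 1 ≤ s := (K.L K.init).pos
  obtain ⟨Z, hZ⟩ : ∃ Z, Z = s + n + n' := ⟨_, rfl⟩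
  rw [← hZ]
  have hM : Roomy (c * Z ^ c) (Z ^ 570) 2000 := roomy_pow hc (by omega) (by norm_num) (by omega)
  obtain ⟨Y, hY⟩ : ∃ Y, Y = Z ^ 3 := ⟨_, rfl⟩
  have hYB : Y ^ 190 = Z ^ 570 := by rw [hY, ← pow_mul]
  rw [← hYB] at hM
  have hZY : Z ≤ Y := hY ▸ Nat.le_self_pow (by norm_num) Z
  have hNY : 2 * n * n' + 1 ≤ Y := hY ▸ levels_le (by omega) (by omega) (by omega)
  have hYlarge : 27 ≤ Y := by
    rw [hY]
    exact (by norm_num : 27 = 3 ^ 3) ▸ Nat.pow_le_pow_left (by omega : 3 ≤ Z) 3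
  have hle : Y ≤ Y ^ 190 := Nat.le_self_pow (by norm_num) Y
  have hlevels : 2 * n * n' = 2 * (n * n') := by ring
  have hn₁ : n ≤ n * n' := Nat.le_mul_of_pos_right _ p₂
  have hn₁' : n' ≤ n * n' := Nat.le_mul_of_pos_left _ p₁
  have hf : FitsTS n n' (2 * n * n') (c * Z ^ c) (Y ^ 190) Y :=
    ⟨hM, by omega, le_rfl, by omega, by omega, by omega⟩
  have hT : 10000 * ((2 * n * n' + 1) * (n * K'.numTrans + n' * K.numTrans)) + 2 ≤ Y ^ 190 := by
    have h₁ : K.numTrans ≤ Y * Y :=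
      (numTrans_le K.toTS).trans (Nat.mul_le_mul (by omega) (by omega))
    have h₁' : K'.numTrans ≤ Y * Y :=
      (numTrans_le K'.toTS).trans (Nat.mul_le_mul (by omega) (by omega))
    have h₂ : (2 * n * n' + 1) * (n * K'.numTrans + n' * K.numTrans) ≤
        Y * (Y * (Y * Y) + Y * (Y * Y)) :=
      Nat.mul_le_mul hNY (Nat.add_le_add (Nat.mul_le_mul (by omega) h₁')
        (Nat.mul_le_mul (by omega) h₁))
    have h₃ : Y * (Y * (Y * Y) + Y * (Y * Y)) = 2 * Y ^ 4 := by ring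
    have h₄ : 27 ^ 4 * Y ^ 4 ≤ Y ^ 8 := by
      have := Nat.mul_le_mul_right (Y ^ 4) (Nat.pow_le_pow_left hYlarge 4)
      calc _ ≤ Y ^ 4 * Y ^ 4 := this
        _ = Y ^ 8 := by ring
    have h₅ : Y ^ 8 ≤ Y ^ 190 := Nat.pow_le_pow_right (by omega) (by norm_num)
    have h₆ : 1 ≤ Y ^ 4 := Nat.one_le_pow _ _ (by omega)
    omega
  have hcard : Nat.card (Fin n × Fin n' × Bool) ≤ 2 * n * n' := by
    simp only [Nat.card_eq_fintype_card, Fintype.card_prod, Fintype.card_fin, Fintype.card_bool]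
    apply le_of_eq
    ring
  obtain ⟨t, s', hexec, ht, hres⟩ := run_decideBy hM (by norm_num) (rn := 1) (rn' := 3) (aL := 2)
    (aL' := 5) (n := n) (n' := n') (by norm_num) (by norm_num) (by norm_num) (by norm_num)
    (by norm_num) (by norm_num)
    (tsInput_bdd K K' (by omega) (by omega) (by omega) (by omega))
    (fun a ha => List.getD_eq_default _ _ (by simp only [List.length_cons, List.length_nil]; omega))
    rfl rfl (by omega)
    (emitsSet_emitTS (holdsTS_tsInput K K' (2 * n * n')) hf) hT
    (fun u v v' h => h.not_duplicator) (fun k v h => h.ne_zero) (fun w hw w' hw' => by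
      obtain ⟨v, hv⟩ := K.total ⟨w, hw⟩
      exact ⟨_, _, TSEdge.entered ⟨w, hw⟩ v ⟨w', hw'⟩ false 0 (by omega) hv⟩)
  refine ⟨t, s', hexec, ht.trans ?_, fun w w' => ?_⟩
  · have h₁ : 1 ≤ n * K'.numTrans :=
      Nat.mul_pos p₁ (p₂.trans (le_numTrans K'.toTS))
    obtain ⟨q, hq⟩ : ∃ q, q = n * K'.numTrans + n' * K.numTrans := ⟨_, rfl⟩
    rw [← hq]
    -- The number of levels supplies the factor `n * n'` of the time bound.
    have h₂ : (2 * n * n' + 1) * q ≤ 3 * (n * n') * q := Nat.mul_le_mul_right _ (by omega)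
    have h₃ : 3 * (n * n') * q = 3 * (n * n' * q) := by ring
    have h₄ : n * n' ≤ n * n' * q := Nat.le_mul_of_pos_right _ (by omega)
    have h₅ : n * (n' * 200 + 20) = 200 * (n * n') + 20 * n := by ring
    omega
  · obtain ⟨h₀₁, hiff⟩ := hres w w.2 w' w'.2
    have hL : (tsInput K K').arr 2 w = K.L w :=
      table_apply (fun w => (K.L w : ℕ)) w
    have hL' : (tsInput K K').arr 5 w' = K'.L w' :=
      table_apply (fun w => (K'.L w : ℕ)) w'
    rw [hL, hL', lost_iff_losing_ts, Fin.val_inj] at hiff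
    rw [fairSim_eq_strongFairAlt, strongFairAlt_eq_safePair hcard]
    unfold bit
    split_ifs with h
    · exact hiff.2 h
    · exact h₀₁.resolve_right fun h' => h (hiff.1 h')

theorem mul_numTrans_le :
    n * n' * (n * K'.numTrans + n' * K.numTrans) ≤
      2 * (max n n' ^ 3 * max K.numTrans K'.numTrans) := by
  calc n * n' * (n * K'.numTrans + n' * K.numTrans)
      ≤ max n n' * max n n' * (max n n' * max K.numTrans K'.numTrans +
          max n n' * max K.numTrans K'.numTrans) := by
        gcongr <;> first | exact le_max_left _ _ | exact le_max_right _ _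
    _ = _ := by ring

end

end FairSim
-- Assembly of the maximum relations and the two programs
theorem mainTheorem1 :
    (∀ {Obs W A₁ A₂ W' A₁' A₂' : Type*} [Finite W] [Finite A₁] [Finite A₂]
        [Finite W'] [Finite A₁'] [Finite A₂']
        (K : FairATS Obs W A₁ A₂) (K' : FairATS Obs W' A₁' A₂'),
      IsGreatest {S : W → W' → Prop | IsWFAS K K' S} (weakFairAlt K K') ∧
      IsGreatest {S : W → W' → Prop | IsSFAS K K' S} (strongFairAlt K K') ∧
      weakFairAlt K K' = strongFairAlt K K') ∧
    (∃ (p : Prog) (c C : ℕ), ∀ {s n k₁ k₂ n' k₁' k₂' : ℕ}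
        (K : FairATS (Fin s) (Fin n) (Fin k₁) (Fin k₂))
        (K' : FairATS (Fin s) (Fin n') (Fin k₁') (Fin k₂')),
      p.Computes (c * (s + n + k₁ + k₂ + n' + k₁' + k₂') ^ c) (atsInput K K')
        (strongFairAlt K K')
        (C * (n ^ 2 * n' ^ 2 * k₁ ^ 2 * k₁' * (k₁' * k₂' + k₂)))) ∧
    (∀ {Obs W W' : Type*} [Finite W] [Finite W'] (K : FairTS Obs W) (K' : FairTS Obs W'),
      IsGreatest {S : W → W' → Prop | IsFairSimulation K K' S} (fairSim K K')) ∧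
    (∃ (p : Prog) (c C : ℕ), ∀ {s n n' : ℕ}
        (K : FairTS (Fin s) (Fin n)) (K' : FairTS (Fin s) (Fin n')),
      p.Computes (c * (s + n + n') ^ c) (tsInput K K') (fairSim K K')
        (C * (n * n' * (n * K'.numTrans + n' * K.numTrans))) ∧
      p.Computes (c * (s + n + n') ^ c) (tsInput K K') (fairSim K K')
        (C * ((max n n') ^ 3 * max K.numTrans K'.numTrans))) := by
  refine ⟨fun K K' => ⟨isGreatest_weakFairAlt, isGreatest_strongFairAlt,
    weakFairAlt_eq_strongFairAlt⟩, ⟨decideBy 1 5 3 8 emitATS, 570 * 2000, 7000000, fun K K' =>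
    computes_strongFairAlt K K' rfl⟩, fun K K' => isGreatest_fairSim,
    ⟨decideBy 1 3 2 5 emitTS, 570 * 2000, 2 * 4000000, fun K K' => ?_⟩⟩
  have h := computes_fairSim K K' rfl
  refine ⟨h.mono (Nat.mul_le_mul_right _ (by norm_num)), h.mono ?_⟩
  -- The factor `2` in the constant comes from replacing both summands of the first time bound by
  -- their common maximum.
  rw [mul_comm 2, mul_assoc 4000000]
  exact Nat.mul_le_mul_left _ (mul_numTrans_le K K')
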